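/- Let $\mathcal I$ be an ordinary category and let $\mathcal M$ be a simplicial Quillen presheaf on $\mathcal I$, i.e. a pseudofunctor $i\mapsto\mathcal M(i)$, $(\alpha:i\to i')\mapsto(\alpha_!\dashv\alpha^*)$, from $\mathcal I$ to simplicial model categories and simplicial Quillen adjunctions, such that every $\mathcal M(i)$ is combinatorial. For a small simplicial category $\mathcal J$ with a simplicial functor $\varphi:\mathcal J\to\mathcal I$ (where $\mathcal I$ is regarded as having discrete mapping spaces) and $\alpha:\varphi(j)\to\varphi(k)$ in $\mathcal I$, let $\mathrm{Map}^{\alpha}_{\mathcal J}(j,k)\subseteq\mathrm{Map}_{\mathcal J}(j,k)$ be the preimage of $\alpha$. Let $\mathrm{Sec}_{\mathcal J}(\mathcal M)$ be the category of simplicial sections of $\mathcal M$ along $\mathcal J$: an object $s$ consists of objects $s(j)\in\mathcal M(\varphi(j))$ for $j\in\mathcal J$ and maps of simplicial sets $\mathrm{Map}^{\alpha}_{\mathcal J}(j,k)\to\mathrm{Map}_{\mathcal M(\varphi(k))}(\alpha_!s(j),s(k))$ for all $j,k\in\mathcal J$ and $\alpha:\varphi(j)\to\varphi(k)$, compatible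 with identities and composition; a morphism $T:s\to t$ consists of maps $T(j):s(j)\to t(j)$ in $\mathcal M(\varphi(j))$, compatible with these maps. Equivalently, $\mathrm{Sec}_{\mathcal J}(\mathcal M)$ is the category of simplicial functors over $\mathcal I$ from $\mathcal J$ to the simplicial Grothendieck construction $\int\mathcal M$, whose mapping spaces are $\mathrm{Map}((i,X),(i',Y))=\coprod_{\alpha:i\to i'}\mathrm{Map}_{\mathcal M(i')}(\alpha_!X,Y)$. Let $\mathrm{Sec}^{\mathrm{proj}}_{\mathcal J}(\mathcal M)$ be this category with the projective model structure, in which the weak equivalences and the fibrations are defined levelwise and the cofibrations are the maps with the left lifting property against levelwise trivial fibrations. Let $\psi:\mathcal J\to\mathcal J'$ be a simplicial functor between small simplicial categories over $\mathcal I$ (so $\varphi=\varphi'\circ\psi$). Then the projective model structures on $\mathrm{Sec}_{\mathcal J}(\mathcal M)$ and $\mathrm{Sec}_{\mathcal J'}(\mathcal M)$ exist, the restriction functor $\psi^*:\mathrm{Sec}_{\mathcal J'}(\mathcal M)\to\mathrm{Sec}_{\mathcal J}(\mathcal M)$ has a left adjoint $\psi_!$, and $$\psi_!:\mathrm{Sec}^{\mathrm{proj}}_{\mathcal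 J}(\mathcal M)\rightleftarrows\mathrm{Sec}^{\mathrm{proj}}_{\mathcal J'}(\mathcal M):\psi^*$$ is a Quillen adjunction. If moreover $\psi$ is a Dwyer–Kan equivalence, i.e. all the maps $\mathrm{Map}_{\mathcal J}(j,k)\to\mathrm{Map}_{\mathcal J'}(\psi(j),\psi(k))$ are weak homotopy equivalences and every object of $\mathcal J'$ is isomorphic in the homotopy category of $\mathcal J'$ to an object $\psi(j)$, then $\psi_!\dashv\psi^*$ is a Quillen equivalence. -/

import Mathlib

open CategoryTheory MonoidalCategory Simplicial HomotopicalAlgebra SimplicialCategory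

universe v u u'

namespace SimplicialSections

noncomputable section

section SimplicialSets

/-- A map `f : X ⟶ Y` of simplicial sets is a weak homotopy equivalence if for every Kan complex
`Z`, restriction along `f` induces a bijection `π₀ (Map(Y, Z)) → π₀ (Map(X, Z))`. -/
def IsWeakHomotopyEquivalence {X Y : SSet.{v}} (f : X ⟶ Y) : Prop :=
  ∀ (Z : SSet.{v}) [SSet.KanComplex Z],
    Function.Bijective (SSet.mapπ₀ ((MonoidalClosed.pre f).app Z))

end SimplicialSets

section SimplicialFunctors

variable {C : Type u} [Category.{v} C] [SimplicialCategory C]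
  {D : Type u'} [Category.{v} D] [SimplicialCategory D]

/-- The ordinary functor underlying a simplicial functor between simplicial categories. -/
@[simps, reducible]
def underlying (F : EnrichedFunctor SSet.{v} C D) : C ⥤ D where
  obj X := F.obj X
  map {X Y} f := (eHomEquiv SSet.{v}).symm (eHomEquiv SSet.{v} f ≫ F.map X Y)
  map_id X := by
    rw [Equiv.symm_apply_eq, eHomEquiv_id, eHomEquiv_id, F.map_id]
  map_comp {X Y Z} f g := by
    rw [Equiv.symm_apply_eq, eHomEquiv_comp, eHomEquiv_comp, Equiv.apply_symm_apply,
      Equiv.apply_symm_apply, Category.assoc, Category.assoc, F.map_comp,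
      tensorHom_comp_tensorHom_assoc]

/-- A simplicial adjunction `F ⊣ G`: isomorphisms `Map(F X, Y) ≅ Map(X, G Y)` of simplicial sets
which are simplicially natural in `X` and `Y`. -/
structure SimplicialAdjunction (F : EnrichedFunctor SSet.{v} C D)
    (G : EnrichedFunctor SSet.{v} D C) where
  homIso (X : C) (Y : D) : sHom (F.obj X) Y ≅ sHom X (G.obj Y)
  naturality_left (X X' : C) (Y : D) :
    F.map X X' ▷ sHom (F.obj X') Y ≫ sHomComp (F.obj X) (F.obj X') Y ≫ (homIso X Y).hom =
      sHom X X' ◁ (homIso X' Y).hom ≫ sHomComp X X' (G.obj Y)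
  naturality_right (X : C) (Y Y' : D) :
    sHomComp (F.obj X) Y Y' ≫ (homIso X Y').hom =
      ((homIso X Y).hom ⊗ₘ G.map Y Y') ≫ sHomComp X (G.obj Y) (G.obj Y')

/-- Two morphisms of a simplicial category are weakly homotopic if they lie in the same connected
component of the mapping space. -/
def WeaklyHomotopic {X Y : C} (f g : X ⟶ Y) : Prop :=
  SSet.π₀.mk (homEquiv' X Y f) = SSet.π₀.mk (homEquiv' X Y g)

/-- A morphism of a simplicial category which becomes invertible in the homotopy category. -/
def IsHomotopyInvertible {X Y : C} (f : X ⟶ Y) : Prop :=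
  ∃ g : Y ⟶ X, WeaklyHomotopic (f ≫ g) (𝟙 X) ∧ WeaklyHomotopic (g ≫ f) (𝟙 Y)

/-- Dwyer--Kan equivalences of simplicial categories: simplicial functors inducing weak homotopy
equivalences on mapping spaces, and essentially surjective on homotopy categories. -/
structure IsDwyerKanEquivalence (F : EnrichedFunctor SSet.{v} C D) : Prop where
  map_weakEquivalence (X Y : C) : IsWeakHomotopyEquivalence (F.map X Y)
  exists_obj (Y : D) : ∃ (X : C) (f : F.obj X ⟶ Y), IsHomotopyInvertible f

end SimplicialFunctors

section ModelCategories

variable (C : Type u) [Category.{v} C]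

/-- A simplicial category which is tensored over simplicial sets: a bifunctor `K, X ↦ K ⊗ X`,
together with a universal map `K ⟶ Map(X, K ⊗ X)`; the last field says that
`Map(K ⊗ X, Y) ⟶ Map(X, Y) ^ K` is an isomorphism, in terms of maps from an arbitrary `L`. -/
structure SimplicialTensor [SimplicialCategory C] where
  tensor : SSet.{v} ⥤ C ⥤ C
  unit (K : SSet.{v}) (X : C) : K ⟶ sHom X ((tensor.obj K).obj X)
  unit_naturality_left {K L : SSet.{v}} (k : K ⟶ L) (X : C) :
    unit K X ≫ eHomWhiskerLeft SSet.{v} X ((tensor.map k).app X) = k ≫ unit L X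
  unit_naturality_right (K : SSet.{v}) {X Y : C} (f : X ⟶ Y) :
    unit K X ≫ eHomWhiskerLeft SSet.{v} X ((tensor.obj K).map f) =
      unit K Y ≫ eHomWhiskerRight SSet.{v} f ((tensor.obj K).obj Y)
  bijective (K : SSet.{v}) (X Y : C) (L : SSet.{v}) :
    Function.Bijective (fun g : L ⟶ sHom ((tensor.obj K).obj X) Y ↦
      (unit K X ⊗ₘ g) ≫ sHomComp X ((tensor.obj K).obj X) Y)

/-- A simplicial category is cotensored over simplicial sets if for all `K` and `Y` there are
an object `P = Y ^ K` and a map `K ⟶ Map(P, Y)` inducing isomorphisms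
`Map(X, P) ⟶ Map(X, Y) ^ K`. -/
def IsCotensored [SimplicialCategory C] : Prop :=
  ∀ (K : SSet.{v}) (Y : C), ∃ (P : C) (ε : K ⟶ sHom P Y), ∀ (X : C) (L : SSet.{v}),
    Function.Bijective (fun g : L ⟶ sHom X P ↦ (g ⊗ₘ ε) ≫ sHomComp X P Y)

/-- Simplicial model categories: a model structure on a simplicial category which is tensored and
cotensored over simplicial sets and satisfies the pushout-product axiom. -/
def IsSimplicialModelCategory [SimplicialCategory C] [ModelCategory C] : Prop :=
  IsCotensored C ∧ ∃ T : SimplicialTensor C,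
    ∀ {K L : SSet.{v}} (k : K ⟶ L) {A B : C} (i : A ⟶ B) (sq : T.tensor.PushoutObjObj k i),
      Mono k → Cofibration i → Cofibration sq.ι ∧
        (IsWeakHomotopyEquivalence k ∨ WeakEquivalence i → WeakEquivalence sq.ι)

/-- Combinatorial model categories: the underlying category is locally presentable, and the model
structure is generated by sets of cofibrations and of trivial cofibrations. -/
structure IsCombinatorial [ModelCategory C] : Prop where
  isLocallyPresentable : IsLocallyPresentable.{v} C
  exists_generatingCofibrations : ∃ W : MorphismProperty C,
    MorphismProperty.IsSmall.{v} W ∧ trivialFibrations C = W.rlp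
  exists_generatingTrivialCofibrations : ∃ W : MorphismProperty C,
    MorphismProperty.IsSmall.{v} W ∧ fibrations C = W.rlp

variable {C} {D : Type u'} [Category.{v} D] [ModelCategory C] [ModelCategory D]

/-- A functor between model categories that preserves cofibrations and trivial cofibrations. -/
structure PreservesCofibrations (L : C ⥤ D) : Prop where
  cofibration {X Y : C} (f : X ⟶ Y) : Cofibration f → Cofibration (L.map f)
  trivialCofibration {X Y : C} (f : X ⟶ Y) :
    Cofibration f → WeakEquivalence f → Cofibration (L.map f) ∧ WeakEquivalence (L.map f)

/-- An adjunction between model categories is a Quillen adjunction if its left adjoint preserves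
cofibrations and trivial cofibrations. -/
def IsQuillenAdjunction {L : C ⥤ D} {R : D ⥤ C} (_adj : L ⊣ R) : Prop :=
  PreservesCofibrations L

/-- A Quillen adjunction `L ⊣ R` is a Quillen equivalence if for all cofibrant `X` and fibrant
`Y`, a map `L X ⟶ Y` is a weak equivalence iff the adjoint map `X ⟶ R Y` is one. -/
structure IsQuillenEquivalence {L : C ⥤ D} {R : D ⥤ C} (adj : L ⊣ R) : Prop where
  isQuillenAdjunction : IsQuillenAdjunction adj
  weakEquivalence_iff (X : C) (Y : D) (f : L.obj X ⟶ Y) : IsCofibrant X → IsFibrant Y →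
    (WeakEquivalence f ↔ WeakEquivalence (adj.homEquiv X Y f))

end ModelCategories

section QuillenPresheaves

/-- A simplicial Quillen presheaf on an ordinary category `I`: a pseudofunctor from `I` to simplicial
model categories and simplicial Quillen adjunctions `α_! ⊣ α^*`. The structure isomorphisms of
the pseudofunctor are simplicially natural isomorphisms between the left adjoints. -/
structure SimplicialQuillenPresheaf (I : Type u') [Category.{v} I] where
  fiber : I → Type u
  [category (i : I) : Category.{v} (fiber i)]
  [simplicialCategory (i : I) : SimplicialCategory (fiber i)]
  [modelCategory (i : I) : ModelCategory (fiber i)]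
  isSimplicialModelCategory (i : I) : IsSimplicialModelCategory (fiber i)
  push {i j : I} (α : i ⟶ j) : EnrichedFunctor SSet.{v} (fiber i) (fiber j)
  pull {i j : I} (α : i ⟶ j) : EnrichedFunctor SSet.{v} (fiber j) (fiber i)
  adj {i j : I} (α : i ⟶ j) : SimplicialAdjunction (push α) (pull α)
  push_preservesCofibrations {i j : I} (α : i ⟶ j) : PreservesCofibrations (underlying (push α))
  pushId (i : I) (X : fiber i) : (push (𝟙 i)).obj X ≅ X
  pushComp {i j k : I} (α : i ⟶ j) (β : j ⟶ k) (X : fiber i) :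
    (push (α ≫ β)).obj X ≅ (push β).obj ((push α).obj X)
  pushId_naturality (i : I) (X Y : fiber i) :
    (push (𝟙 i)).map X Y ≫ eHomWhiskerLeft SSet.{v} _ (pushId i Y).hom =
      eHomWhiskerRight SSet.{v} (pushId i X).hom Y
  pushComp_naturality {i j k : I} (α : i ⟶ j) (β : j ⟶ k) (X Y : fiber i) :
    (push (α ≫ β)).map X Y ≫ eHomWhiskerLeft SSet.{v} _ (pushComp α β Y).hom =
      (push α).map X Y ≫ (push β).map _ _ ≫ eHomWhiskerRight SSet.{v} (pushComp α β X).hom _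
  pushComp_id_left {i j : I} (α : i ⟶ j) (X : fiber i) :
    (pushComp (𝟙 i) α X).hom ≫ (underlying (push α)).map (pushId i X).hom =
      eqToHom (by rw [Category.id_comp])
  pushComp_id_right {i j : I} (α : i ⟶ j) (X : fiber i) :
    (pushComp α (𝟙 j) X).hom ≫ (pushId j ((push α).obj X)).hom =
      eqToHom (by rw [Category.comp_id])
  pushComp_assoc {i j k l : I} (α : i ⟶ j) (β : j ⟶ k) (γ : k ⟶ l) (X : fiber i) :
    (pushComp (α ≫ β) γ X).hom ≫ (underlying (push γ)).map (pushComp α β X).hom =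
      eqToHom (by rw [Category.assoc]) ≫ (pushComp α (β ≫ γ) X).hom ≫
        (pushComp β γ ((push α).obj X)).hom

attribute [instance] SimplicialQuillenPresheaf.category
  SimplicialQuillenPresheaf.simplicialCategory SimplicialQuillenPresheaf.modelCategory

end QuillenPresheaves

section Over

variable {J : Type u} [Category.{v} J] [SimplicialCategory J] {I : Type u'} [Category.{v} I]

variable (J I) in
/-- A simplicial functor from a simplicial category `J` to an ordinary category `I`, the latter being
regarded as a simplicial category with discrete mapping spaces. -/
structure FunctorToOrdinary where
  obj : J → I
  map {j k : J} {n : SimplexCategoryᵒᵖ} : (sHom j k).obj n → (obj j ⟶ obj k)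
  map_simplicial {j k : J} {n m : SimplexCategoryᵒᵖ} (θ : n ⟶ m) (x : (sHom j k).obj n) :
    map ((sHom j k).map θ x) = map x
  map_id (j : J) (n : SimplexCategoryᵒᵖ) :
    map ((eId SSet.{v} j).app n PUnit.unit) = 𝟙 (obj j)
  map_comp {j k l : J} {n : SimplexCategoryᵒᵖ} (x : (sHom j k).obj n) (y : (sHom k l).obj n) :
    map ((sHomComp j k l).app n ⟨x, y⟩) = map x ≫ map y

namespace FunctorToOrdinary

variable (φ : FunctorToOrdinary J I)

/-- The preimage `Map^α(j, k) ⊆ Map(j, k)` of `α : φ(j) ⟶ φ(k)`. -/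
@[simps]
def mapOver {j k : J} (α : φ.obj j ⟶ φ.obj k) : (sHom j k).Subcomplex where
  obj _ := {x | φ.map x = α}
  map θ x hx := (φ.map_simplicial θ x).trans hx

/-- The identity of `j`, as a vertex of `Map^𝟙(j, j)`. -/
def idOver (j : J) : 𝟙_ SSet.{v} ⟶ (φ.mapOver (𝟙 (φ.obj j)) : SSet.{v}) :=
  SSet.Subcomplex.lift (eId SSet.{v} j) (by
    rintro n _ ⟨⟨⟩, rfl⟩
    exact φ.map_id j n)

/-- The composition `Map^α(j, k) × Map^β(k, l) ⟶ Map^{β ∘ α}(j, l)`. -/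
def compOver {j k l : J} (α : φ.obj j ⟶ φ.obj k) (β : φ.obj k ⟶ φ.obj l) :
    (φ.mapOver α : SSet.{v}) ⊗ (φ.mapOver β : SSet.{v}) ⟶ (φ.mapOver (α ≫ β) : SSet.{v}) :=
  SSet.Subcomplex.lift (((φ.mapOver α).ι ⊗ₘ (φ.mapOver β).ι) ≫ sHomComp j k l) (by
    rintro n _ ⟨⟨⟨x, rfl⟩, ⟨y, rfl⟩⟩, rfl⟩
    exact φ.map_comp x y)

variable {K : Type u} [Category.{v} K] [SimplicialCategory K]

/-- The composite of a simplicial functor `ψ : K ⟶ J` with `φ : J ⟶ I`. -/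
@[simps, reducible]
def precomp (ψ : EnrichedFunctor SSet.{v} K J) : FunctorToOrdinary K I where
  obj j := φ.obj (ψ.obj j)
  map {j k n} x := φ.map ((ψ.map j k).app n x)
  map_simplicial θ x := by
    rw [NatTrans.naturality_apply, φ.map_simplicial]
  map_id j n := by
    rw [← φ.map_id, ← ψ.map_id]
    rfl
  map_comp {j k l n} x y := by
    rw [← φ.map_comp]
    congr 1
    exact ConcreteCategory.congr_hom (NatTrans.congr_app (ψ.map_comp j k l) n) ⟨x, y⟩

/-- The map `Map^α(j, k) ⟶ Map^α(ψ j, ψ k)` induced by `ψ`. -/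
def precompOver (ψ : EnrichedFunctor SSet.{v} K J) {j k : K}
    (α : φ.obj (ψ.obj j) ⟶ φ.obj (ψ.obj k)) :
    ((φ.precomp ψ).mapOver (j := j) (k := k) α : SSet.{v}) ⟶ (φ.mapOver α : SSet.{v}) :=
  SSet.Subcomplex.lift (((φ.precomp ψ).mapOver (j := j) (k := k) α).ι ≫ ψ.map j k) (by
    rintro n _ ⟨⟨x, hx⟩, rfl⟩
    exact hx)

lemma idOver_precompOver (ψ : EnrichedFunctor SSet.{v} K J) (j : K) :
    (φ.precomp ψ).idOver j ≫ φ.precompOver ψ (𝟙 (φ.obj (ψ.obj j))) = φ.idOver (ψ.obj j) := by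
  rw [← cancel_mono (SSet.Subcomplex.ι _)]
  exact ψ.map_id j

lemma compOver_precompOver (ψ : EnrichedFunctor SSet.{v} K J) {j k l : K}
    (α : φ.obj (ψ.obj j) ⟶ φ.obj (ψ.obj k)) (β : φ.obj (ψ.obj k) ⟶ φ.obj (ψ.obj l)) :
    (φ.precomp ψ).compOver (j := j) (k := k) (l := l) α β ≫ φ.precompOver ψ (α ≫ β) =
      (φ.precompOver ψ α ⊗ₘ φ.precompOver ψ β) ≫ φ.compOver α β := by
  rw [← cancel_mono (SSet.Subcomplex.ι _)]
  ext n ⟨⟨x, hx⟩, ⟨y, hy⟩⟩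
  exact ConcreteCategory.congr_hom (NatTrans.congr_app (ψ.map_comp j k l) n) ⟨x, y⟩

end FunctorToOrdinary

end Over

section Sections

variable {I : Type u'} [Category.{v} I] (M : SimplicialQuillenPresheaf.{v, u} I)
  {J : Type v} [Category.{v} J] [SimplicialCategory J]

/-- A simplicial section of `M` along `φ : J ⟶ I`, i.e. a simplicial functor over `I` from `J` to
the simplicial category `∫ M` with objects the pairs `(i, X)`, `X ∈ M(i)`, and mapping spaces
`Map((i, X), (i', Y)) = ∐_{α : i ⟶ i'} Map(α_! X, Y)`. Such a functor consists of
objects `s(j) ∈ M(φ(j))` and, for every `α : φ(j) ⟶ φ(k)`, of a map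
`Map^α(j, k) ⟶ Map(α_! s(j), s(k))`, compatibly with units and composition. -/
structure SimplicialSection (φ : FunctorToOrdinary J I) where
  obj (j : J) : M.fiber (φ.obj j)
  map {j k : J} (α : φ.obj j ⟶ φ.obj k) :
    (φ.mapOver α : SSet.{v}) ⟶ sHom ((M.push α).obj (obj j)) (obj k)
  map_id (j : J) :
    φ.idOver j ≫ map (𝟙 (φ.obj j)) = eHomEquiv SSet.{v} (M.pushId (φ.obj j) (obj j)).hom
  map_comp {j k l : J} (α : φ.obj j ⟶ φ.obj k) (β : φ.obj k ⟶ φ.obj l) :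
    φ.compOver α β ≫ map (α ≫ β) =
      (map α ⊗ₘ map β) ≫ (M.push β).map _ _ ▷ _ ≫ sHomComp _ _ _ ≫
        eHomWhiskerRight SSet.{v} (M.pushComp α β (obj j)).hom (obj l)

namespace SimplicialSection

variable {M} {φ : FunctorToOrdinary J I}

/-- Morphisms of sections are the simplicial natural transformations over `I`. -/
@[ext]
structure Hom (s t : SimplicialSection M φ) where
  app (j : J) : s.obj j ⟶ t.obj j
  naturality {j k : J} (α : φ.obj j ⟶ φ.obj k) :
    s.map α ≫ eHomWhiskerLeft SSet.{v} _ (app k) =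
      t.map α ≫ eHomWhiskerRight SSet.{v} ((underlying (M.push α)).map (app j)) _

/-- The category `Sec_J(M)` of simplicial sections. -/
instance : Category.{v} (SimplicialSection M φ) where
  Hom := Hom
  id s :=
    { app j := 𝟙 (s.obj j)
      naturality α := by
        rw [eHomWhiskerLeft_id, CategoryTheory.Functor.map_id, eHomWhiskerRight_id] }
  comp T T' :=
    { app j := T.app j ≫ T'.app j
      naturality α := by
        rw [eHomWhiskerLeft_comp, ← Category.assoc, T.naturality α, Category.assoc,
          ← eHom_whisker_exchange, ← Category.assoc, T'.naturality α, Category.assoc,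
          CategoryTheory.Functor.map_comp, eHomWhiskerRight_comp] }
  id_comp _ := Hom.ext (funext fun _ ↦ Category.id_comp _)
  comp_id _ := Hom.ext (funext fun _ ↦ Category.comp_id _)
  assoc _ _ _ := Hom.ext (funext fun _ ↦ Category.assoc _ _ _)

/-- A map of sections which is levelwise a fibration. -/
def IsLevelwiseFibration {s t : SimplicialSection M φ} (T : s ⟶ t) : Prop :=
  ∀ j : J, Fibration (Hom.app T j)

/-- A map of sections which is levelwise a weak equivalence. -/
def IsLevelwiseWeakEquivalence {s t : SimplicialSection M φ} (T : s ⟶ t) : Prop :=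
  ∀ j : J, WeakEquivalence (Hom.app T j)

/-- The projective model structure on `Sec_J(M)`: weak equivalences and fibrations are levelwise,
and cofibrations are the maps with the left lifting property against the levelwise trivial
fibrations. -/
structure IsProjective (P : ModelCategory (SimplicialSection M φ)) : Prop where
  weakEquivalence_iff {s t : SimplicialSection M φ} (T : s ⟶ t) :
    WeakEquivalence T ↔ IsLevelwiseWeakEquivalence T
  fibration_iff {s t : SimplicialSection M φ} (T : s ⟶ t) :
    Fibration T ↔ IsLevelwiseFibration T
  cofibration_iff {s t : SimplicialSection M φ} (T : s ⟶ t) :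
    Cofibration T ↔ ∀ {s' t' : SimplicialSection M φ} (T' : s' ⟶ t'),
      IsLevelwiseFibration T' → IsLevelwiseWeakEquivalence T' → HasLiftingProperty T T'

variable (M) {J' : Type v} [Category.{v} J'] [SimplicialCategory J']
  (φ' : FunctorToOrdinary J' I) (ψ : EnrichedFunctor SSet.{v} J J')

variable {M φ'} in
/-- The restriction `ψ^* s` of a section `s` along `J'` to a section along `J`, where `J` lies over
`I` through `ψ : J ⟶ J'`. -/
@[simps, reducible]
def restrict (s : SimplicialSection M φ') : SimplicialSection M (φ'.precomp ψ) where
  obj j := s.obj (ψ.obj j)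
  map α := φ'.precompOver ψ α ≫ s.map α
  map_id j := by
    rw [← Category.assoc, φ'.idOver_precompOver, s.map_id]
  map_comp α β := by
    rw [← Category.assoc, φ'.compOver_precompOver, Category.assoc, s.map_comp,
      ← tensorHom_comp_tensorHom, Category.assoc]

variable {M φ'} in
/-- The restriction of a map of sections. -/
@[simps, reducible]
def Hom.restrict {s t : SimplicialSection M φ'} (T : Hom s t) :
    Hom (s.restrict ψ) (t.restrict ψ) where
  app j := T.app (ψ.obj j)
  naturality {j k} α := by
    have h := congrArg (φ'.precompOver ψ (j := j) (k := k) α ≫ ·) (T.naturality α)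
    exact (Category.assoc _ _ _).trans (h.trans (Category.assoc _ _ _).symm)

/-- The restriction functor `ψ^* : Sec_{J'}(M) ⥤ Sec_J(M)`. -/
def restriction : SimplicialSection M φ' ⥤ SimplicialSection M (φ'.precomp ψ) where
  obj s := s.restrict ψ
  map T := Hom.restrict ψ T

end SimplicialSection

end Sections

end

end SimplicialSections

/-!
Evaluation `s ↦ s(k)` of sections has a left adjoint, the free section with values the coproducts
of the objects `Map^α(k, j) ⊗ α_! X`, and a right adjoint, the cofree section with values the
products of the objects `(α^* E) ^ Map^α(j, k)`. Free sections transfer the generating sets of the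
fibres to sections, and small object arguments give the projective model structure. Since sections
are monadic over families of objects, the adjoint lifting theorem gives a left adjoint of `ψ^*`.

Let `ψ` be a Dwyer-Kan equivalence. Morphisms of sections which are weak equivalences at `j` are so
at any object isomorphic to `j` in the homotopy category, so it remains to see that the unit
`η : X(k) ⟶ (ψ_! X)(ψ k)` is a weak equivalence for `X` cofibrant. Maps out of the source and the
target of `η` are maps from `X` to a cofree section over `J` and to the restriction of a cofree
section over `J'`; let `Q(E)` be the homotopy fibre product of the latter and the paths in the
former. Its values represent families of maps out of the mapping cylinders of the weak homotopy
equivalences `Map^α(j, k) ⟶ Map^α(ψ j, ψ k)`, so that for a fibration `E ⟶ D` the map from `Q(E)` to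
the fibre product of `Q(D)` and the cofree section on `E` is a levelwise trivial fibration. Lifting
maps from `X` against it shows that the inclusion of `X(k)` in the mapping cylinder of `η` is a
trivial cofibration.
-/

namespace SimplicialSections

noncomputable section

/-! ### Simplicial categories -/

section SimplicialCategories

variable {C : Type u} [Category.{v} C] [SimplicialCategory C]
  {D : Type u'} [Category.{v} D] [SimplicialCategory D]

lemma congr_app_apply {X Y : SSet.{v}} {f g : X ⟶ Y} (h : f = g) {n : SimplexCategoryᵒᵖ}
    (x : X.obj n) : f.app n x = g.app n x :=
  ConcreteCategory.congr_hom (NatTrans.congr_app h n) x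

/-- Composition of `n`-simplices of the mapping spaces of a simplicial category. -/
def scomp {X Y Z : C} {n : SimplexCategoryᵒᵖ} (x : (sHom X Y).obj n) (y : (sHom Y Z).obj n) :
    (sHom X Z).obj n :=
  (sHomComp X Y Z).app n ⟨x, y⟩

infixr:80 " ⊚ " => scomp

/-- The totally degenerate `n`-simplex of a mapping space given by a morphism. -/
def degen (n : SimplexCategoryᵒᵖ) {X Y : C} (f : X ⟶ Y) : (sHom X Y).obj n :=
  (eHomEquiv SSet.{v} f).app n PUnit.unit

lemma eHomEquiv_app {X Y : C} (f : X ⟶ Y) {n : SimplexCategoryᵒᵖ} (t : (𝟙_ SSet.{v}).obj n) :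
    (eHomEquiv SSet.{v} f).app n t = degen n f := rfl

lemma degen_zero {X Y : C} (f : X ⟶ Y) : degen (.op ⦋0⦌) f = homEquiv' X Y f := rfl

lemma degen_zero_injective {X Y : C} {f g : X ⟶ Y}
    (h : degen (.op ⦋0⦌) f = degen (.op ⦋0⦌) g) : f = g :=
  (homEquiv' X Y).injective h

lemma map_degen {X Y : C} {n m : SimplexCategoryᵒᵖ} (θ : n ⟶ m) (f : X ⟶ Y) :
    (sHom X Y).map θ (degen n f) = degen m f :=
  (NatTrans.naturality_apply (eHomEquiv SSet.{v} f) θ PUnit.unit).symm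

lemma eId_app (X : C) (n : SimplexCategoryᵒᵖ) (t : (𝟙_ SSet.{v}).obj n) :
    (eId SSet.{v} X).app n t = degen n (𝟙 X) := by
  rw [degen, eHomEquiv_id]
  rfl

@[simp]
lemma scomp_assoc {X Y Z W : C} {n : SimplexCategoryᵒᵖ} (x : (sHom X Y).obj n)
    (y : (sHom Y Z).obj n) (z : (sHom Z W).obj n) : (x ⊚ y) ⊚ z = x ⊚ y ⊚ z :=
  congr_app_apply (e_assoc SSet.{v} X Y Z W) ⟨x, y, z⟩

@[simp]
lemma degen_id_scomp {X Y : C} {n : SimplexCategoryᵒᵖ} (x : (sHom X Y).obj n) :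
    degen n (𝟙 X) ⊚ x = x := by
  rw [← eId_app X n PUnit.unit]
  exact congr_app_apply (e_id_comp SSet.{v} X Y) x

@[simp]
lemma scomp_degen_id {X Y : C} {n : SimplexCategoryᵒᵖ} (x : (sHom X Y).obj n) :
    x ⊚ degen n (𝟙 Y) = x := by
  rw [← eId_app Y n PUnit.unit]
  exact congr_app_apply (e_comp_id SSet.{v} X Y) x

lemma degen_comp (n : SimplexCategoryᵒᵖ) {X Y Z : C} (f : X ⟶ Y) (g : Y ⟶ Z) :
    degen n (f ≫ g) = degen n f ⊚ degen n g := by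
  rw [degen, eHomEquiv_comp]
  rfl

lemma degen_scomp_degen_scomp {n : SimplexCategoryᵒᵖ} {X Y Z W : C} (f : X ⟶ Y) (g : Y ⟶ Z)
    (x : (sHom Z W).obj n) :
    degen n f ⊚ degen n g ⊚ x = degen n (f ≫ g) ⊚ x := by
  rw [degen_comp, scomp_assoc]

lemma enrichedFunctor_map_scomp (F : EnrichedFunctor SSet.{v} C D) {X Y Z : C}
    {n : SimplexCategoryᵒᵖ} (x : (sHom X Y).obj n) (y : (sHom Y Z).obj n) :
    (F.map X Z).app n (x ⊚ y) = (F.map X Y).app n x ⊚ (F.map Y Z).app n y :=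
  congr_app_apply (F.map_comp X Y Z) ⟨x, y⟩

lemma enrichedFunctor_map_degen (F : EnrichedFunctor SSet.{v} C D) {X Y : C}
    {n : SimplexCategoryᵒᵖ} (f : X ⟶ Y) :
    (F.map X Y).app n (degen n f) = degen n ((underlying F).map f) := by
  dsimp only [degen, underlying]
  rw [Equiv.apply_symm_apply]
  rfl

namespace SimplicialAdjunction

variable {F : EnrichedFunctor SSet.{v} C D} {G : EnrichedFunctor SSet.{v} D C}
  (adj : SimplicialAdjunction F G)

lemma homIso_map_scomp {X X' : C} {Y : D} {n : SimplexCategoryᵒᵖ}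
    (x : (sHom X X').obj n) (y : (sHom (F.obj X') Y).obj n) :
    (adj.homIso X Y).hom.app n ((F.map X X').app n x ⊚ y) =
      x ⊚ (adj.homIso X' Y).hom.app n y :=
  congr_app_apply (adj.naturality_left X X' Y) ⟨x, y⟩

lemma homIso_scomp {X : C} {Y Y' : D} {n : SimplexCategoryᵒᵖ}
    (x : (sHom (F.obj X) Y).obj n) (y : (sHom Y Y').obj n) :
    (adj.homIso X Y').hom.app n (x ⊚ y) =
      (adj.homIso X Y).hom.app n x ⊚ (G.map Y Y').app n y :=
  congr_app_apply (adj.naturality_right _ _ _) ⟨x, y⟩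

/-- The bijection on morphisms given by a simplicial adjunction. -/
def homEquiv (X : C) (Y : D) : (F.obj X ⟶ Y) ≃ (X ⟶ G.obj Y) :=
  (homEquiv' _ _).trans (((adj.homIso X Y).app _).toEquiv.trans (homEquiv' _ _).symm)

lemma degen_homEquiv {X : C} {Y : D} (f : F.obj X ⟶ Y) (n : SimplexCategoryᵒᵖ) :
    degen n (adj.homEquiv X Y f) = (adj.homIso X Y).hom.app n (degen n f) := by
  have h : degen (.op ⦋0⦌) (adj.homEquiv X Y f) = (adj.homIso X Y).hom.app _ (degen _ f) :=
    (homEquiv' _ _).apply_symm_apply _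
  rw [← map_degen (SimplexCategory.const n.unop ⦋0⦌ 0).op, h, ← NatTrans.naturality_apply,
    map_degen]

/-- The ordinary adjunction underlying a simplicial adjunction. -/
def toAdjunction : underlying F ⊣ underlying G :=
  Adjunction.mkOfHomEquiv
    { homEquiv X Y := adj.homEquiv X Y
      homEquiv_naturality_left_symm {X X' Y} f g := by
        rw [Equiv.symm_apply_eq]
        apply degen_zero_injective
        rw [adj.degen_homEquiv, degen_comp, degen_comp, ← enrichedFunctor_map_degen,
          adj.homIso_map_scomp, ← adj.degen_homEquiv, Equiv.apply_symm_apply]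
      homEquiv_naturality_right {X Y Y'} f g := by
        apply degen_zero_injective
        rw [adj.degen_homEquiv, degen_comp, degen_comp, ← enrichedFunctor_map_degen,
          adj.homIso_scomp, ← adj.degen_homEquiv] }

end SimplicialAdjunction

namespace SimplicialTensor

variable (T : SimplicialTensor C) {K L : SSet.{v}} {X Y : C}

/-- Morphisms `K ⊗ X ⟶ Y` identify to maps `K ⟶ Map(X, Y)`. -/
def homEquiv (K : SSet.{v}) (X Y : C) : ((T.tensor.obj K).obj X ⟶ Y) ≃ (K ⟶ sHom X Y) :=
  Equiv.ofBijective (fun f ↦ T.unit K X ≫ eHomWhiskerLeft SSet.{v} X f)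
    ((Iso.homFromEquiv (ρ_ K)).bijective.comp
      ((T.bijective K X Y (𝟙_ SSet.{v})).comp (eHomEquiv SSet.{v}).bijective))

lemma homEquiv_apply (f : (T.tensor.obj K).obj X ⟶ Y) :
    T.homEquiv K X Y f = T.unit K X ≫ eHomWhiskerLeft SSet.{v} X f := rfl

lemma homEquiv_comp (f : (T.tensor.obj K).obj X ⟶ Y) {Y' : C} (g : Y ⟶ Y') :
    T.homEquiv K X Y' (f ≫ g) = T.homEquiv K X Y f ≫ eHomWhiskerLeft SSet.{v} X g := by
  simp [homEquiv_apply]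

lemma homEquiv_map_app_comp (k : K ⟶ L) (f : (T.tensor.obj L).obj X ⟶ Y) :
    T.homEquiv K X Y ((T.tensor.map k).app X ≫ f) = k ≫ T.homEquiv L X Y f := by
  rw [homEquiv_comp, homEquiv_apply, homEquiv_apply, T.unit_naturality_left, Category.assoc]

lemma homEquiv_map_comp {X' : C} (x : X ⟶ X') (f : (T.tensor.obj K).obj X' ⟶ Y) :
    T.homEquiv K X Y ((T.tensor.obj K).map x ≫ f) =
      T.homEquiv K X' Y f ≫ eHomWhiskerRight SSet.{v} x Y := by
  rw [homEquiv_comp, homEquiv_apply, homEquiv_apply, T.unit_naturality_right, Category.assoc,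
    Category.assoc, eHom_whisker_exchange]

/-- The adjunction between `- ⊗ X` and `Map(X, -)`. -/
def tensorAdjunction (X : C) : T.tensor.flip.obj X ⊣ (sHomFunctor C).obj (.op X) :=
  Adjunction.mkOfHomEquiv
    { homEquiv K Y := T.homEquiv K X Y
      homEquiv_naturality_left_symm k f :=
        (Equiv.symm_apply_eq _).2 (((T.homEquiv_map_app_comp k _).trans
          (congrArg (k ≫ ·) (Equiv.apply_symm_apply _ f))).symm)
      homEquiv_naturality_right f g := T.homEquiv_comp f g }

/-- Mapping spaces into a limit are limits of mapping spaces. -/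
def isLimitSHom {𝒦 : Type*} [Category 𝒦] {F : 𝒦 ⥤ C} {c : Limits.Cone F}
    (hc : Limits.IsLimit c) (X : C) :
    Limits.IsLimit (((sHomFunctor C).obj (.op X)).mapCone c) :=
  have := (T.tensorAdjunction X).rightAdjoint_preservesLimits
  Limits.isLimitOfPreserves _ hc

end SimplicialTensor

namespace IsCotensored

variable (hC : IsCotensored C)

/-- The cotensor `Y ^ K`. -/
def cotensor (K : SSet.{v}) (Y : C) : C := (hC K Y).choose

/-- The universal map `K ⟶ Map(Y ^ K, Y)`. -/
def counit (K : SSet.{v}) (Y : C) : K ⟶ sHom (hC.cotensor K Y) Y := (hC K Y).choose_spec.choose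

lemma bijective (K : SSet.{v}) (X Y : C) (L : SSet.{v}) :
    Function.Bijective (fun g : L ⟶ sHom X (hC.cotensor K Y) ↦
      (g ⊗ₘ hC.counit K Y) ≫ sHomComp X (hC.cotensor K Y) Y) :=
  (hC K Y).choose_spec.choose_spec X L

/-- Morphisms `X ⟶ Y ^ K` identify to maps `K ⟶ Map(X, Y)`. -/
def homEquiv (K : SSet.{v}) (X Y : C) : (X ⟶ hC.cotensor K Y) ≃ (K ⟶ sHom X Y) :=
  Equiv.ofBijective (fun f ↦ hC.counit K Y ≫ eHomWhiskerRight SSet.{v} f Y)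
    ((Iso.homFromEquiv (λ_ K)).bijective.comp
      ((hC.bijective K X Y (𝟙_ SSet.{v})).comp (eHomEquiv SSet.{v}).bijective))

lemma homEquiv_apply {K : SSet.{v}} {X Y : C} (f : X ⟶ hC.cotensor K Y) :
    hC.homEquiv K X Y f = hC.counit K Y ≫ eHomWhiskerRight SSet.{v} f Y := rfl

lemma homEquiv_comp {K : SSet.{v}} {X X' Y : C} (x : X ⟶ X') (f : X' ⟶ hC.cotensor K Y) :
    hC.homEquiv K X Y (x ≫ f) = hC.homEquiv K X' Y f ≫ eHomWhiskerRight SSet.{v} x Y := by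
  rw [homEquiv_apply, homEquiv_apply, eHomWhiskerRight_comp, Category.assoc]

/-- Mapping spaces out of a colimit are limits of mapping spaces. -/
def isLimitSHom {𝒦 : Type*} [Category 𝒦] {F : 𝒦 ⥤ C} {c : Limits.Cocone F}
    (hc : Limits.IsColimit c) (Y : C) :
    Limits.IsLimit (((sHomFunctor C).flip.obj Y).mapCone c.op) :=
  have := (Adjunction.adjunctionOfEquivLeft (G := (sHomFunctor C).flip.obj Y)
    (fun K X ↦ (opEquiv (.op (hC.cotensor K Y)) X).trans (hC.homEquiv K X.unop Y))
    fun _ _ _ x f ↦ hC.homEquiv_comp x.unop f.unop).rightAdjoint_preservesLimits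
  Limits.isLimitOfPreserves _ hc.op

end IsCotensored

section Powers

variable {ι : Type*}

/-- The object `P` with the maps `K i ⟶ Map(A i, P)` is a simplicial coproduct of the tensors
`K i ⊗ A i`. -/
def IsCopower (K : ι → SSet.{v}) (A : ι → C) (P : C) (u : ∀ i, K i ⟶ sHom (A i) P) : Prop :=
  ∀ (Y : C) (L : SSet.{v}), Function.Bijective
    (fun (g : L ⟶ sHom P Y) (i : ι) ↦ (u i ⊗ₘ g) ≫ sHomComp (A i) P Y)

namespace IsCopower

variable {K : ι → SSet.{v}} {A : ι → C} {P : C} {u : ∀ i, K i ⟶ sHom (A i) P}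

section

variable (h : IsCopower K A P u) {Y : C} {L : SSet.{v}}

/-- The map `L ⟶ Map(P, Y)` determined by maps `K i × L ⟶ Map(A i, Y)`. -/
def desc (k : ∀ i, K i ⊗ L ⟶ sHom (A i) Y) : L ⟶ sHom P Y := ((h Y L).2 k).choose

lemma unit_scomp_desc (k : ∀ i, K i ⊗ L ⟶ sHom (A i) Y) (i : ι) {n : SimplexCategoryᵒᵖ}
    (x : (K i).obj n) (l : L.obj n) :
    (u i).app n x ⊚ (h.desc k).app n l = (k i).app n ⟨x, l⟩ :=
  congr_app_apply (congrFun ((h Y L).2 k).choose_spec i) ⟨x, l⟩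

include h in
lemma ext {g g' : L ⟶ sHom P Y}
    (hg : ∀ (i : ι) (n : SimplexCategoryᵒᵖ) (x : (K i).obj n) (l : L.obj n),
      (u i).app n x ⊚ g.app n l = (u i).app n x ⊚ g'.app n l) : g = g' := by
  refine (h Y L).1 (funext fun i ↦ ?_)
  ext n ⟨x, l⟩
  exact hg i n x l

/-- Morphisms `P ⟶ Y` identify to families of maps `K i ⟶ Map(A i, Y)`. -/
def homEquiv (Y : C) : (P ⟶ Y) ≃ ∀ i, K i ⟶ sHom (A i) Y :=
  Equiv.ofBijective (fun f i ↦ u i ≫ eHomWhiskerLeft SSet.{v} (A i) f)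
    ((Equiv.piCongrRight fun i ↦ Iso.homFromEquiv (ρ_ (K i))).bijective.comp
      ((h Y (𝟙_ SSet.{v})).comp (eHomEquiv SSet.{v}).bijective))

lemma unit_homEquiv_symm (k : ∀ i, K i ⟶ sHom (A i) Y) (i : ι) :
    u i ≫ eHomWhiskerLeft SSet.{v} (A i) ((h.homEquiv Y).symm k) = k i :=
  congrFun ((h.homEquiv Y).apply_symm_apply k) i

include h in
lemma hom_ext {f f' : P ⟶ Y}
    (hf : ∀ i, u i ≫ eHomWhiskerLeft SSet.{v} (A i) f =
      u i ≫ eHomWhiskerLeft SSet.{v} (A i) f') : f = f' :=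
  (h.homEquiv Y).injective (funext hf)

end

lemma map (h : IsCopower K A P u) {F : EnrichedFunctor SSet.{v} C D}
    {G : EnrichedFunctor SSet.{v} D C} (adj : SimplicialAdjunction F G) :
    IsCopower K (fun i ↦ F.obj (A i)) (F.obj P) (fun i ↦ u i ≫ F.map (A i) P) := by
  intro Y L
  let e (L : SSet.{v}) (X : C) : (L ⟶ sHom (F.obj X) Y) ≃ (L ⟶ sHom X (G.obj Y)) :=
    (adj.homIso X Y).homToEquiv
  refine ((Equiv.piCongrRight fun i ↦ e (K i ⊗ L) (A i)).bijective.of_comp_iff' _).1 ?_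
  refine Eq.subst (funext fun g ↦ funext fun i ↦ ?_) ((h (G.obj Y) L).comp (e L P).bijective)
  ext n ⟨x, l⟩
  exact (adj.homIso_map_scomp _ _).symm

end IsCopower

/-- The coproduct of the tensors `K i ⊗ A i`. -/
def copower (T : SimplicialTensor C) (K : ι → SSet.{v}) (A : ι → C)
    [Limits.HasCoproductsOfShape ι C] : C :=
  ∐ fun i ↦ (T.tensor.obj (K i)).obj (A i)

/-- The universal map `K i ⟶ Map(A i, ∐ K i ⊗ A i)`. -/
def copowerUnit (T : SimplicialTensor C) (K : ι → SSet.{v}) (A : ι → C)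
    [Limits.HasCoproductsOfShape ι C] (i : ι) : K i ⟶ sHom (A i) (copower T K A) :=
  T.homEquiv _ _ _ (Limits.Sigma.ι (fun i ↦ (T.tensor.obj (K i)).obj (A i)) i)

lemma isCopower_copower (T : SimplicialTensor C) (hC : IsCotensored C)
    [Limits.HasCoproductsOfShape ι C] (K : ι → SSet.{v}) (A : ι → C) :
    IsCopower K A (copower T K A) (copowerUnit T K A) := by
  intro Y L
  let B (i : ι) : C := (T.tensor.obj (K i)).obj (A i)
  have hB := hC.isLimitSHom (Limits.coproductIsCoproduct B) Y
  have hT := Function.Bijective.piMap fun i ↦ T.bijective (K i) (A i) Y L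
  have hcoprod : Function.Bijective fun (g : L ⟶ sHom (∐ B) Y) (i : ι) ↦
      g ≫ eHomWhiskerRight SSet.{v} (Limits.Sigma.ι B i) Y := by
    refine ⟨fun g g' h ↦ hB.hom_ext fun ⟨⟨i⟩⟩ ↦ congrFun h i, fun k ↦
      ⟨hB.lift { pt := L, π := { app i := k i.unop.as, naturality := ?_ } },
        funext fun i ↦ hB.fac _ (.op ⟨i⟩)⟩⟩
    rintro ⟨⟨i⟩⟩ ⟨⟨i'⟩⟩ ⟨⟨⟨rfl : i' = i⟩⟩⟩
    exact (congrArg (k i' ≫ ·) (eHomWhiskerRight_id SSet.{v} (B i') Y)).symm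
  refine Eq.subst (funext fun g ↦ funext fun i ↦ ?_) (hT.comp hcoprod)
  ext n ⟨x, l⟩
  exact (scomp_assoc _ _ _).symm

/-- The object `Q` with the maps `K i ⟶ Map(F i Q, E)` is a simplicial product of the cotensors of
the images of `E` by the right adjoints of the functors `F i`. -/
def IsPower (K : ι → SSet.{v}) (F : ι → EnrichedFunctor SSet.{v} C D) (E : D) (Q : C)
    (w : ∀ i, K i ⟶ sHom ((F i).obj Q) E) : Prop :=
  ∀ (X : C) (L : SSet.{v}), Function.Bijective
    (fun (g : L ⟶ sHom X Q) (i : ι) ↦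
      ((g ≫ (F i).map X Q) ⊗ₘ w i) ≫ sHomComp ((F i).obj X) ((F i).obj Q) E)

namespace IsPower

variable {K : ι → SSet.{v}} {F : ι → EnrichedFunctor SSet.{v} C D} {E : D} {Q : C}
  {w : ∀ i, K i ⟶ sHom ((F i).obj Q) E} (h : IsPower K F E Q w) {X : C} {L : SSet.{v}}

/-- The map `L ⟶ Map(X, Q)` determined by maps `L × K i ⟶ Map(F i X, E)`. -/
def lift (k : ∀ i, L ⊗ K i ⟶ sHom ((F i).obj X) E) : L ⟶ sHom X Q := ((h X L).2 k).choose

lemma lift_scomp_counit (k : ∀ i, L ⊗ K i ⟶ sHom ((F i).obj X) E) (i : ι)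
    {n : SimplexCategoryᵒᵖ} (l : L.obj n) (x : (K i).obj n) :
    ((F i).map X Q).app n ((h.lift k).app n l) ⊚ (w i).app n x = (k i).app n ⟨l, x⟩ :=
  congr_app_apply (congrFun ((h X L).2 k).choose_spec i) ⟨l, x⟩

include h in
lemma ext {g g' : L ⟶ sHom X Q}
    (hg : ∀ (i : ι) (n : SimplexCategoryᵒᵖ) (l : L.obj n) (x : (K i).obj n),
      ((F i).map X Q).app n (g.app n l) ⊚ (w i).app n x =
        ((F i).map X Q).app n (g'.app n l) ⊚ (w i).app n x) : g = g' := by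
  refine (h X L).1 (funext fun i ↦ ?_)
  ext n ⟨l, x⟩
  exact hg i n l x

end IsPower

/-- The product of the cotensors `(G i E) ^ K i`. -/
def power (hC : IsCotensored C) (K : ι → SSet.{v}) (G : ι → EnrichedFunctor SSet.{v} D C) (E : D)
    [Limits.HasProductsOfShape ι C] : C :=
  ∏ᶜ fun i ↦ hC.cotensor (K i) ((G i).obj E)

/-- The map `K i ⟶ Map(F i (∏ (G i E) ^ K i), E)` adjoint to the projections. -/
def powerCounit (hC : IsCotensored C) (K : ι → SSet.{v}) {F : ι → EnrichedFunctor SSet.{v} C D}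
    {G : ι → EnrichedFunctor SSet.{v} D C} (adj : ∀ i, SimplicialAdjunction (F i) (G i)) (E : D)
    [Limits.HasProductsOfShape ι C] (i : ι) : K i ⟶ sHom ((F i).obj (power hC K G E)) E :=
  hC.homEquiv _ _ _ (Limits.Pi.π (fun i ↦ hC.cotensor (K i) ((G i).obj E)) i) ≫
    ((adj i).homIso _ _).inv

lemma isPower_power (T : SimplicialTensor C) (hC : IsCotensored C)
    [Limits.HasProductsOfShape ι C] (K : ι → SSet.{v})
    {F : ι → EnrichedFunctor SSet.{v} C D} {G : ι → EnrichedFunctor SSet.{v} D C}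
    (adj : ∀ i, SimplicialAdjunction (F i) (G i)) (E : D) :
    IsPower K F E (power hC K G E) (powerCounit hC K adj E) := by
  intro X L
  let R (i : ι) : C := hC.cotensor (K i) ((G i).obj E)
  have hR := T.isLimitSHom (Limits.productIsProduct R) X
  have hcotensor := Function.Bijective.piMap fun i ↦ hC.bijective (K i) X ((G i).obj E) L
  have hprod : Function.Bijective fun (g : L ⟶ sHom X (∏ᶜ R)) (i : ι) ↦
      g ≫ eHomWhiskerLeft SSet.{v} X (Limits.Pi.π R i) := by
    refine ⟨fun g g' h ↦ hR.hom_ext fun ⟨i⟩ ↦ congrFun h i, fun k ↦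
      ⟨hR.lift { pt := L, π := { app i := k i.as, naturality := ?_ } },
        funext fun i ↦ hR.fac _ ⟨i⟩⟩⟩
    rintro ⟨i⟩ ⟨i'⟩ ⟨⟨rfl : i = i'⟩⟩
    exact (congrArg (k i ≫ ·) (eHomWhiskerLeft_id SSet.{v} X (R i))).symm
  let e (i : ι) : (L ⊗ K i ⟶ sHom ((F i).obj X) E) ≃ (L ⊗ K i ⟶ sHom X ((G i).obj E)) :=
    ((adj i).homIso X E).homToEquiv
  refine ((Equiv.piCongrRight e).bijective.of_comp_iff' _).1
    (Eq.subst (funext fun g ↦ funext fun i ↦ ?_) (hcotensor.comp hprod))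
  ext n ⟨l, x⟩
  refine (scomp_assoc _ _ _).trans ((congrArg (g.app n l ⊚ ·) ?_).trans
    ((adj i).homIso_map_scomp _ _).symm)
  have hw : powerCounit hC K adj E i ≫ ((adj i).homIso _ _).hom =
      hC.homEquiv _ _ _ (Limits.Pi.π R i) :=
    (Category.assoc _ _ _).trans
      ((congrArg (_ ≫ ·) (Iso.inv_hom_id _)).trans (Category.comp_id _))
  exact (congr_app_apply hw x).symm

end Powers

end SimplicialCategories

/-! ### Locally presentable categories -/

section Presentability

open Limits

section

variable (C : Type u) [Category.{v} C]

lemma hasColimits_of_isLocallyPresentable (hC : IsLocallyPresentable.{v} C) :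
    HasColimitsOfSize.{v, v} C := by
  obtain ⟨κ, _, h⟩ := hC.exists_cardinal
  infer_instance

lemma hasLimits_of_isLocallyPresentable (hC : IsLocallyPresentable.{v} C) :
    HasLimitsOfSize.{v, v} C := by
  obtain ⟨κ, _, h⟩ := hC.exists_cardinal
  let P := isCardinalPresentable C κ
  let F : SmallModel.{v} P.FullSubcategory ⥤ C := (equivSmallModel _).inverse ⋙ P.ι
  have : F.IsDense := by dsimp only [F]; infer_instance
  have : HasColimitsOfSize.{v, v} C := inferInstance
  have adj := Presheaf.uliftYonedaAdjunction.{v} _ (uliftYoneda.{v}.leftKanExtensionUnit F)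
  have : (Presheaf.restrictedULiftYoneda.{v} F).IsRightAdjoint := adj.isRightAdjoint
  have : Reflective (Presheaf.restrictedULiftYoneda.{v} F) := { L := _, adj := adj }
  exact ⟨fun _ _ ↦ hasLimitsOfShape_of_reflective (Presheaf.restrictedULiftYoneda.{v} F)⟩

end

open MorphismProperty in
lemma hasSmallObjectArgument_ofHoms {S : Type u} [Category.{v} S] [HasColimitsOfSize.{v, v} S]
    {ι : Type v} {A B : ι → S} (f : ∀ a, A a ⟶ B a) (hA : ∀ a, IsPresentable.{v} (A a)) :
    HasSmallObjectArgument.{v} (ofHoms f) := by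
  choose κ₀ hκ₀ h using fun a ↦ (hA a).exists_cardinal
  obtain ⟨κ, hκ, hlt⟩ := HasCardinalLT.exists_regular_cardinal_forall.{v}
    (fun a ↦ (κ₀ a).ord.ToType)
  have : Fact κ.IsRegular := ⟨hκ⟩
  have : Nonempty κ.ord.ToType := by simpa using hκ.ne_zero
  have := WellFoundedLT.toOrderBot κ.ord.ToType
  refine ⟨κ, inferInstance, inferInstance, { preservesColimit := ?_ }⟩
  rintro _ _ X Y _ ⟨a⟩ g hg
  have hle : κ₀ a ≤ κ := by
    have := hlt a
    rw [hasCardinalLT_iff_cardinal_mk_lt, Cardinal.mk_ord_toType] at this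
    exact this.le
  have := h a
  have : IsCardinalPresentable (A a) κ := isCardinalPresentable_of_le _ hle
  have := preservesColimitsOfShape_of_isCardinalPresentable (A a) κ κ.ord.ToType
  infer_instance

lemma isRightAdjoint_pi' {S : Type*} [Category.{v} S] [HasCoproducts.{v} S] {J : Type v}
    {C : J → Type u} [∀ j, Category.{v} (C j)] (G : ∀ j, S ⥤ C j) (hG : ∀ j, (G j).IsRightAdjoint) :
    (Functor.pi' G).IsRightAdjoint := by
  let adj (j : J) := Adjunction.ofIsRightAdjoint (G j)
  let L (X : ∀ j, C j) (j : J) : S := (G j).leftAdjoint.obj (X j)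
  let e (X : ∀ j, C j) (s : S) : (∐ L X ⟶ s) ≃ (X ⟶ (Functor.pi' G).obj s) :=
    { toFun f j := (adj j).homEquiv _ _ (Sigma.ι (L X) j ≫ f)
      invFun g := Sigma.desc fun j ↦ ((adj j).homEquiv _ _).symm (g j)
      left_inv f := Sigma.hom_ext _ _ fun j ↦
        (Sigma.ι_desc _ _).trans (Equiv.symm_apply_apply _ _)
      right_inv g := funext fun j ↦
        (congrArg _ (Sigma.ι_desc _ _)).trans (Equiv.apply_symm_apply _ _) }
  have he (X : ∀ j, C j) (s s' : S) (f : s ⟶ s') (g : ∐ L X ⟶ s) :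
      e X s' (g ≫ f) = e X s g ≫ (Functor.pi' G).map f := funext fun j ↦
    (congrArg ((adj j).homEquiv _ _) (Category.assoc _ _ _).symm).trans
      ((adj j).homEquiv_naturality_right _ _)
  exact (Adjunction.adjunctionOfEquivLeft e he).isRightAdjoint

lemma preservesColimit_pi' {S : Type*} [Category* S] {𝒦 : Type*} [Category* 𝒦] {J : Type*}
    {C : J → Type u} [∀ j, Category.{v} (C j)] (G : ∀ j, S ⥤ C j) (F : 𝒦 ⥤ S)
    [∀ j, PreservesColimit F (G j)] : PreservesColimit F (Functor.pi' G) where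
  preserves {c} hc := by
    let e (t : Cocone (F ⋙ Functor.pi' G)) (j : J) : Cocone (F ⋙ G j) :=
      { pt := t.pt j
        ι := { app k := t.ι.app k j
               naturality k k' a := congrFun (t.ι.naturality a) j } }
    let hc' (j : J) := isColimitOfPreserves (G j) hc
    exact ⟨{
      desc t j := (hc' j).desc (e t j)
      fac t k := funext fun j ↦ (hc' j).fac (e t j) k
      uniq t m hm := funext fun j ↦ (hc' j).uniq (e t j) _ fun k ↦ congrFun (hm k) j }⟩

end Presentability

/-! ### Weak homotopy equivalences of simplicial sets -/

section WeakHomotopyEquivalences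

open Limits SSet Opposite

/-- The functor `X ↦ π₀ Map(X, Z)`. -/
def homπ₀Functor (Z : SSet.{v}) : SSet.{v}ᵒᵖ ⥤ Type v :=
  MonoidalClosed.internalHom.flip.obj Z ⋙ π₀Functor

namespace IsWeakHomotopyEquivalence

variable {X Y W : SSet.{v}} {f : X ⟶ Y} {g : Y ⟶ W}

lemma iff_isIso : IsWeakHomotopyEquivalence f ↔
    ∀ (Z : SSet.{v}) [KanComplex Z], IsIso ((homπ₀Functor Z).map f.op) :=
  forall₂_congr fun Z _ ↦ (isIso_iff_bijective ((homπ₀Functor Z).map f.op)).symm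

lemma of_isIso (f : X ⟶ Y) [IsIso f] : IsWeakHomotopyEquivalence f :=
  iff_isIso.2 fun _ _ ↦ inferInstance

lemma of_retractArrow {X' Y' : SSet.{v}} {f' : X' ⟶ Y'} (hf' : IsWeakHomotopyEquivalence f')
    (h : RetractArrow f f') : IsWeakHomotopyEquivalence f :=
  iff_isIso.2 fun Z _ ↦ (MorphismProperty.isomorphisms _).of_retract
    (h.op.map (homπ₀Functor Z)) (iff_isIso.1 hf' Z)

lemma of_precomp (hf : IsWeakHomotopyEquivalence f) (hfg : IsWeakHomotopyEquivalence (f ≫ g)) :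
    IsWeakHomotopyEquivalence g :=
  iff_isIso.2 fun Z _ ↦ by
    have := iff_isIso.1 hf Z
    have := iff_isIso.1 hfg Z
    rw [op_comp, Functor.map_comp] at this
    exact IsIso.of_isIso_comp_right _ ((homπ₀Functor Z).map f.op)

lemma of_postcomp (hg : IsWeakHomotopyEquivalence g) (hfg : IsWeakHomotopyEquivalence (f ≫ g)) :
    IsWeakHomotopyEquivalence f :=
  iff_isIso.2 fun Z _ ↦ by
    have := iff_isIso.1 hg Z
    have := iff_isIso.1 hfg Z
    rw [op_comp, Functor.map_comp] at this
    exact IsIso.of_isIso_comp_left ((homπ₀Functor Z).map g.op) _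

end IsWeakHomotopyEquivalence

/-- The `i`-th vertex of the interval. -/
abbrev vertex (i : Fin 2) : (Δ[1] : SSet.{v}) _⦋0⦌ := stdSimplex.obj₀Equiv.symm i

/-- The boundary of the interval, as the union of its two vertices. -/
abbrev vertices : (Δ[1] : SSet.{v}).Subcomplex :=
  Subcomplex.ofSimplex (vertex 0) ⊔ Subcomplex.ofSimplex (vertex 1)

lemma bicartSq_vertices : Subcomplex.BicartSq ⊥ (Subcomplex.ofSimplex (vertex.{v} 0))
    (Subcomplex.ofSimplex (vertex 1)) vertices where
  sup_eq := rfl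
  inf_eq := by
    refine le_antisymm ?_ bot_le
    rintro n _ ⟨⟨θ, rfl⟩, ⟨θ', h⟩⟩
    exact one_ne_zero (α := Fin 2) (DFunLike.congr_fun (congrArg stdSimplex.asOrderHom h) 0)

lemma const_app_zero {X Y : SSet.{v}} (y : Y _⦋0⦌) (x : X _⦋0⦌) : (SSet.const y).app _ x = y := by
  have : SimplexCategory.const ⦋0⦌ ⦋0⦌ 0 = 𝟙 _ := Subsingleton.elim _ _
  simp [this]

lemma δ_yonedaEquiv {E : SSet.{v}} (f : (Δ[1] : SSet.{v}) ⟶ E) {i j : Fin 2} {x : E _⦋0⦌}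
    (hij : stdSimplex.δ i = SSet.const (vertex.{v} j))
    (hf : (Subcomplex.ofSimplex (vertex j)).ι ≫ f = SSet.const x) :
    E.δ i (yonedaEquiv f) = x := by
  have h : f.app _ (vertex j) = x :=
    (congr_app_apply hf ⟨vertex j, Subcomplex.mem_ofSimplex_obj _⟩).trans (const_app_zero x _)
  rw [← stdSimplex.yonedaEquiv_δ_comp, hij, SSet.const_comp, h]
  exact const_app_zero x (yonedaEquiv (𝟙 _))

lemma π₀_mk_eq_of_rlp {E F : SSet.{v}} {p : E ⟶ F}
    (hp : ∀ {S T : SSet.{v}} (m : S ⟶ T) [Mono m], HasLiftingProperty m p) {x y : E _⦋0⦌}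
    (h : p.app _ x = p.app _ y) : π₀.mk x = π₀.mk y := by
  have hv := bicartSq_vertices.{v}.isPushout
  let d := hv.desc (SSet.const x) (SSet.const y) (Subsingleton.elim _ _)
  have := hp vertices.ι
  have sq : CommSq d vertices.ι p (SSet.const (p.app _ x)) := ⟨hv.hom_ext
    (by rw [hv.inl_desc_assoc, SSet.const_comp]; rfl)
    (by rw [hv.inr_desc_assoc, SSet.const_comp, ← h]; rfl)⟩
  exact π₀.sound (Edge.mk (yonedaEquiv sq.lift)
    (δ_yonedaEquiv _ stdSimplex.δ_one_eq_const
      ((congrArg (_ ≫ ·) sq.fac_left).trans (hv.inl_desc _ _ _)))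
    (δ_yonedaEquiv _ stdSimplex.δ_zero_eq_const
      ((congrArg (_ ≫ ·) sq.fac_left).trans (hv.inr_desc _ _ _))))

lemma mapπ₀_bijective_of_rlp {E F : SSet.{v}} {p : E ⟶ F}
    (hp : ∀ {S T : SSet.{v}} (m : S ⟶ T) [Mono m], HasLiftingProperty m p) :
    Function.Bijective (mapπ₀ p) := by
  have := hp (initial.to F)
  have sq : CommSq (initial.to E) (initial.to F) p (𝟙 F) := ⟨initial.hom_ext _ _⟩
  have hp' : Function.LeftInverse (mapπ₀ sq.lift) (mapπ₀ p) := fun x ↦ by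
    induction x with | mk x
    exact π₀_mk_eq_of_rlp hp (congr_app_apply sq.fac_right _)
  have hs : Function.RightInverse (mapπ₀ sq.lift) (mapπ₀ p) := fun y ↦ by
    rw [← mapπ₀_comp_apply, sq.fac_right, mapπ₀_id_apply]
  exact ⟨hp'.injective, hs.surjective⟩

open modelCategoryQuillen in
lemma hasLiftingProperty_pre {A B S T : SSet.{v}} {i : A ⟶ B} (hi : anodyneExtensions i)
    (m : S ⟶ T) [Mono m] (Z : SSet.{v}) [KanComplex Z] :
    HasLiftingProperty m ((MonoidalClosed.pre i).app Z) := by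
  let sq₁₂ := Functor.PushoutObjObj.ofHasPushout (curriedTensor SSet.{v}) i m
  let sq₁₃ := Functor.PullbackObjObj.ofIsTerminal
    MonoidalClosed.internalHom i (terminal.from Z) terminalIsTerminal
  refine (MonoidalClosed.internalHomAdjunction₂.hasLiftingProperty_iff sq₁₂ sq₁₃).1 ?_
  exact anodyneExtensions_pushoutObjObjι' sq₁₂ hi _
    ((HomotopicalAlgebra.fibration_iff _).1 ((isFibrant_iff Z).1 inferInstance))

lemma isWeakHomotopyEquivalence_of_anodyne {A B : SSet.{v}} {i : A ⟶ B}
    (hi : anodyneExtensions i) : IsWeakHomotopyEquivalence i := fun Z _ ↦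
  mapπ₀_bijective_of_rlp fun m _ ↦ hasLiftingProperty_pre hi m Z

/-- The inclusion of a vertex in the interval. -/
abbrev vertexι (i : Fin 2) : (Δ[0] : SSet.{v}) ⟶ Δ[1] := SSet.const (vertex i)

lemma vertexι_eq_δ (i j : Fin 2) (hij : i ≠ j) : vertexι.{v} i = stdSimplex.δ j := by
  fin_cases i <;> fin_cases j
  · exact (hij rfl).elim
  · exact stdSimplex.δ_one_eq_const.symm
  · exact stdSimplex.δ_zero_eq_const.symm
  · exact (hij rfl).elim

instance (i : Fin 2) : Mono (vertexι.{v} i) := by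
  obtain ⟨j, hij⟩ := exists_ne i
  rw [vertexι_eq_δ i j hij.symm]
  infer_instance

open modelCategoryQuillen in
lemma anodyneExtensions_vertexι (i : Fin 2) : anodyneExtensions (vertexι.{v} i) := by
  intro E F p hp
  have : Fibration p := ⟨hp⟩
  refine ⟨fun {a b} sq ↦ ?_⟩
  obtain ⟨j, hij⟩ := exists_ne i
  have hk (k : Fin 2) (hk : k ≠ i) : stdSimplex.δ k = vertexι.{v} i :=
    (vertexι_eq_δ i k hk.symm).symm
  obtain ⟨l, h₁, h₂⟩ := horn.IsCompatible.exists_lift (n := 0) (i := i) (f := fun _ _ ↦ a) trivial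
    p b (fun k h ↦ by rw [hk k h]; exact sq.w)
  exact ⟨⟨⟨l, by rw [← hk j hij]; exact h₁ j hij, h₂⟩⟩⟩

lemma isWeakHomotopyEquivalence_vertexι (i : Fin 2) : IsWeakHomotopyEquivalence (vertexι.{v} i) :=
  isWeakHomotopyEquivalence_of_anodyne (anodyneExtensions_vertexι i)

lemma anodyneExtensions_ι₀ (K : SSet.{v}) : anodyneExtensions (ι₀ (X := K)) := by
  let e : K ≅ K ⊗ Δ[0] :=
    { hom := CartesianMonoidalCategory.lift (𝟙 K) (SSet.const (stdSimplex.obj₀Equiv.symm 0))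
      inv := SemiCartesianMonoidalCategory.fst K Δ[0]
      inv_hom_id := by
        ext n ⟨x, y⟩
        rfl }
  have := e.isIso_hom
  have h : ι₀ (X := K) = e.hom ≫ K ◁ vertexι 0 := rfl
  rw [h]
  exact (MorphismProperty.cancel_left_of_respectsIso anodyneExtensions e.hom (K ◁ vertexι 0)).2
    ((anodyneExtensions_vertexι 0).whiskerLeft K)

/-- The mapping cylinder of a map of simplicial sets. -/
def mappingCylinder {K L : SSet.{v}} (f : K ⟶ L) : SSet.{v} := pushout (ι₀ (X := K)) f

namespace mappingCylinder

variable {K L : SSet.{v}} (f : K ⟶ L)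

/-- The map from the cylinder on the source to the mapping cylinder. -/
def inl : K ⊗ Δ[1] ⟶ mappingCylinder f := pushout.inl _ _

/-- The inclusion of the target in the mapping cylinder. -/
def inr : L ⟶ mappingCylinder f := pushout.inr _ _

lemma isPushout : IsPushout ι₀ f (inl f) (inr f) := IsPushout.of_hasPushout _ _

/-- The inclusion of the source in the mapping cylinder. -/
def ι : K ⟶ mappingCylinder f := ι₁ ≫ inl f

variable {f} in
lemma isWeakHomotopyEquivalence_ι (hf : IsWeakHomotopyEquivalence f) :
    IsWeakHomotopyEquivalence (ι f) := by
  let r : mappingCylinder f ⟶ L :=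
    (isPushout f).desc (SemiCartesianMonoidalCategory.fst K Δ[1] ≫ f) (𝟙 L) (by
      rw [Category.comp_id]; rfl)
  have h₁ : inr f ≫ r = 𝟙 L := (isPushout f).inr_desc _ _ _
  have h₂ : ι f ≫ r = f := by
    rw [ι, Category.assoc, (isPushout f).inl_desc]
    rfl
  have h₃ : IsWeakHomotopyEquivalence (inr f) := by
    refine isWeakHomotopyEquivalence_of_anodyne ?_
    exact MorphismProperty.of_isPushout (P := anodyneExtensions) (isPushout f).flip
      (anodyneExtensions_ι₀ K)
  refine (h₃.of_precomp (g := r) ?_).of_postcomp ?_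
  · rw [h₁]
    exact .of_isIso _
  · rwa [h₂]

instance : Mono (ι f) := by
  rw [NatTrans.mono_iff_mono_app]
  intro m
  rw [CategoryTheory.mono_iff_injective]
  have h := (isPushout f).map ((CategoryTheory.evaluation _ _).obj m)
  let g₁ : (K ⊗ Δ[1]).obj m ⟶ Option (K.obj m) :=
    ↾fun x ↦ if x.2 = stdSimplex.const 1 0 m then none else some x.1
  let g₂ : L.obj m ⟶ Option (K.obj m) := ↾fun _ ↦ none
  have hg : ((CategoryTheory.evaluation _ _).obj m).map (ι₀ (X := K)) ≫ g₁ =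
      ((CategoryTheory.evaluation _ _).obj m).map f ≫ g₂ := by
    exact ConcreteCategory.hom_ext _ _ fun x ↦ if_pos rfl
  have hx (x : K.obj m) : h.desc g₁ g₂ hg ((ι f).app m x) = some x := by
    refine (ConcreteCategory.congr_hom (h.inl_desc g₁ g₂ hg) ((ι₁ (X := K)).app m x)).trans ?_
    refine if_neg fun H ↦ ?_
    exact one_ne_zero (α := Fin 2) (DFunLike.congr_fun (congrArg stdSimplex.asOrderHom H) 0)
  intro x y hxy
  have := (hx x).symm.trans ((congrArg _ hxy).trans (hx y))
  simpa using this

end mappingCylinder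

end WeakHomotopyEquivalences

section Components

open Limits SSet Opposite

/-- The discrete simplicial set with two vertices. -/
def discreteBool : SSet.{v} := (Functor.const _).obj (ULift.{v} Bool)

lemma discreteBool_app_eq {n : ℕ} (f : (Δ[n] : SSet.{v}) ⟶ discreteBool) {m m' : SimplexCategoryᵒᵖ}
    (x : (Δ[n] : SSet.{v}).obj m) (x' : (Δ[n] : SSet.{v}).obj m') :
    (f.app m x : ULift.{v} Bool) = f.app m' x' := by
  have key {m : SimplexCategoryᵒᵖ} (x : (Δ[n] : SSet.{v}).obj m) :
      (f.app m x : ULift.{v} Bool) = yonedaEquiv f := by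
    have hx : x = (Δ[n] : SSet.{v}).map (stdSimplex.objEquiv x).op (yonedaEquiv (𝟙 _)) :=
      stdSimplex.objEquiv.injective (Category.comp_id _).symm
    exact (congrArg (f.app m) hx).trans (NatTrans.naturality_apply f _ _)
  exact (key x).trans (key x').symm

instance : KanComplex discreteBool.{v} := by
  rw [KanComplex.iff]
  intro n i f hf
  obtain ⟨j₀, hj₀⟩ := exists_ne i
  have ext {n : ℕ} (g g' : (Δ[n] : SSet.{v}) ⟶ discreteBool) {m : SimplexCategoryᵒᵖ}
      (x x' : (Δ[n] : SSet.{v}).obj m) (h : g.app m x = g'.app m x') : g = g' := by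
    ext m' y
    exact (discreteBool_app_eq g y x).trans (h.trans (discreteBool_app_eq g' x' y))
  refine ⟨SSet.const (yonedaEquiv (f j₀ hj₀) : ULift.{v} Bool), fun j hj ↦ ?_⟩
  cases n with
  | zero =>
    obtain rfl : j = j₀ := by omega
    exact ext _ _ (yonedaEquiv (𝟙 _)) (yonedaEquiv (𝟙 _)) rfl
  | succ n =>
    have hlt (j k : Fin (n + 3)) (hj : j ≠ i) (hk : k ≠ i) (hjk : j < k) : f j hj = f k hk := by
      have h : stdSimplex.δ _ ≫ f j hj = stdSimplex.δ _ ≫ f k hk := hf j k hj hk hjk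
      have h' := congrArg (fun g ↦ yonedaEquiv g) h
      exact ext _ _ _ _ h'
    have heq : f j hj = f j₀ hj₀ := by
      rcases lt_trichotomy j j₀ with h | rfl | h
      · exact hlt _ _ _ _ h
      · rfl
      · exact (hlt _ _ _ _ h).symm
    rw [heq]
    exact ext _ _ (yonedaEquiv (𝟙 _)) (yonedaEquiv (𝟙 _)) rfl

lemma discreteBool_eq_of_π₀_mk_eq {x y : discreteBool.{v} _⦋0⦌} (h : π₀.mk x = π₀.mk y) :
    x = y := by
  have := congrArg (π₀.lift (fun x : discreteBool.{v} _⦋0⦌ ↦ x)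
    (fun x y e ↦ e.src_eq.symm.trans e.tgt_eq)) h
  exact this

/-- The vertex of the mapping space given by a map. -/
def ihomVertex {X Z : SSet.{v}} (g : X ⟶ Z) : 𝟙_ SSet.{v} ⟶ (ihom X).obj Z :=
  MonoidalClosed.curry ((ρ_ X).hom ≫ g)

lemma ihomVertex_comp_pre {X Y Z : SSet.{v}} (f : X ⟶ Y) (g : Y ⟶ Z) :
    ihomVertex g ≫ (MonoidalClosed.pre f).app Z = ihomVertex (f ≫ g) := by
  rw [ihomVertex, ihomVertex, MonoidalClosed.curry_pre_app]
  simp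

/-- A vertex `y` gives an evaluation map `discreteBool ^ Y ⟶ discreteBool`, so two maps in the same
component of `discreteBool ^ Y` take the same value at `y`. -/
lemma discreteBool_app_eq_of_π₀_mk_eq {Y : SSet.{v}} {c c' : Y ⟶ discreteBool}
    (h : π₀.mk ((ihomVertex c).app (op ⦋0⦌) PUnit.unit) =
      π₀.mk ((ihomVertex c').app (op ⦋0⦌) PUnit.unit)) (y : Y _⦋0⦌) :
    c.app _ y = c'.app _ y := by
  let e : (ihom Y).obj discreteBool ⟶ discreteBool :=
    CartesianMonoidalCategory.lift (SSet.const y) (𝟙 _) ≫ (ihom.ev Y).app _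
  have he (g : Y ⟶ discreteBool) :
      e.app _ ((ihomVertex g).app (op ⦋0⦌) PUnit.unit) = g.app _ y := by
    have : ihomVertex g ≫ e = CartesianMonoidalCategory.lift (SSet.const y) (𝟙 _) ≫
        Y ◁ ihomVertex g ≫ (ihom.ev Y).app _ := by rfl
    rw [ihomVertex, ← MonoidalClosed.uncurry_eq, MonoidalClosed.uncurry_curry] at this
    exact (congr_app_apply this PUnit.unit).trans
      (congrArg (g.app _) (const_app_zero (X := 𝟙_ _) y PUnit.unit))
  rw [← he c, ← he c']
  exact discreteBool_eq_of_π₀_mk_eq (congrArg (mapπ₀ e) h)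

lemma discreteBool_hom_ext {Y : SSet.{v}} {c c' : Y ⟶ discreteBool}
    (h : ∀ y : Y _⦋0⦌, c.app _ y = c'.app _ y) : c = c' := by
  refine NatTrans.ext (funext fun n ↦ ConcreteCategory.hom_ext _ _ fun y ↦ ?_)
  have hv (d : Y ⟶ discreteBool) :=
    NatTrans.naturality_apply d (SimplexCategory.const ⦋0⦌ n.unop 0).op y
  exact (hv c).symm.trans ((h _).trans (hv c'))

lemma IsWeakHomotopyEquivalence.cancel_discreteBool {X Y : SSet.{v}} {f : X ⟶ Y}
    (hf : IsWeakHomotopyEquivalence f) {c c' : Y ⟶ discreteBool} (h : f ≫ c = f ≫ c') :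
    c = c' := by
  refine discreteBool_hom_ext fun y ↦ discreteBool_app_eq_of_π₀_mk_eq ((hf discreteBool).1 ?_) y
  have hpre (d : Y ⟶ discreteBool) :=
    congrArg π₀.mk (congr_app_apply (ihomVertex_comp_pre f d) (n := op ⦋0⦌) PUnit.unit)
  have hpre' := hpre c'
  rw [← h] at hpre'
  exact (hpre c).trans hpre'.symm

/-- A subcomplex whose complement is a subcomplex. -/
def IsClopen {X : SSet.{v}} (A : X.Subcomplex) : Prop :=
  ∀ {n m : SimplexCategoryᵒᵖ} (θ : n ⟶ m) (x : X.obj n), X.map θ x ∈ A.obj m → x ∈ A.obj n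

open Classical in
/-- The retraction onto a nonempty clopen subcomplex. -/
def IsClopen.retraction {X : SSet.{v}} {A : X.Subcomplex} (hA : IsClopen A)
    (a : (A : SSet.{v}) _⦋0⦌) : X ⟶ A where
  app n := ↾fun x ↦ if hx : x ∈ A.obj n then ⟨x, hx⟩ else (SSet.const (X := X) a).app n x
  naturality n m θ := by
    refine ConcreteCategory.hom_ext _ _ fun x ↦ ?_
    by_cases hx : x ∈ A.obj n
    · refine (dif_pos (A.map θ hx)).trans (Eq.symm ?_)
      exact congrArg ((A : SSet.{v}).map θ) (dif_pos hx)
    · refine (dif_neg (fun h ↦ hx (hA θ x h))).trans (Eq.symm ?_)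
      exact (congrArg ((A : SSet.{v}).map θ) (dif_neg hx)).trans
        (NatTrans.naturality_apply (SSet.const (X := X) a) θ x).symm

lemma IsClopen.retraction_app_of_mem {X : SSet.{v}} {A : X.Subcomplex} (hA : IsClopen A)
    (a : (A : SSet.{v}) _⦋0⦌) {n} {x : X.obj n} (hx : x ∈ A.obj n) :
    (hA.retraction a).app n x = ⟨x, hx⟩ := dif_pos hx

lemma IsClopen.retraction_app_of_notMem {X : SSet.{v}} {A : X.Subcomplex} (hA : IsClopen A)
    (a : (A : SSet.{v}) _⦋0⦌) {n} {x : X.obj n} (hx : x ∉ A.obj n) :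
    (hA.retraction a).app n x = (SSet.const (X := X) a).app n x := dif_neg hx

lemma IsClopen.ι_retraction {X : SSet.{v}} {A : X.Subcomplex} (hA : IsClopen A)
    (a : (A : SSet.{v}) _⦋0⦌) : A.ι ≫ hA.retraction a = 𝟙 _ := by
  refine NatTrans.ext (funext fun n ↦ ConcreteCategory.hom_ext _ _ fun x ↦ ?_)
  exact hA.retraction_app_of_mem a x.2

open Classical in
/-- The indicator map of a clopen subcomplex. -/
def IsClopen.indicator {X : SSet.{v}} {A : X.Subcomplex} (hA : IsClopen A) : X ⟶ discreteBool where
  app n := ↾fun x ↦ ULift.up (decide (x ∈ A.obj n))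
  naturality n m θ := by
    refine ConcreteCategory.hom_ext _ _ fun x ↦ ?_
    exact congrArg ULift.up (decide_eq_decide.2 ⟨hA θ x, fun h ↦ A.map θ h⟩)

section OfIsClopen

variable {X Y : SSet.{v}} {f : X ⟶ Y} {A : X.Subcomplex} {B : Y.Subcomplex}
  {g : (A : SSet.{v}) ⟶ B}

lemma IsWeakHomotopyEquivalence.of_isClopen_of_vertex (hf : IsWeakHomotopyEquivalence f)
    (hA : IsClopen A) (hB : IsClopen B) (hg : g ≫ B.ι = A.ι ≫ f)
    (hAB : ∀ {n} (x : X.obj n), f.app n x ∈ B.obj n → x ∈ A.obj n)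
    (a : (A : SSet.{v}) _⦋0⦌) : IsWeakHomotopyEquivalence g := by
  have hr : hA.retraction a ≫ g = f ≫ hB.retraction (g.app _ a) := by
    refine NatTrans.ext (funext fun n ↦ ConcreteCategory.hom_ext _ _ fun x ↦ ?_)
    change g.app n ((hA.retraction a).app n x) = (hB.retraction (g.app _ a)).app n (f.app n x)
    by_cases hx : x ∈ A.obj n
    · have hgx : (g.app n ⟨x, hx⟩).1 = f.app n x := congr_app_apply hg (⟨x, hx⟩ : A.toSSet.obj n)
      rw [hA.retraction_app_of_mem a hx,
        hB.retraction_app_of_mem _ (hgx ▸ (g.app n ⟨x, hx⟩).2)]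
      exact Subtype.ext hgx
    · rw [hA.retraction_app_of_notMem a hx, hB.retraction_app_of_notMem _ (mt (hAB x) hx)]
      exact congr_app_apply (SSet.const_comp (X := X) a g) x
  exact hf.of_retractArrow
    { i := Arrow.homMk A.ι B.ι hg.symm
      r := Arrow.homMk (hA.retraction a) (hB.retraction (g.app _ a)) hr
      retract := Arrow.hom_ext _ _ (hA.ι_retraction a) (hB.ι_retraction _) }

lemma IsWeakHomotopyEquivalence.isEmpty_of_isClopen (hf : IsWeakHomotopyEquivalence f)
    (hB : IsClopen B) (hfB : ∀ {n} (x : X.obj n), f.app n x ∉ B.obj n) (n : SimplexCategoryᵒᵖ) :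
    IsEmpty ((B : SSet.{v}).obj n) := by
  classical
  have h : hB.indicator = SSet.const (ULift.up false : discreteBool.{v} _⦋0⦌) :=
    hf.cancel_discreteBool (by ext n x; exact congrArg ULift.up (decide_eq_false (hfB x)))
  exact ⟨fun y ↦ of_decide_eq_false (congrArg ULift.down (congr_app_apply h y.1)) y.2⟩

lemma IsWeakHomotopyEquivalence.of_isClopen (hf : IsWeakHomotopyEquivalence f)
    (hA : IsClopen A) (hB : IsClopen B) (hg : g ≫ B.ι = A.ι ≫ f)
    (hAB : ∀ {n} (x : X.obj n), f.app n x ∈ B.obj n → x ∈ A.obj n) :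
    IsWeakHomotopyEquivalence g := by
  by_cases h : Nonempty ((A : SSet.{v}) _⦋0⦌)
  · exact hf.of_isClopen_of_vertex hA hB hg hAB h.some
  · have hA₀ (n : SimplexCategoryᵒᵖ) : IsEmpty ((A : SSet.{v}).obj n) :=
      ⟨fun x ↦ h ⟨(A : SSet.{v}).map (SimplexCategory.const ⦋0⦌ n.unop 0).op x⟩⟩
    have hB₀ := hf.isEmpty_of_isClopen hB fun {n} x hx ↦ (hA₀ n).false ⟨x, hAB x hx⟩
    have (n : SimplexCategoryᵒᵖ) : IsIso (g.app n) :=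
      (isIso_iff_bijective _).2 ⟨fun x ↦ ((hA₀ n).false x).elim, fun y ↦ ((hB₀ n).false y).elim⟩
    have := NatIso.isIso_of_isIso_app g
    exact .of_isIso g

end OfIsClopen

end Components

/-! ### Gap maps of presheaves of simplicial sets -/

section GapMaps

open Limits Opposite

variable {C : Type u} [Category.{v} C]

lemma comp_map_op_comp {H : Cᵒᵖ ⥤ SSet.{v}} {P Q R : C} {K L : SSet.{v}}
    {a : K ⟶ H.obj (op Q)} {b : L ⟶ H.obj (op R)} {k : K ⟶ L} {f : R ⟶ Q}
    (h : a ≫ H.map f.op = k ≫ b) (g : P ⟶ R) :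
    a ≫ H.map (g ≫ f).op = k ≫ b ≫ H.map g.op := by
  rw [op_comp, Functor.map_comp, reassoc_of% h]

lemma comp_map_op_eq_of_comp_eq {H : Cᵒᵖ ⥤ SSet.{v}} {P Q R S : C}
    {K L N : SSet.{v}} {w : K ⟶ H.obj (op Q)} {u : L ⟶ H.obj (op R)} {s : N ⟶ H.obj (op S)}
    {f : K ⟶ L} {g : K ⟶ N} {fst : P ⟶ R} {snd : P ⟶ S} {m : R ⟶ Q} {n : S ⟶ Q}
    (hm : w ≫ H.map m.op = f ≫ u) (hn : w ≫ H.map n.op = g ≫ s) (h : fst ≫ m = snd ≫ n) :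
    f ≫ u ≫ H.map fst.op = g ≫ s ≫ H.map snd.op := by
  rw [← comp_map_op_comp hm, h, comp_map_op_comp hn]

lemma comp_map_op_comp_app {H H' : Cᵒᵖ ⥤ SSet.{v}} {q : H ⟶ H'}
    {P P' R R' : C} {L : SSet.{v}} {u : L ⟶ H.obj (op R)} {u' : L ⟶ H'.obj (op R')}
    {r : R ⟶ R'} {m : P ⟶ R} {m' : P' ⟶ R'} {f : P ⟶ P'} (hu : u' ≫ H'.map r.op = u ≫ q.app (op R))
    (h : f ≫ m' = m ≫ r) :
    (u' ≫ H'.map m'.op) ≫ H'.map f.op = (u ≫ H.map m.op) ≫ q.app (op P) := by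
  rw [Category.assoc, Category.assoc, ← Functor.map_comp, ← op_comp, h, op_comp,
    Functor.map_comp, reassoc_of% hu, q.naturality]

/-- For presheaves `H` and `H'` of simplicial sets, this is the lifting property of `k` against the
gap map `H B ⟶ H A ×_{H' A} H' B` determined by `f : A ⟶ B` and `p : H ⟶ H'`. -/
def HasGapLiftingProperty {K Z : SSet.{v}} (k : K ⟶ Z) {A B : C} (f : A ⟶ B)
    {H H' : Cᵒᵖ ⥤ SSet.{v}} (p : H ⟶ H') : Prop :=
  ∀ (a : K ⟶ H.obj (op B)) (b : Z ⟶ H.obj (op A)) (c : Z ⟶ H'.obj (op B)),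
    a ≫ H.map f.op = k ≫ b → a ≫ p.app (op B) = k ≫ c → b ≫ p.app (op A) = c ≫ H'.map f.op →
      ∃ z : Z ⟶ H.obj (op B), k ≫ z = a ∧ z ≫ H.map f.op = b ∧ z ≫ p.app (op B) = c

/-- `Q` represents the presheaf of families of maps from `K i` to the values of `H i`, with
universal family `w`. -/
def RepresentsFamilies {ι : Type*} (K : ι → SSet.{v}) (H : ι → Cᵒᵖ ⥤ SSet.{v}) (Q : C)
    (w : ∀ i, K i ⟶ (H i).obj (op Q)) : Prop :=
  ∀ X : C, Function.Bijective (fun (f : X ⟶ Q) i ↦ w i ≫ (H i).map f.op)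

namespace RepresentsFamilies

variable {ι : Type*} {K Z : ι → SSet.{v}} {H H' : ι → Cᵒᵖ ⥤ SSet.{v}} {Q Q' R R' P : C}
  {w : ∀ i, K i ⟶ (H i).obj (op Q)} {w' : ∀ i, K i ⟶ (H' i).obj (op Q')}
  {u : ∀ i, Z i ⟶ (H i).obj (op R)} {u' : ∀ i, Z i ⟶ (H' i).obj (op R')}

lemma hom_ext (hw : RepresentsFamilies K H Q w) {X : C} {f f' : X ⟶ Q}
    (h : ∀ i, w i ≫ (H i).map f.op = w i ≫ (H i).map f'.op) : f = f' :=
  (hw X).1 (funext h)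

lemma exists_hom (hw : RepresentsFamilies K H Q w) {X : C} (k : ∀ i, K i ⟶ (H i).obj (op X)) :
    ∃ f : X ⟶ Q, ∀ i, w i ≫ (H i).map f.op = k i :=
  ((hw X).2 k).imp fun _ ↦ congrFun

lemma hasLiftingProperty_corner (hw : RepresentsFamilies K H Q w)
    (hu : RepresentsFamilies Z H R u) (hu' : RepresentsFamilies Z H' R' u')
    {k : ∀ i, K i ⟶ Z i} {p : ∀ i, H i ⟶ H' i} {A B : C} {f : A ⟶ B}
    (hlift : ∀ i, HasGapLiftingProperty (k i) f (p i)) {m' : R' ⟶ Q'} {q : Q ⟶ Q'}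
    {pr₁ : P ⟶ R'} {pr₂ : P ⟶ Q} (hP : IsPullback pr₁ pr₂ m' q) (corner : R ⟶ P)
    (hm : ∀ i, w i ≫ (H i).map (corner ≫ pr₂).op = k i ≫ u i)
    (hm' : ∀ i, w' i ≫ (H' i).map m'.op = k i ≫ u' i)
    (hq : ∀ i, w' i ≫ (H' i).map q.op = w i ≫ (p i).app _)
    (hr : ∀ i, u' i ≫ (H' i).map (corner ≫ pr₁).op = u i ≫ (p i).app _) :
    HasLiftingProperty f corner := by
  refine ⟨fun {a b} sq ↦ ?_⟩
  have hz (i : ι) := hlift i (w i ≫ (H i).map (b ≫ pr₂).op) (u i ≫ (H i).map a.op)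
    (u' i ≫ (H' i).map (b ≫ pr₁).op)
    (by rw [← reassoc_of% hm i, Category.assoc, ← Functor.map_comp, ← Functor.map_comp, ← op_comp,
      ← op_comp, ← Category.assoc f, ← sq.w, Category.assoc])
    (by rw [← reassoc_of% hm' i, Category.assoc, (p i).naturality, ← reassoc_of% hq i,
      ← Functor.map_comp, ← Functor.map_comp, ← op_comp, ← op_comp, Category.assoc, Category.assoc,
      hP.w])
    (by rw [Category.assoc, (p i).naturality, ← reassoc_of% hr i, Category.assoc,
      ← Functor.map_comp, ← Functor.map_comp, ← op_comp, ← op_comp, ← Category.assoc, sq.w,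
      Category.assoc])
  choose z hz₁ hz₂ hz₃ using hz
  obtain ⟨l, hl⟩ := hu.exists_hom z
  refine ⟨⟨⟨l, hu.hom_ext fun i ↦ ?_, hP.hom_ext (hu'.hom_ext fun i ↦ ?_)
    (hw.hom_ext fun i ↦ ?_)⟩⟩⟩
  · rw [op_comp, Functor.map_comp, reassoc_of% hl i, hz₂]
  · rw [Category.assoc, op_comp, Functor.map_comp, reassoc_of% hr i, ← (p i).naturality,
      reassoc_of% hl i, hz₃]
  · rw [Category.assoc, op_comp, Functor.map_comp, reassoc_of% hm i, hl, hz₁]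

lemma hasLiftingProperty [HasTerminal C] (hw : RepresentsFamilies K H Q w)
    (hw' : RepresentsFamilies K H' Q' w') {p : ∀ i, H i ⟶ H' i} {A B : C} {f : A ⟶ B}
    (hlift : ∀ i, HasGapLiftingProperty (initial.to (K i)) f (p i)) {q : Q ⟶ Q'}
    (hq : ∀ i, w' i ≫ (H' i).map q.op = w i ≫ (p i).app _) : HasLiftingProperty f q := by
  have h₀ : RepresentsFamilies (fun _ ↦ ⊥_ SSet.{v}) H (⊤_ C) fun _ ↦ initial.to _ :=
    fun X ↦ ⟨fun _ _ _ ↦ terminal.hom_ext _ _, fun _ ↦ ⟨terminal.from X,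
      funext fun _ ↦ initial.hom_ext _ _⟩⟩
  have hP : IsPullback (𝟙 Q') (terminal.from Q') (terminal.from Q') (𝟙 (⊤_ C)) :=
    .of_horiz_isIso ⟨terminal.hom_ext _ _⟩
  refine h₀.hasLiftingProperty_corner (w' := fun i ↦ initial.to ((H' i).obj (op (⊤_ C))))
    hw hw' hlift hP q
    (fun _ ↦ initial.hom_ext _ _) (fun _ ↦ initial.hom_ext _ _)
    (fun _ ↦ initial.hom_ext _ _) fun i ↦ ?_
  rw [Category.comp_id, hq]

end RepresentsFamilies

end GapMaps

section MappingPresheaves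

open Limits

variable {C : Type u} [Category.{v} C] [SimplicialCategory C]
  {D : Type u'} [Category.{v} D] [SimplicialCategory D]

/-- The functor sending `E` to the presheaf `X ↦ Map(F X, E)`. -/
def mappingPresheaf (F : EnrichedFunctor SSet.{v} C D) : D ⥤ Cᵒᵖ ⥤ SSet.{v} :=
  (sHomFunctor D).flip ⋙ (Functor.whiskeringLeft _ _ _).obj (underlying F).op

lemma IsPower.representsFamilies {ι : Type*} {K : ι → SSet.{v}}
    {F : ι → EnrichedFunctor SSet.{v} C D} {E : D} {Q : C} {w : ∀ i, K i ⟶ sHom ((F i).obj Q) E}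
    (h : IsPower K F E Q w) :
    RepresentsFamilies K (fun i ↦ (mappingPresheaf (F i)).obj E) Q w := by
  intro X
  have hunit := (h X (𝟙_ SSet.{v})).comp (eHomEquiv SSet.{v}).bijective
  let e (i : ι) : (𝟙_ SSet.{v} ⊗ K i ⟶ sHom ((F i).obj X) E) ≃ (K i ⟶ sHom ((F i).obj X) E) :=
    (λ_ (K i)).homFromEquiv
  refine Eq.subst (funext fun f ↦ funext fun i ↦ ?_)
    ((Equiv.piCongrRight e).bijective.comp hunit)
  ext n x
  exact congrArg (· ⊚ (w i).app n x) (congr_app_apply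
    (Equiv.apply_symm_apply (eHomEquiv SSet.{v}) (eHomEquiv SSet.{v} f ≫ (F i).map X Q))
      PUnit.unit).symm

namespace IsSimplicialModelCategory

variable [ModelCategory D] (hD : IsSimplicialModelCategory D)

/-- A choice of the tensor of a simplicial model category. -/
def tensor : SimplicialTensor D := hD.2.choose

lemma pushoutProduct {K L : SSet.{v}} (k : K ⟶ L) [Mono k] {A B : D} (i : A ⟶ B)
    [Cofibration i] (sq : hD.tensor.tensor.PushoutObjObj k i) :
    Cofibration sq.ι ∧ (IsWeakHomotopyEquivalence k ∨ WeakEquivalence i → WeakEquivalence sq.ι) :=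
  hD.2.choose_spec k i sq inferInstance inferInstance

include hD

lemma exists_sHom_lift {K Z : SSet.{v}} (k : K ⟶ Z) [Mono k] {A B E E' : D} (i : A ⟶ B)
    [Cofibration i] (p : E ⟶ E') [Fibration p]
    (h : IsWeakHomotopyEquivalence k ∨ WeakEquivalence i ∨ WeakEquivalence p)
    (a : K ⟶ sHom B E) (b : Z ⟶ sHom A E) (c : Z ⟶ sHom B E')
    (hab : a ≫ eHomWhiskerRight SSet.{v} i E = k ≫ b)
    (hac : a ≫ eHomWhiskerLeft SSet.{v} B p = k ≫ c)
    (hbc : b ≫ eHomWhiskerLeft SSet.{v} A p = c ≫ eHomWhiskerRight SSet.{v} i E') :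
    ∃ z : Z ⟶ sHom B E, k ≫ z = a ∧ z ≫ eHomWhiskerRight SSet.{v} i E = b ∧
      z ≫ eHomWhiskerLeft SSet.{v} B p = c := by
  let T := hD.tensor
  let sq : T.tensor.PushoutObjObj k i := .ofHasPushout _ _ _
  obtain ⟨h₁, h₂⟩ := hD.pushoutProduct k i sq
  have : HasLiftingProperty sq.ι p := by
    by_cases hp : WeakEquivalence p
    · infer_instance
    · have := h₂ (by tauto)
      infer_instance
  obtain ⟨a, rfl⟩ := (T.homEquiv _ _ _).surjective a
  obtain ⟨b, rfl⟩ := (T.homEquiv _ _ _).surjective b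
  obtain ⟨c, rfl⟩ := (T.homEquiv _ _ _).surjective c
  rw [← T.homEquiv_map_comp, ← T.homEquiv_map_app_comp, EmbeddingLike.apply_eq_iff_eq] at hab
  rw [← T.homEquiv_comp, ← T.homEquiv_map_app_comp, EmbeddingLike.apply_eq_iff_eq] at hac
  rw [← T.homEquiv_map_comp, ← T.homEquiv_comp, EmbeddingLike.apply_eq_iff_eq] at hbc
  have w : CommSq (sq.isPushout.desc b a hab.symm) sq.ι p c :=
    ⟨sq.isPushout.hom_ext (by simp [hbc]) (by simp [hac])⟩
  refine ⟨T.homEquiv _ _ _ w.lift, ?_, ?_, ?_⟩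
  · rw [← T.homEquiv_map_app_comp, ← sq.inr_ι, Category.assoc, w.fac_left, sq.isPushout.inr_desc]
  · rw [← T.homEquiv_map_comp, ← sq.inl_ι, Category.assoc, w.fac_left, sq.isPushout.inl_desc]
  · rw [← T.homEquiv_comp, w.fac_right]

lemma hasGapLiftingProperty_mappingPresheaf [ModelCategory C] {F : EnrichedFunctor SSet.{v} C D}
    (hF : PreservesCofibrations (underlying F)) {K Z : SSet.{v}} (k : K ⟶ Z) [Mono k] {A B : C}
    (f : A ⟶ B) [Cofibration f] {E E' : D} (p : E ⟶ E') [Fibration p]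
    (h : IsWeakHomotopyEquivalence k ∨ WeakEquivalence f ∨ WeakEquivalence p) :
    HasGapLiftingProperty k f ((mappingPresheaf F).map p) := by
  have := hF.cofibration f inferInstance
  have hf (h : WeakEquivalence f) := (hF.trivialCofibration f inferInstance h).2
  exact hD.exists_sHom_lift k ((underlying F).map f) p (by tauto)

end IsSimplicialModelCategory

end MappingPresheaves

/-! ### Homotopies in simplicial model categories -/

section Homotopies

open Limits SSet Opposite

variable {C : Type u} [Category.{v} C] [SimplicialCategory C]
  {D : Type u'} [Category.{v} D] [SimplicialCategory D]

namespace WeaklyHomotopic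

lemma refl {X Y : C} (f : X ⟶ Y) : WeaklyHomotopic f f := rfl

lemma symm {X Y : C} {f g : X ⟶ Y} (h : WeaklyHomotopic f g) : WeaklyHomotopic g f := Eq.symm h

lemma trans {X Y : C} {f g k : X ⟶ Y} (h : WeaklyHomotopic f g) (h' : WeaklyHomotopic g k) :
    WeaklyHomotopic f k := Eq.trans h h'

lemma comp_left {X Y Z : C} (k : X ⟶ Y) {f g : Y ⟶ Z} (h : WeaklyHomotopic f g) :
    WeaklyHomotopic (k ≫ f) (k ≫ g) := by
  have key (f : Y ⟶ Z) : mapπ₀ (eHomWhiskerRight SSet.{v} k Z) (π₀.mk (homEquiv' Y Z f)) =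
      π₀.mk (homEquiv' X Z (k ≫ f)) := congrArg π₀.mk (degen_comp (op ⦋0⦌) k f).symm
  exact (key f).symm.trans ((congrArg _ h).trans (key g))

lemma map (F : EnrichedFunctor SSet.{v} C D) {X Y : C} {f g : X ⟶ Y} (h : WeaklyHomotopic f g) :
    WeaklyHomotopic ((underlying F).map f) ((underlying F).map g) := by
  have key (f : X ⟶ Y) : mapπ₀ (F.map X Y) (π₀.mk (homEquiv' X Y f)) =
      π₀.mk (homEquiv' _ _ ((underlying F).map f)) :=
    congrArg π₀.mk (enrichedFunctor_map_degen F f)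
  exact (key f).symm.trans ((congrArg _ h).trans (key g))

end WeaklyHomotopic

/-- The source (`i = 0`) and the target (`i = 1`) of a homotopy. -/
def endpoint {X Y : C} (h : (Δ[1] : SSet.{v}) ⟶ sHom X Y) (i : Fin 2) : X ⟶ Y :=
  (homEquiv' X Y).symm (h.app (op ⦋0⦌) (stdSimplex.obj₀Equiv.symm i))

lemma degen_zero_endpoint {X Y : C} (h : (Δ[1] : SSet.{v}) ⟶ sHom X Y) (i : Fin 2) :
    degen (op ⦋0⦌) (endpoint h i) = h.app (op ⦋0⦌) (stdSimplex.obj₀Equiv.symm i) :=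
  (homEquiv' X Y).apply_symm_apply _

lemma degen_endpoint {X Y : C} (h : (Δ[1] : SSet.{v}) ⟶ sHom X Y) (i : Fin 2)
    (n : SimplexCategoryᵒᵖ) : degen n (endpoint h i) = h.app n (stdSimplex.const 1 i n) := by
  rw [← map_degen (SimplexCategory.const n.unop ⦋0⦌ 0).op, degen_zero_endpoint,
    ← NatTrans.naturality_apply]
  rfl

lemma vertexι_comp {X Y : C} (h : (Δ[1] : SSet.{v}) ⟶ sHom X Y) (i : Fin 2) :
    vertexι i ≫ h = SSet.const (degen (op ⦋0⦌) (endpoint h i)) := by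
  rw [degen_zero_endpoint]
  exact SSet.const_comp _ _

lemma endpoint_eq_of_vertexι_comp {X Y : C} {h : (Δ[1] : SSet.{v}) ⟶ sHom X Y} {i : Fin 2}
    {f : X ⟶ Y} (hf : vertexι i ≫ h = SSet.const (degen (op ⦋0⦌) f)) : endpoint h i = f := by
  refine degen_zero_injective ?_
  rw [vertexι_comp] at hf
  rw [← yonedaEquiv_const (degen _ (endpoint h i)), hf, yonedaEquiv_const]

lemma endpoint_comp_eHomWhiskerLeft {X Y Z : C} (h : (Δ[1] : SSet.{v}) ⟶ sHom X Y) (g : Y ⟶ Z)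
    (i : Fin 2) : endpoint (h ≫ eHomWhiskerLeft SSet.{v} X g) i = endpoint h i ≫ g := by
  refine degen_zero_injective ?_
  rw [degen_zero_endpoint, degen_comp, degen_zero_endpoint]
  rfl

lemma endpoint_comp_eHomWhiskerRight {X Y Z : C} (g : X ⟶ Y) (h : (Δ[1] : SSet.{v}) ⟶ sHom Y Z)
    (i : Fin 2) : endpoint (h ≫ eHomWhiskerRight SSet.{v} g Z) i = g ≫ endpoint h i := by
  refine degen_zero_injective ?_
  rw [degen_zero_endpoint, degen_comp, degen_zero_endpoint]
  rfl

lemma const_comp_eHomWhiskerLeft {K : SSet.{v}} {X Y Z : C} (f : X ⟶ Y) (g : Y ⟶ Z) :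
    SSet.const (X := K) (degen (op ⦋0⦌) f) ≫ eHomWhiskerLeft SSet.{v} X g =
      SSet.const (degen (op ⦋0⦌) (f ≫ g)) := by
  rw [SSet.const_comp, degen_comp]
  rfl

lemma δ_one_yonedaEquiv_eq {X Y : C} (h : (Δ[1] : SSet.{v}) ⟶ sHom X Y) :
    (sHom X Y).δ 1 (yonedaEquiv h) = homEquiv' X Y (endpoint h 0) := by
  rw [← stdSimplex.yonedaEquiv_δ_comp, ← vertexι_eq_δ 0 1 zero_ne_one, vertexι_comp,
    yonedaEquiv_const, degen_zero]

lemma δ_zero_yonedaEquiv_eq {X Y : C} (h : (Δ[1] : SSet.{v}) ⟶ sHom X Y) :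
    (sHom X Y).δ 0 (yonedaEquiv h) = homEquiv' X Y (endpoint h 1) := by
  rw [← stdSimplex.yonedaEquiv_δ_comp, ← vertexι_eq_δ 1 0 one_ne_zero, vertexι_comp,
    yonedaEquiv_const, degen_zero]

lemma weaklyHomotopic_endpoint {X Y : C} (h : (Δ[1] : SSet.{v}) ⟶ sHom X Y) :
    WeaklyHomotopic (endpoint h 0) (endpoint h 1) :=
  π₀.sound (Edge.mk (yonedaEquiv h) (δ_one_yonedaEquiv_eq h) (δ_zero_yonedaEquiv_eq h))

lemma WeaklyHomotopic.iff_of_endpoint {X Y : C} {f g : X ⟶ Y} (hfg : WeaklyHomotopic f g)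
    (P : (X ⟶ Y) → Prop)
    (hP : ∀ h : (Δ[1] : SSet.{v}) ⟶ sHom X Y, P (endpoint h 0) ↔ P (endpoint h 1)) :
    P f ↔ P g := by
  have hedge (x₀ x₁ : (sHom X Y) _⦋0⦌) (e : Edge x₀ x₁) :
      P ((homEquiv' X Y).symm x₀) = P ((homEquiv' X Y).symm x₁) := by
    have h := hP (yonedaEquiv.symm e.edge)
    have h₀ := δ_one_yonedaEquiv_eq (yonedaEquiv.symm e.edge)
    have h₁ := δ_zero_yonedaEquiv_eq (yonedaEquiv.symm e.edge)
    rw [Equiv.apply_symm_apply, e.src_eq] at h₀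
    rw [Equiv.apply_symm_apply, e.tgt_eq] at h₁
    rw [(Equiv.symm_apply_eq _).2 h₀, (Equiv.symm_apply_eq _).2 h₁]
    exact propext h
  have := congrArg (π₀.lift (fun x ↦ P ((homEquiv' X Y).symm x)) hedge) hfg
  rw [π₀.lift_mk, π₀.lift_mk, Equiv.symm_apply_apply, Equiv.symm_apply_apply] at this
  exact iff_of_eq this

end Homotopies

section CylinderObjects

open Limits SSet Opposite

variable {C : Type u} [Category.{v} C] [SimplicialCategory C]

/-- The end inclusions of the cylinder `Δ[1] ⊗ X`. -/
def SimplicialTensor.cylι (T : SimplicialTensor C) (X : C) (i : Fin 2) :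
    X ⟶ (T.tensor.obj Δ[1]).obj X := endpoint (T.unit Δ[1] X) i

lemma SimplicialTensor.cylι_comp (T : SimplicialTensor C) {X Y : C}
    (f : (T.tensor.obj Δ[1]).obj X ⟶ Y) (i : Fin 2) :
    T.cylι X i ≫ f = endpoint (T.homEquiv _ _ _ f) i :=
  (endpoint_comp_eHomWhiskerLeft _ _ _).symm

lemma SimplicialTensor.endpoint_eq (T : SimplicialTensor C) {X Y : C}
    (h : Δ[1] ⟶ sHom X Y) (i : Fin 2) :
    endpoint h i = T.cylι X i ≫ (T.homEquiv _ _ _).symm h := by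
  rw [T.cylι_comp, Equiv.apply_symm_apply]

lemma IsCotensored.eq_of_isInitial (hC : IsCotensored C) {A : C} (hA : IsInitial A)
    {L : SSet.{v}} {Y : C} (g g' : L ⟶ sHom A Y) : g = g' :=
  (hC.homEquiv L A Y).symm.injective (hA.hom_ext _ _)

variable [ModelCategory C]

namespace IsSimplicialModelCategory

lemma exists_homotopy_lift (hC : IsSimplicialModelCategory C)
    {X E D : C} [IsCofibrant X] (p : E ⟶ D) [Fibration p] (i : Fin 2)
    (h : (Δ[1] : SSet.{v}) ⟶ sHom X D) (f : X ⟶ E) (hf : f ≫ p = endpoint h i) :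
    ∃ h' : (Δ[1] : SSet.{v}) ⟶ sHom X E, endpoint h' i = f ∧
      h' ≫ eHomWhiskerLeft SSet.{v} X p = h := by
  obtain ⟨z, hz₁, -, hz₂⟩ := hC.exists_sHom_lift (vertexι i) (initial.to X) p
    (.inl (isWeakHomotopyEquivalence_vertexι i)) (SSet.const (degen (op ⦋0⦌) f))
    (SSet.const (degen (op ⦋0⦌) (initial.to E))) h
    (hC.1.eq_of_isInitial initialIsInitial _ _)
    (by rw [const_comp_eHomWhiskerLeft, vertexι_comp, hf])
    (hC.1.eq_of_isInitial initialIsInitial _ _)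
  exact ⟨z, endpoint_eq_of_vertexι_comp hz₁, hz₂⟩

lemma trivialCofibrations_cylι (hC : IsSimplicialModelCategory C)
    (T : SimplicialTensor C) (X : C) [IsCofibrant X] (i : Fin 2) :
    trivialCofibrations C (T.cylι X i) := by
  rw [← fibrations_llp]
  intro E D p hp
  have : Fibration p := ⟨hp⟩
  refine ⟨fun {a c} sq ↦ ?_⟩
  obtain ⟨z, hz₁, hz₂⟩ := hC.exists_homotopy_lift p i (T.homEquiv _ _ _ c) a
    (by rw [sq.w, T.cylι_comp])
  refine ⟨⟨⟨(T.homEquiv _ _ _).symm z, ?_, ?_⟩⟩⟩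
  · rw [← T.endpoint_eq, hz₁]
  · apply (T.homEquiv _ _ _).injective
    rw [T.homEquiv_comp, Equiv.apply_symm_apply, hz₂]

lemma weakEquivalence_iff_of_weaklyHomotopic (hC : IsSimplicialModelCategory C)
    {X Y : C} {f g : X ⟶ Y} (h : WeaklyHomotopic f g) :
    WeakEquivalence f ↔ WeakEquivalence g := by
  let T := hC.tensor
  obtain ⟨X', q, hX', hq⟩ : ∃ (X' : C) (q : X' ⟶ X), IsCofibrant X' ∧ WeakEquivalence q := by
    let d := MorphismProperty.factorizationData (cofibrations C) (trivialFibrations C)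
      (initial.to X)
    exact ⟨d.Z, d.p, (isCofibrant_iff_of_isInitial d.i initialIsInitial).2 ⟨d.hi⟩, ⟨d.hp.2⟩⟩
  refine h.iff_of_endpoint (fun f ↦ WeakEquivalence f) fun h ↦ ?_
  rw [← weakEquivalence_precomp_iff q, ← weakEquivalence_precomp_iff q (endpoint h 1),
    ← endpoint_comp_eHomWhiskerRight, ← endpoint_comp_eHomWhiskerRight, T.endpoint_eq,
    T.endpoint_eq]
  have h₀ : WeakEquivalence (T.cylι X' 0) := ⟨(hC.trivialCofibrations_cylι T X' 0).2⟩
  have h₁ : WeakEquivalence (T.cylι X' 1) := ⟨(hC.trivialCofibrations_cylι T X' 1).2⟩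
  rw [weakEquivalence_precomp_iff, weakEquivalence_precomp_iff]

lemma exists_section_of_weaklyHomotopic (hC : IsSimplicialModelCategory C)
    {X E D : C} [IsCofibrant X] (p : E ⟶ D) [Fibration p]
    {f : X ⟶ E} {g : X ⟶ D} (h : WeaklyHomotopic (f ≫ p) g) :
    ∃ f' : X ⟶ E, f' ≫ p = g ∧ WeaklyHomotopic f f' := by
  refine (h.iff_of_endpoint (fun g ↦ ∃ f' : X ⟶ E, f' ≫ p = g ∧ WeaklyHomotopic f f') ?_).1
    ⟨f, rfl, .refl f⟩
  intro h
  constructor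
  · rintro ⟨f', hf', hff'⟩
    obtain ⟨hh, rfl, rfl⟩ := hC.exists_homotopy_lift p 0 h f' hf'
    exact ⟨endpoint hh 1, (endpoint_comp_eHomWhiskerLeft _ _ _).symm,
      hff'.trans (weaklyHomotopic_endpoint hh)⟩
  · rintro ⟨f', hf', hff'⟩
    obtain ⟨hh, rfl, rfl⟩ := hC.exists_homotopy_lift p 1 h f' hf'
    exact ⟨endpoint hh 0, (endpoint_comp_eHomWhiskerLeft _ _ _).symm,
      hff'.trans (weaklyHomotopic_endpoint hh).symm⟩

lemma weakEquivalence_of_two_out_of_six (hC : IsSimplicialModelCategory C)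
    {U V X Y : C}
    [IsCofibrant V] (u : U ⟶ V) (v : V ⟶ X) (w : X ⟶ Y) (huv : WeakEquivalence (u ≫ v))
    (θ : V ⟶ Y) [IsIso θ] (h : WeaklyHomotopic (v ≫ w) θ) : WeakEquivalence w := by
  let d := MorphismProperty.factorizationData (trivialCofibrations C) (fibrations C) w
  have : Fibration d.p := ⟨d.hp⟩
  have : WeakEquivalence d.i := ⟨d.hi.2⟩
  obtain ⟨v', hv', hvv'⟩ := hC.exists_section_of_weaklyHomotopic d.p (f := v ≫ d.i) (g := θ)
    (by rwa [Category.assoc, d.fac])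
  have h₁ : WeakEquivalence (u ≫ v') := by
    refine (hC.weakEquivalence_iff_of_weaklyHomotopic (hvv'.comp_left u)).1 ?_
    rw [← Category.assoc]
    infer_instance
  have h₂ : WeakEquivalence (d.p ≫ inv θ ≫ v') := by
    rw [← weakEquivalence_precomp_iff (u ≫ v')]
    have h₃ : (u ≫ v') ≫ d.p ≫ inv θ ≫ v' = u ≫ v' := by
      rw [Category.assoc, ← Category.assoc v', hv', IsIso.hom_inv_id_assoc]
    rwa [h₃]
  have h₃ : WeakEquivalence d.p := by
    refine ⟨MorphismProperty.of_retract (P := weakEquivalences C) (f := d.p)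
      (g := d.p ≫ inv θ ≫ v')
      ⟨Arrow.homMk (𝟙 _) (inv θ ≫ v') ?_, Arrow.homMk (𝟙 _) d.p ?_, ?_⟩ h₂.1⟩
    · exact Category.id_comp _
    · simp [hv']
    · ext
      · exact Category.id_comp _
      · simp [hv']
  rw [← d.fac]
  infer_instance

end IsSimplicialModelCategory

end CylinderObjects

section LeftQuillen

open Limits

variable {C : Type u} [Category.{v} C] [ModelCategory C] {D : Type u'} [Category.{v} D]
  [ModelCategory D] {F : C ⥤ D}

lemma PreservesCofibrations.isCofibrant_obj (hF : PreservesCofibrations F) [F.IsLeftAdjoint]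
    (X : C) [IsCofibrant X] : IsCofibrant (F.obj X) :=
  (isCofibrant_iff_of_isInitial (F.map (initial.to X)) (initialIsInitial.isInitialObj F _)).2
    (hF.cofibration _ inferInstance)

lemma PreservesCofibrations.weakEquivalence_map (hF : PreservesCofibrations F) {X Y : C}
    [IsCofibrant X] [IsCofibrant Y] (f : X ⟶ Y) [WeakEquivalence f] :
    WeakEquivalence (F.map f) := by
  let h : CofibrantBrownFactorization f := Classical.arbitrary _
  have : Cofibration h.i := ⟨h.hi⟩
  have h₁ := (hF.trivialCofibration h.i inferInstance inferInstance).2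
  have h₂ := (hF.trivialCofibration h.s inferInstance inferInstance).2
  have h₃ : WeakEquivalence (F.map h.p) := by
    have : WeakEquivalence (F.map h.s ≫ F.map h.p) := by
      rw [← F.map_comp, h.s_p, F.map_id]
      infer_instance
    exact weakEquivalence_of_precomp (F.map h.s) _
  rw [← h.fac, F.map_comp]
  infer_instance

end LeftQuillen

section PathObjects

open Limits Opposite SSet

variable {C : Type u} [Category.{v} C] [SimplicialCategory C]

namespace IsCotensored

variable (hC : IsCotensored C)

/-- The functoriality of the cotensor `Y ^ K` in `Y`. -/
def cotensorMap (K : SSet.{v}) {Y Z : C} (p : Y ⟶ Z) : hC.cotensor K Y ⟶ hC.cotensor K Z :=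
  (hC.homEquiv K _ Z).symm (hC.counit K Y ≫ eHomWhiskerLeft SSet.{v} _ p)

lemma counit_comp_eHomWhiskerRight_cotensorMap (K : SSet.{v}) {Y Z : C} (p : Y ⟶ Z) :
    hC.counit K Z ≫ eHomWhiskerRight SSet.{v} (hC.cotensorMap K p) Z =
      hC.counit K Y ≫ eHomWhiskerLeft SSet.{v} _ p := by
  rw [← hC.homEquiv_apply]
  exact Equiv.apply_symm_apply _ _

lemma cotensorMap_comp_endpoint_counit {Y Z : C} (p : Y ⟶ Z) (i : Fin 2) :
    hC.cotensorMap Δ[1] p ≫ endpoint (hC.counit Δ[1] Z) i =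
      endpoint (hC.counit Δ[1] Y) i ≫ p := by
  rw [← endpoint_comp_eHomWhiskerRight, counit_comp_eHomWhiskerRight_cotensorMap,
    endpoint_comp_eHomWhiskerLeft]

/-- The map `L ⊗ K ⟶ Map(X, Y)` corresponding to `L ⟶ Map(X, Y ^ K)`. -/
def uncurry {L K : SSet.{v}} {X Y : C} (g : L ⟶ sHom X (hC.cotensor K Y)) : L ⊗ K ⟶ sHom X Y :=
  (g ⊗ₘ hC.counit K Y) ≫ sHomComp X (hC.cotensor K Y) Y

lemma uncurry_comp_eHomWhiskerRight {L K : SSet.{v}} {X Y W : C}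
    (g : L ⟶ sHom X (hC.cotensor K Y)) (x : W ⟶ X) :
    hC.uncurry g ≫ eHomWhiskerRight SSet.{v} x Y =
      hC.uncurry (g ≫ eHomWhiskerRight SSet.{v} x _) := by
  ext n ⟨s, t⟩
  exact (scomp_assoc _ _ _).symm

lemma uncurry_comp_eHomWhiskerLeft {L K : SSet.{v}} {X Y Z : C}
    (g : L ⟶ sHom X (hC.cotensor K Y)) (p : Y ⟶ Z) :
    hC.uncurry g ≫ eHomWhiskerLeft SSet.{v} X p =
      hC.uncurry (g ≫ eHomWhiskerLeft SSet.{v} X (hC.cotensorMap K p)) := by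
  ext n ⟨s, t⟩
  refine (scomp_assoc _ _ _).trans (Eq.trans ?_ (scomp_assoc _ _ _).symm)
  exact congrArg (g.app n s ⊚ ·)
    (congr_app_apply (hC.counit_comp_eHomWhiskerRight_cotensorMap K p).symm t)

lemma ι₀_comp_uncurry {L : SSet.{v}} {X Y : C} (g : L ⟶ sHom X (hC.cotensor Δ[1] Y)) :
    ι₀ ≫ hC.uncurry g = g ≫ eHomWhiskerLeft SSet.{v} X (endpoint (hC.counit Δ[1] Y) 0) := by
  ext n x
  exact congrArg (g.app n x ⊚ ·) (degen_endpoint (hC.counit Δ[1] Y) 0 n).symm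

lemma ι₁_comp_uncurry {L : SSet.{v}} {X Y : C} (g : L ⟶ sHom X (hC.cotensor Δ[1] Y)) :
    ι₁ ≫ hC.uncurry g = g ≫ eHomWhiskerLeft SSet.{v} X (endpoint (hC.counit Δ[1] Y) 1) := by
  ext n x
  exact congrArg (g.app n x ⊚ ·) (degen_endpoint (hC.counit Δ[1] Y) 1 n).symm

lemma representsFamilies_uncurry {ι : Type*} {L : ι → SSet.{v}} {K : SSet.{v}}
    {D : Type u'} [Category.{v} D] [SimplicialCategory D] {F : ι → EnrichedFunctor SSet.{v} D C}
    {Y : C} {Q : D} {w : ∀ i, L i ⟶ sHom ((F i).obj Q) (hC.cotensor K Y)}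
    (hw : RepresentsFamilies L (fun i ↦ (mappingPresheaf (F i)).obj (hC.cotensor K Y)) Q w) :
    RepresentsFamilies (fun i ↦ L i ⊗ K) (fun i ↦ (mappingPresheaf (F i)).obj Y) Q
      fun i ↦ hC.uncurry (w i) :=
  fun X ↦ Eq.subst
    (funext fun _ ↦ funext fun i ↦ (hC.uncurry_comp_eHomWhiskerRight (w i) _).symm)
    ((Function.Bijective.piMap fun i ↦ hC.bijective K ((F i).obj X) Y (L i)).comp (hw X))

end IsCotensored

lemma RepresentsFamilies.of_isPullback {ι : Type*} {D : Type u} [Category.{v} D]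
    {K L N Z : ι → SSet.{v}} {H : ι → Dᵒᵖ ⥤ SSet.{v}} {Q R S P : D}
    {w : ∀ i, K i ⟶ (H i).obj (op Q)} {u : ∀ i, L i ⟶ (H i).obj (op R)}
    {s : ∀ i, N i ⟶ (H i).obj (op S)} {z : ∀ i, Z i ⟶ (H i).obj (op P)}
    (hw : RepresentsFamilies K H Q w) (hu : RepresentsFamilies L H R u)
    (hs : RepresentsFamilies N H S s) {f : ∀ i, K i ⟶ L i} {g : ∀ i, K i ⟶ N i}
    {a : ∀ i, L i ⟶ Z i} {b : ∀ i, N i ⟶ Z i} (hZ : ∀ i, IsPushout (f i) (g i) (a i) (b i))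
    {fst : P ⟶ R} {snd : P ⟶ S} {m : R ⟶ Q} {n : S ⟶ Q} (hP : IsPullback fst snd m n)
    (hm : ∀ i, w i ≫ (H i).map m.op = f i ≫ u i) (hn : ∀ i, w i ≫ (H i).map n.op = g i ≫ s i)
    (ha : ∀ i, a i ≫ z i = u i ≫ (H i).map fst.op)
    (hb : ∀ i, b i ≫ z i = s i ≫ (H i).map snd.op) :
    RepresentsFamilies Z H P z := by
  have hfst (i : ι) {X : D} (l : X ⟶ P) :
      a i ≫ z i ≫ (H i).map l.op = u i ≫ (H i).map (l ≫ fst).op :=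
    (comp_map_op_comp (ha i).symm l).symm
  have hsnd (i : ι) {X : D} (l : X ⟶ P) :
      b i ≫ z i ≫ (H i).map l.op = s i ≫ (H i).map (l ≫ snd).op :=
    (comp_map_op_comp (hb i).symm l).symm
  refine fun X ↦ ⟨fun l l' h ↦ hP.hom_ext (hu.hom_ext fun i ↦ ?_) (hs.hom_ext fun i ↦ ?_),
    fun k ↦ ?_⟩
  · rw [← hfst, ← hfst]
    exact congrArg (a i ≫ ·) (congrFun h i)
  · rw [← hsnd, ← hsnd]
    exact congrArg (b i ≫ ·) (congrFun h i)
  · obtain ⟨x, hx⟩ := hu.exists_hom fun i ↦ a i ≫ k i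
    obtain ⟨y, hy⟩ := hs.exists_hom fun i ↦ b i ≫ k i
    have hxy : x ≫ m = y ≫ n := hw.hom_ext fun i ↦ by
      rw [op_comp, op_comp, Functor.map_comp, Functor.map_comp, reassoc_of% hm i,
        reassoc_of% hn i, hx, hy, (hZ i).w_assoc]
    refine ⟨hP.lift x y hxy, funext fun i ↦ (hZ i).hom_ext ?_ ?_⟩
    · rw [hfst, hP.lift_fst, hx]
    · rw [hsnd, hP.lift_snd, hy]

end PathObjects

/-! ### Free and cofree sections -/

namespace SimplicialQuillenPresheaf

variable {I : Type u'} [Category.{v} I] (M : SimplicialQuillenPresheaf.{v, u} I)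

lemma map_scomp_degen_pushId (i : I) {X Y : M.fiber i} {n : SimplexCategoryᵒᵖ}
    (x : (sHom X Y).obj n) :
    ((M.push (𝟙 i)).map X Y).app n x ⊚ degen n (M.pushId i Y).hom =
      degen n (M.pushId i X).hom ⊚ x :=
  congr_app_apply (M.pushId_naturality i X Y) x

lemma map_scomp_degen_pushComp {i j k : I} (α : i ⟶ j) (β : j ⟶ k) {X Y : M.fiber i}
    {n : SimplexCategoryᵒᵖ} (x : (sHom X Y).obj n) :
    ((M.push (α ≫ β)).map X Y).app n x ⊚ degen n (M.pushComp α β Y).hom =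
      degen n (M.pushComp α β X).hom ⊚
        ((M.push β).map _ _).app n (((M.push α).map X Y).app n x) :=
  congr_app_apply (M.pushComp_naturality α β X Y) x

lemma map_scomp_degen_pushComp_scomp {i j k : I} (α : i ⟶ j) (β : j ⟶ k) {X Y : M.fiber i}
    {n : SimplexCategoryᵒᵖ} (x : (sHom X Y).obj n) {Z : M.fiber k} (z : (sHom _ Z).obj n) :
    ((M.push (α ≫ β)).map X Y).app n x ⊚ degen n (M.pushComp α β Y).hom ⊚ z =
      degen n (M.pushComp α β X).hom ⊚
        ((M.push β).map _ _).app n (((M.push α).map X Y).app n x) ⊚ z := by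
  rw [← scomp_assoc, map_scomp_degen_pushComp, scomp_assoc]

lemma map_map_scomp_degen_pushComp_inv_scomp {i j k : I} (α : i ⟶ j) (β : j ⟶ k) {X Y : M.fiber i}
    {n : SimplexCategoryᵒᵖ} (x : (sHom X Y).obj n) {Z : M.fiber k} (z : (sHom _ Z).obj n) :
    ((M.push β).map _ _).app n (((M.push α).map X Y).app n x) ⊚
      degen n (M.pushComp α β Y).inv ⊚ z =
    degen n (M.pushComp α β X).inv ⊚ ((M.push (α ≫ β)).map X Y).app n x ⊚ z := by
  have h := congrArg (degen n (M.pushComp α β X).inv ⊚ ·)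
    (M.map_scomp_degen_pushComp_scomp α β x (degen n (M.pushComp α β Y).inv ⊚ z))
  dsimp only at h
  rw [degen_scomp_degen_scomp, Iso.hom_inv_id, degen_id_scomp, degen_scomp_degen_scomp,
    Iso.inv_hom_id, degen_id_scomp] at h
  exact h.symm

lemma pushId_hom_naturality (i : I) {X Y : M.fiber i} (f : X ⟶ Y) :
    (underlying (M.push (𝟙 i))).map f ≫ (M.pushId i Y).hom = (M.pushId i X).hom ≫ f := by
  apply degen_zero_injective
  rw [degen_comp, degen_comp, ← enrichedFunctor_map_degen, map_scomp_degen_pushId]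

lemma pushComp_hom_naturality {i j k : I} (α : i ⟶ j) (β : j ⟶ k) {X Y : M.fiber i} (f : X ⟶ Y) :
    (underlying (M.push (α ≫ β))).map f ≫ (M.pushComp α β Y).hom =
      (M.pushComp α β X).hom ≫ (underlying (M.push β)).map ((underlying (M.push α)).map f) := by
  apply degen_zero_injective
  rw [degen_comp, degen_comp, ← enrichedFunctor_map_degen, map_scomp_degen_pushComp,
    ← enrichedFunctor_map_degen, ← enrichedFunctor_map_degen]

lemma pushComp_inv_comp_eqToHom_right {i j : I} (α : i ⟶ j) (X : M.fiber i)
    (h : (M.push (α ≫ 𝟙 j)).obj X = (M.push α).obj X) :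
    (M.pushComp α (𝟙 j) X).inv ≫ eqToHom h = (M.pushId j ((M.push α).obj X)).hom := by
  rw [Iso.inv_comp_eq, M.pushComp_id_right]

lemma pushComp_inv_comp_eqToHom_left {i j : I} (α : i ⟶ j) (X : M.fiber i)
    (h : (M.push (𝟙 i ≫ α)).obj X = (M.push α).obj X) :
    (M.pushComp (𝟙 i) α X).inv ≫ eqToHom h =
      (underlying (M.push α)).map (M.pushId i X).hom := by
  rw [Iso.inv_comp_eq, M.pushComp_id_left]

lemma pushComp_assoc_inv {i j k l : I} (α : i ⟶ j) (β : j ⟶ k) (γ : k ⟶ l)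
    (X : M.fiber i)
    (h : (M.push ((α ≫ β) ≫ γ)).obj X = (M.push (α ≫ β ≫ γ)).obj X) :
    (M.pushComp β γ ((M.push α).obj X)).hom ≫
      (underlying (M.push γ)).map (M.pushComp α β X).inv ≫ (M.pushComp (α ≫ β) γ X).inv ≫
        eqToHom h = (M.pushComp α (β ≫ γ) X).inv := by
  rw [← cancel_mono (M.pushComp α (β ≫ γ) X).hom, Iso.inv_hom_id,
    ← cancel_mono (M.pushComp β γ ((M.push α).obj X)).hom, Category.id_comp, Category.assoc,
    Category.assoc, Category.assoc, Category.assoc,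
    ← M.pushComp_assoc α β γ X, Iso.inv_hom_id_assoc, ← Functor.map_comp, Iso.inv_hom_id,
    CategoryTheory.Functor.map_id, Category.comp_id]

lemma pushComp_assoc_inv' {i j k l : I} (α : i ⟶ j) (β : j ⟶ k) (γ : k ⟶ l)
    (X : M.fiber i)
    (h : (M.push (α ≫ β ≫ γ)).obj X = (M.push ((α ≫ β) ≫ γ)).obj X) :
    (underlying (M.push γ)).map (M.pushComp α β X).hom ≫
      (M.pushComp β γ ((M.push α).obj X)).inv ≫ (M.pushComp α (β ≫ γ) X).inv ≫
        eqToHom h = (M.pushComp (α ≫ β) γ X).inv := by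
  rw [← cancel_mono (eqToHom h.symm), ← M.pushComp_assoc_inv α β γ X h.symm, Category.assoc,
    Category.assoc, Category.assoc, Category.assoc, Iso.inv_hom_id_assoc,
    Category.assoc, ← Functor.map_comp_assoc, Iso.hom_inv_id, CategoryTheory.Functor.map_id,
    Category.id_comp, Category.assoc, eqToHom_trans, eqToHom_refl, Category.comp_id]

end SimplicialQuillenPresheaf

section Sections

variable {I : Type u'} [Category.{v} I] {M : SimplicialQuillenPresheaf.{v, u} I}
  {J : Type v} [Category.{v} J] [SimplicialCategory J] {φ : FunctorToOrdinary J I}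

/-- The identity of `j`, as an `n`-simplex of `Map^𝟙(j, j)`. -/
def FunctorToOrdinary.one (φ : FunctorToOrdinary J I) (j : J) (n : SimplexCategoryᵒᵖ) :
    (φ.mapOver (𝟙 (φ.obj j)) : SSet.{v}).obj n :=
  (φ.idOver j).app n PUnit.unit

/-- Composition of `n`-simplices of the simplicial sets `Map^α(j, k)`. -/
def FunctorToOrdinary.mul (φ : FunctorToOrdinary J I) {j k l : J} {α : φ.obj j ⟶ φ.obj k}
    {β : φ.obj k ⟶ φ.obj l} {n : SimplexCategoryᵒᵖ}
    (x : (φ.mapOver α : SSet.{v}).obj n) (y : (φ.mapOver β : SSet.{v}).obj n) :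
    (φ.mapOver (α ≫ β) : SSet.{v}).obj n :=
  (φ.compOver α β).app n ⟨x, y⟩

lemma FunctorToOrdinary.mul_one_coe {j k : J} {α : φ.obj j ⟶ φ.obj k} {n : SimplexCategoryᵒᵖ}
    (x : (φ.mapOver α : SSet.{v}).obj n) : (φ.mul x (φ.one k n)).1 = x.1 := by
  refine Eq.trans ?_ (scomp_degen_id x.1)
  rw [← eId_app k n PUnit.unit]
  rfl

lemma FunctorToOrdinary.one_mul_coe {j k : J} {α : φ.obj j ⟶ φ.obj k} {n : SimplexCategoryᵒᵖ}
    (x : (φ.mapOver α : SSet.{v}).obj n) : (φ.mul (φ.one j n) x).1 = x.1 := by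
  refine Eq.trans ?_ (degen_id_scomp x.1)
  rw [← eId_app j n PUnit.unit]
  rfl

lemma FunctorToOrdinary.mul_assoc_coe {j k l m : J} {α : φ.obj j ⟶ φ.obj k}
    {β : φ.obj k ⟶ φ.obj l} {γ : φ.obj l ⟶ φ.obj m} {n : SimplexCategoryᵒᵖ}
    (x : (φ.mapOver α : SSet.{v}).obj n) (y : (φ.mapOver β : SSet.{v}).obj n)
    (z : (φ.mapOver γ : SSet.{v}).obj n) :
    (φ.mul (φ.mul x y) z).1 = (φ.mul x (φ.mul y z)).1 :=
  scomp_assoc x.1 y.1 z.1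

namespace SimplicialSection

lemma map_one (s : SimplicialSection M φ) (j : J) (n : SimplexCategoryᵒᵖ) :
    (s.map (𝟙 (φ.obj j))).app n (φ.one j n) = degen n (M.pushId (φ.obj j) (s.obj j)).hom :=
  congr_app_apply (s.map_id j) PUnit.unit

lemma map_mul (s : SimplicialSection M φ) {j k l : J} {α : φ.obj j ⟶ φ.obj k}
    {β : φ.obj k ⟶ φ.obj l} {n : SimplexCategoryᵒᵖ}
    (x : (φ.mapOver α : SSet.{v}).obj n) (y : (φ.mapOver β : SSet.{v}).obj n) :
    (s.map (α ≫ β)).app n (φ.mul x y) = degen n (M.pushComp α β (s.obj j)).hom ⊚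
      ((M.push β).map _ _).app n ((s.map α).app n x) ⊚ (s.map β).app n y :=
  congr_app_apply (s.map_comp α β) ⟨x, y⟩

lemma naturality_app {s t : SimplicialSection M φ} (T : s ⟶ t) {j k : J}
    (α : φ.obj j ⟶ φ.obj k) {n : SimplexCategoryᵒᵖ} (x : (φ.mapOver α : SSet.{v}).obj n) :
    (s.map α).app n x ⊚ degen n (Hom.app T k) =
      degen n ((underlying (M.push α)).map (Hom.app T j)) ⊚ (t.map α).app n x :=
  congr_app_apply (Hom.naturality T α) x

@[ext]
lemma hom_ext {s t : SimplicialSection M φ} {T T' : s ⟶ t}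
    (h : ∀ j, Hom.app T j = Hom.app T' j) : T = T' :=
  Hom.ext (funext h)

variable (M φ) in
/-- Evaluation of sections at an object. -/
def ev (j : J) : SimplicialSection M φ ⥤ M.fiber (φ.obj j) where
  obj s := s.obj j
  map T := Hom.app T j

end SimplicialSection

variable (M φ) in
/-- The levels of the free section on an object `X` of `M(φ(j))`, with the universal maps
`Map^α(j, k) ⟶ Map(α_! X, obj k)` which generate it. -/
structure FreeData (j : J) (X : M.fiber (φ.obj j)) where
  obj (k : J) : M.fiber (φ.obj k)
  gen {k : J} (α : φ.obj j ⟶ φ.obj k) :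
    (φ.mapOver α : SSet.{v}) ⟶ sHom ((M.push α).obj X) (obj k)
  isCopower (k : J) : IsCopower (fun α : φ.obj j ⟶ φ.obj k ↦ (φ.mapOver α : SSet.{v}))
    (fun α ↦ (M.push α).obj X) (obj k) (fun α ↦ gen α)

namespace FreeData

variable {j : J} {X : M.fiber (φ.obj j)} (d : FreeData M φ j X)

lemma gen_eq {k : J} {α α' : φ.obj j ⟶ φ.obj k} {n : SimplexCategoryᵒᵖ}
    (x : (φ.mapOver α : SSet.{v}).obj n) (x' : (φ.mapOver α' : SSet.{v}).obj n)
    (h : x.1 = x'.1) (hα : α = α') :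
    (d.gen α).app n x = degen n (eqToHom (by rw [hα])) ⊚ (d.gen α').app n x' := by
  subst hα
  obtain rfl : x = x' := Subtype.ext h
  simp

/-- The structure maps of the free section. -/
def act {k l : J} (β : φ.obj k ⟶ φ.obj l) :
    (φ.mapOver β : SSet.{v}) ⟶ sHom ((M.push β).obj (d.obj k)) (d.obj l) :=
  ((d.isCopower k).map (M.adj β)).desc fun α ↦ φ.compOver α β ≫ d.gen (α ≫ β) ≫
    eHomWhiskerRight SSet.{v} (M.pushComp α β X).inv (d.obj l)

lemma map_gen_scomp_act {k l : J} {α : φ.obj j ⟶ φ.obj k} {β : φ.obj k ⟶ φ.obj l}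
    {n : SimplexCategoryᵒᵖ} (x : (φ.mapOver α : SSet.{v}).obj n)
    (y : (φ.mapOver β : SSet.{v}).obj n) :
    ((M.push β).map _ _).app n ((d.gen α).app n x) ⊚ (d.act β).app n y =
      degen n (M.pushComp α β X).inv ⊚ (d.gen (α ≫ β)).app n (φ.mul x y) :=
  ((d.isCopower k).map (M.adj β)).unit_scomp_desc _ α x y

lemma act_ext {k l : J} {β : φ.obj k ⟶ φ.obj l} {L : SSet.{v}} {Y : M.fiber (φ.obj l)}
    {g g' : L ⟶ sHom ((M.push β).obj (d.obj k)) Y}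
    (h : ∀ (α : φ.obj j ⟶ φ.obj k) (n : SimplexCategoryᵒᵖ) (x : (φ.mapOver α : SSet.{v}).obj n)
      (t : L.obj n), ((M.push β).map _ _).app n ((d.gen α).app n x) ⊚ g.app n t =
        ((M.push β).map _ _).app n ((d.gen α).app n x) ⊚ g'.app n t) : g = g' :=
  ((d.isCopower k).map (M.adj β)).ext h

/-- The free section on `X`. -/
@[reducible]
def toSection : SimplicialSection M φ where
  obj := d.obj
  map := d.act
  map_id k := d.act_ext fun α n x t ↦ by
    refine (d.map_gen_scomp_act x (φ.one k n)).trans ?_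
    rw [d.gen_eq _ x (φ.mul_one_coe x) (Category.comp_id α), degen_scomp_degen_scomp,
      M.pushComp_inv_comp_eqToHom_right]
    exact (M.map_scomp_degen_pushId _ _).symm
  map_comp {k l m} β γ := d.act_ext fun α n x t ↦ by
    obtain ⟨y, z⟩ := t
    refine (d.map_gen_scomp_act x (φ.mul y z)).trans ?_
    symm
    change ((M.push (β ≫ γ)).map _ _).app n ((d.gen α).app n x) ⊚
      degen n (M.pushComp β γ (d.obj k)).hom ⊚ ((M.push γ).map _ _).app n ((d.act β).app n y) ⊚
        (d.act γ).app n z = _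
    rw [M.map_scomp_degen_pushComp_scomp, ← scomp_assoc (((M.push γ).map _ _).app n _),
      ← enrichedFunctor_map_scomp, d.map_gen_scomp_act, enrichedFunctor_map_scomp,
      scomp_assoc, d.map_gen_scomp_act, enrichedFunctor_map_degen,
      d.gen_eq _ _ (φ.mul_assoc_coe x y z) (Category.assoc α β γ), degen_scomp_degen_scomp,
      degen_scomp_degen_scomp, degen_scomp_degen_scomp, Category.assoc, Category.assoc,
      M.pushComp_assoc_inv]

/-- The unit `X ⟶ (free section on X)(j)`. -/
def unit : X ⟶ d.obj j :=
  (eHomEquiv SSet.{v}).symm (φ.idOver j ≫ d.gen (𝟙 (φ.obj j)) ≫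
    eHomWhiskerRight SSet.{v} (M.pushId (φ.obj j) X).inv _)

lemma degen_unit (n : SimplexCategoryᵒᵖ) :
    degen n d.unit = degen n (M.pushId (φ.obj j) X).inv ⊚
      (d.gen (𝟙 (φ.obj j))).app n (φ.one j n) := by
  dsimp [degen, unit]
  rw [Equiv.apply_symm_apply]
  rfl

lemma gen_one (n : SimplexCategoryᵒᵖ) :
    (d.gen (𝟙 (φ.obj j))).app n (φ.one j n) =
      degen n (M.pushId (φ.obj j) X).hom ⊚ degen n d.unit := by
  rw [degen_unit, degen_scomp_degen_scomp, Iso.hom_inv_id, degen_id_scomp]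

lemma gen_eq_act {k : J} {α : φ.obj j ⟶ φ.obj k} {n : SimplexCategoryᵒᵖ}
    (x : (φ.mapOver α : SSet.{v}).obj n) :
    (d.gen α).app n x = degen n (eqToHom (by rw [Category.id_comp]) ≫
      (M.pushComp (𝟙 (φ.obj j)) α X).hom ≫
        (underlying (M.push α)).map ((M.pushId (φ.obj j) X).hom ≫ d.unit)) ⊚
      (d.act α).app n x := by
  rw [d.gen_eq x (φ.mul (φ.one j n) x) (φ.one_mul_coe x).symm (Category.id_comp α).symm]
  have h := d.map_gen_scomp_act (φ.one j n) x
  rw [gen_one, ← degen_comp, enrichedFunctor_map_degen] at h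
  have h' := congrArg (degen n (M.pushComp (𝟙 (φ.obj j)) α X).hom ⊚ ·) h
  dsimp only at h'
  rw [degen_scomp_degen_scomp, degen_scomp_degen_scomp, Iso.hom_inv_id, degen_id_scomp] at h'
  rw [← h', degen_scomp_degen_scomp]

lemma toSection_hom_ext {s : SimplicialSection M φ} {T T' : d.toSection ⟶ s}
    (h : d.unit ≫ SimplicialSection.Hom.app T j = d.unit ≫ SimplicialSection.Hom.app T' j) :
    T = T' := by
  have key (T : d.toSection ⟶ s) {k : J} {α : φ.obj j ⟶ φ.obj k} {n : SimplexCategoryᵒᵖ}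
      (x : (φ.mapOver α : SSet.{v}).obj n) :
      (d.gen α).app n x ⊚ degen n (SimplicialSection.Hom.app T k) =
        degen n (eqToHom (by rw [Category.id_comp]) ≫ (M.pushComp (𝟙 (φ.obj j)) α X).hom ≫
          (underlying (M.push α)).map ((M.pushId (φ.obj j) X).hom ≫ d.unit ≫
            SimplicialSection.Hom.app T j)) ⊚ (s.map α).app n x := by
    rw [gen_eq_act, scomp_assoc, SimplicialSection.naturality_app T α x, degen_scomp_degen_scomp,
      Category.assoc, Category.assoc, ← Functor.map_comp, Category.assoc]
  ext k
  refine (d.isCopower k).hom_ext fun α ↦ ?_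
  ext n x
  refine (key T x).trans (Eq.trans ?_ (key T' x).symm)
  rw [h]

/-- The levelwise components of the map from the free section determined by `f`. -/
def descApp {s : SimplicialSection M φ} (f : X ⟶ s.obj j) (k : J) : d.obj k ⟶ s.obj k :=
  ((d.isCopower k).homEquiv _).symm fun α ↦
    s.map α ≫ eHomWhiskerRight SSet.{v} ((underlying (M.push α)).map f) _

lemma gen_scomp_degen_descApp {s : SimplicialSection M φ} (f : X ⟶ s.obj j) {k : J}
    {α : φ.obj j ⟶ φ.obj k} {n : SimplexCategoryᵒᵖ} (x : (φ.mapOver α : SSet.{v}).obj n) :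
    (d.gen α).app n x ⊚ degen n (d.descApp f k) =
      degen n ((underlying (M.push α)).map f) ⊚ (s.map α).app n x :=
  congr_app_apply ((d.isCopower k).unit_homEquiv_symm _ α) x

lemma unit_comp_descApp {s : SimplicialSection M φ} (f : X ⟶ s.obj j) :
    d.unit ≫ d.descApp f j = f := by
  apply degen_zero_injective
  rw [degen_comp, degen_unit, scomp_assoc, gen_scomp_degen_descApp, s.map_one, ← degen_comp,
    ← degen_comp, M.pushId_hom_naturality, Iso.inv_hom_id_assoc]

/-- The map from the free section determined by `f`. -/
def desc {s : SimplicialSection M φ} (f : X ⟶ s.obj j) : d.toSection ⟶ s :=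
  .mk (d.descApp f) fun {k l} β ↦ d.act_ext fun α n x y ↦ by
    change ((M.push β).map _ _).app n ((d.gen α).app n x) ⊚ (d.act β).app n y ⊚
        degen n (d.descApp f l) =
      ((M.push β).map _ _).app n ((d.gen α).app n x) ⊚
        degen n ((underlying (M.push β)).map (d.descApp f k)) ⊚ (s.map β).app n y
    rw [← scomp_assoc, d.map_gen_scomp_act, scomp_assoc, gen_scomp_degen_descApp, s.map_mul,
      degen_scomp_degen_scomp, degen_scomp_degen_scomp, Category.assoc,
      M.pushComp_hom_naturality, Iso.inv_hom_id_assoc,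
      ← enrichedFunctor_map_degen, ← enrichedFunctor_map_degen, ← scomp_assoc,
      ← enrichedFunctor_map_scomp, ← enrichedFunctor_map_degen, ← scomp_assoc,
      ← enrichedFunctor_map_scomp, gen_scomp_degen_descApp, enrichedFunctor_map_degen]

/-- Maps from the free section on `X` to `s` identify to maps `X ⟶ s(j)`. -/
def homEquiv (s : SimplicialSection M φ) :
    (d.toSection ⟶ s) ≃ (X ⟶ (SimplicialSection.ev M φ j).obj s) where
  toFun T := d.unit ≫ SimplicialSection.Hom.app T j
  invFun := d.desc
  left_inv _ := d.toSection_hom_ext (d.unit_comp_descApp _)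
  right_inv := d.unit_comp_descApp

end FreeData

variable (M φ) in
/-- The free section on `X`, whose value at `k` is the coproduct of the tensors
`Map^α(j, k) ⊗ α_! X`. -/
def freeData [∀ i, Limits.HasCoproducts.{v} (M.fiber i)] (j : J) (X : M.fiber (φ.obj j)) :
    FreeData M φ j X where
  obj k := copower (M.isSimplicialModelCategory (φ.obj k)).tensor
    (fun α : φ.obj j ⟶ φ.obj k ↦ (φ.mapOver α : SSet.{v})) fun α ↦ (M.push α).obj X
  gen := copowerUnit _ _ _
  isCopower k := isCopower_copower _ (M.isSimplicialModelCategory (φ.obj k)).1 _ _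

lemma isRightAdjoint_ev [∀ i, Limits.HasCoproducts.{v} (M.fiber i)] (j : J) :
    (SimplicialSection.ev M φ j).IsRightAdjoint :=
  (Adjunction.adjunctionOfEquivLeft (G := SimplicialSection.ev M φ j)
    (fun X s ↦ (freeData M φ j X).homEquiv s)
    fun _ _ _ _ _ ↦ (Category.assoc _ _ _).symm).isRightAdjoint

variable (M φ) in
/-- The levels of the cofree section on an object `E` of `M(φ(k))`, with the universal maps
`Map^α(j, k) ⟶ Map(α_! (obj j), E)` which cogenerate it. -/
structure CofreeData (k : J) (E : M.fiber (φ.obj k)) where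
  obj (j : J) : M.fiber (φ.obj j)
  cogen {j : J} (α : φ.obj j ⟶ φ.obj k) :
    (φ.mapOver α : SSet.{v}) ⟶ sHom ((M.push α).obj (obj j)) E
  isPower (j : J) : IsPower (fun α : φ.obj j ⟶ φ.obj k ↦ (φ.mapOver α : SSet.{v}))
    (fun α ↦ M.push α) E (obj j) (fun α ↦ cogen α)

namespace CofreeData

variable {k : J} {E : M.fiber (φ.obj k)} (d : CofreeData M φ k E)

lemma cogen_eq {j : J} {α α' : φ.obj j ⟶ φ.obj k} {n : SimplexCategoryᵒᵖ}
    (x : (φ.mapOver α : SSet.{v}).obj n) (x' : (φ.mapOver α' : SSet.{v}).obj n)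
    (h : x.1 = x'.1) (hα : α = α') :
    (d.cogen α).app n x = degen n (eqToHom (by rw [hα])) ⊚ (d.cogen α').app n x' := by
  subst hα
  obtain rfl : x = x' := Subtype.ext h
  simp

/-- The structure maps of the cofree section. -/
def act {j l : J} (β : φ.obj j ⟶ φ.obj l) :
    (φ.mapOver β : SSet.{v}) ⟶ sHom ((M.push β).obj (d.obj j)) (d.obj l) :=
  (d.isPower l).lift fun α ↦ φ.compOver β α ≫ d.cogen (β ≫ α) ≫
    eHomWhiskerRight SSet.{v} (M.pushComp β α (d.obj j)).inv E

lemma map_act_scomp_cogen {j l : J} {β : φ.obj j ⟶ φ.obj l} {α : φ.obj l ⟶ φ.obj k}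
    {n : SimplexCategoryᵒᵖ} (y : (φ.mapOver β : SSet.{v}).obj n)
    (x : (φ.mapOver α : SSet.{v}).obj n) :
    ((M.push α).map _ _).app n ((d.act β).app n y) ⊚ (d.cogen α).app n x =
      degen n (M.pushComp β α (d.obj j)).inv ⊚ (d.cogen (β ≫ α)).app n (φ.mul y x) :=
  (d.isPower l).lift_scomp_counit _ α y x

/-- The cofree section on `E`. -/
@[reducible]
def toSection : SimplicialSection M φ where
  obj := d.obj
  map := d.act
  map_id j := (d.isPower j).ext fun α n t x ↦ by
    refine (d.map_act_scomp_cogen (φ.one j n) x).trans ?_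
    rw [d.cogen_eq _ x (φ.one_mul_coe x) (Category.id_comp α), degen_scomp_degen_scomp,
      M.pushComp_inv_comp_eqToHom_left, eHomEquiv_app, enrichedFunctor_map_degen]
  map_comp {j l m} β γ := (d.isPower m).ext fun α n t x ↦ by
    obtain ⟨y, z⟩ := t
    refine (d.map_act_scomp_cogen (φ.mul y z) x).trans ?_
    symm
    change ((M.push α).map _ _).app n (degen n (M.pushComp β γ (d.obj j)).hom ⊚
      ((M.push γ).map _ _).app n ((d.act β).app n y) ⊚ (d.act γ).app n z) ⊚
        (d.cogen α).app n x = _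
    rw [enrichedFunctor_map_scomp, enrichedFunctor_map_scomp, scomp_assoc, scomp_assoc,
      d.map_act_scomp_cogen, M.map_map_scomp_degen_pushComp_inv_scomp, d.map_act_scomp_cogen,
      enrichedFunctor_map_degen,
      d.cogen_eq _ _ (φ.mul_assoc_coe y z x).symm (Category.assoc β γ α).symm,
      degen_scomp_degen_scomp, degen_scomp_degen_scomp, degen_scomp_degen_scomp]
    refine congrArg (· ⊚ _) (congrArg (degen n) ?_)
    refine Eq.trans ?_ (M.pushComp_assoc_inv' β γ α (d.obj j) (by rw [Category.assoc]))
    rw [Category.assoc (_ ≫ _) _ (eqToHom _), Category.assoc ((underlying _).map _)]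

/-- The counit `(cofree section on E)(k) ⟶ E`. -/
def counit : d.obj k ⟶ E :=
  (eHomEquiv SSet.{v}).symm (φ.idOver k ≫ d.cogen (𝟙 (φ.obj k)) ≫
    eHomWhiskerRight SSet.{v} (M.pushId (φ.obj k) (d.obj k)).inv _)

lemma degen_counit (n : SimplexCategoryᵒᵖ) :
    degen n d.counit = degen n (M.pushId (φ.obj k) (d.obj k)).inv ⊚
      (d.cogen (𝟙 (φ.obj k))).app n (φ.one k n) := by
  dsimp [degen, counit]
  rw [Equiv.apply_symm_apply]
  rfl

lemma cogen_one (n : SimplexCategoryᵒᵖ) :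
    (d.cogen (𝟙 (φ.obj k))).app n (φ.one k n) =
      degen n ((M.pushId (φ.obj k) (d.obj k)).hom ≫ d.counit) := by
  rw [degen_comp, degen_counit, degen_scomp_degen_scomp, Iso.hom_inv_id, degen_id_scomp]

lemma cogen_eq_act {j : J} {α : φ.obj j ⟶ φ.obj k} {n : SimplexCategoryᵒᵖ}
    (x : (φ.mapOver α : SSet.{v}).obj n) :
    (d.cogen α).app n x = (d.act α).app n x ⊚ degen n d.counit := by
  have h := d.map_act_scomp_cogen x (φ.one k n)
  rw [d.cogen_eq _ x (φ.mul_one_coe x) (Category.comp_id α), degen_scomp_degen_scomp,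
    M.pushComp_inv_comp_eqToHom_right, cogen_one, degen_comp, ← scomp_assoc,
    M.map_scomp_degen_pushId, scomp_assoc] at h
  have h' := congrArg (degen n (M.pushId (φ.obj k) _).inv ⊚ ·) h
  dsimp only at h'
  rw [degen_scomp_degen_scomp, Iso.inv_hom_id, degen_id_scomp, degen_scomp_degen_scomp,
    Iso.inv_hom_id, degen_id_scomp] at h'
  exact h'.symm

lemma degen_map_scomp_cogen {s : SimplicialSection M φ} (T : s ⟶ d.toSection) {j : J}
    {α : φ.obj j ⟶ φ.obj k} {n : SimplexCategoryᵒᵖ} (x : (φ.mapOver α : SSet.{v}).obj n) :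
    degen n ((underlying (M.push α)).map (SimplicialSection.Hom.app T j)) ⊚ (d.cogen α).app n x =
      (s.map α).app n x ⊚ degen n (SimplicialSection.Hom.app T k ≫ d.counit) := by
  rw [cogen_eq_act, ← scomp_assoc, ← SimplicialSection.naturality_app T α x, scomp_assoc,
    degen_comp]

lemma cogen_comp_whiskerRight {s : SimplicialSection M φ} (T : s ⟶ d.toSection) {j : J}
    (α : φ.obj j ⟶ φ.obj k) :
    d.cogen α ≫ eHomWhiskerRight SSet.{v}
      ((underlying (M.push α)).map (SimplicialSection.Hom.app T j)) E =
    s.map α ≫ eHomWhiskerLeft SSet.{v} _ (SimplicialSection.Hom.app T k ≫ d.counit) := by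
  ext n x
  exact d.degen_map_scomp_cogen T x

lemma representsFamilies (j : J) :
    RepresentsFamilies (fun α : φ.obj j ⟶ φ.obj k ↦ (φ.mapOver α : SSet.{v}))
      (fun α ↦ (mappingPresheaf (M.push α)).obj E) (d.obj j) fun α ↦ d.cogen α :=
  (d.isPower j).representsFamilies

lemma toSection_hom_ext {s : SimplicialSection M φ} {T T' : s ⟶ d.toSection}
    (h : SimplicialSection.Hom.app T k ≫ d.counit = SimplicialSection.Hom.app T' k ≫ d.counit) :
    T = T' := by
  ext j
  refine (d.representsFamilies j).hom_ext fun α ↦ ?_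
  refine (d.cogen_comp_whiskerRight T α).trans (Eq.trans ?_ (d.cogen_comp_whiskerRight T' α).symm)
  rw [h]

/-- The levelwise components of the map to the cofree section determined by `f`. -/
def liftApp {s : SimplicialSection M φ} (f : s.obj k ⟶ E) (j : J) : s.obj j ⟶ d.obj j :=
  ((d.representsFamilies j).exists_hom fun α ↦
    s.map α ≫ eHomWhiskerLeft SSet.{v} _ f).choose

lemma degen_map_liftApp_scomp_cogen {s : SimplicialSection M φ} (f : s.obj k ⟶ E) {j : J}
    {α : φ.obj j ⟶ φ.obj k} {n : SimplexCategoryᵒᵖ} (x : (φ.mapOver α : SSet.{v}).obj n) :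
    degen n ((underlying (M.push α)).map (d.liftApp f j)) ⊚ (d.cogen α).app n x =
      (s.map α).app n x ⊚ degen n f :=
  congr_app_apply (((d.representsFamilies j).exists_hom _).choose_spec α) x

lemma liftApp_comp_counit {s : SimplicialSection M φ} (f : s.obj k ⟶ E) :
    d.liftApp f k ≫ d.counit = f := by
  have h := d.degen_map_liftApp_scomp_cogen f (φ.one k (.op (SimplexCategory.mk 0)))
  rw [s.map_one, cogen_one, ← degen_comp, ← degen_comp, ← Category.assoc,
    M.pushId_hom_naturality, Category.assoc] at h
  exact (cancel_epi _).1 (degen_zero_injective h)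

/-- The map to the cofree section determined by `f`. -/
def lift {s : SimplicialSection M φ} (f : s.obj k ⟶ E) : s ⟶ d.toSection :=
  .mk (d.liftApp f) fun {j l} β ↦ (d.isPower l).ext fun α n y x ↦ by
    change ((M.push α).map _ _).app n ((s.map β).app n y ⊚ degen n (d.liftApp f l)) ⊚
        (d.cogen α).app n x =
      ((M.push α).map _ _).app n (degen n ((underlying (M.push β)).map (d.liftApp f j)) ⊚
        (d.act β).app n y) ⊚ (d.cogen α).app n x
    rw [enrichedFunctor_map_scomp, enrichedFunctor_map_scomp, scomp_assoc, scomp_assoc,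
      enrichedFunctor_map_degen, degen_map_liftApp_scomp_cogen, d.map_act_scomp_cogen,
      ← enrichedFunctor_map_degen, M.map_map_scomp_degen_pushComp_inv_scomp,
      enrichedFunctor_map_degen, degen_map_liftApp_scomp_cogen, s.map_mul,
      scomp_assoc, degen_scomp_degen_scomp, Iso.inv_hom_id, degen_id_scomp, scomp_assoc]

/-- Maps from `s` to the cofree section on `E` identify to maps `s(k) ⟶ E`. -/
def homEquiv (s : SimplicialSection M φ) :
    (s ⟶ d.toSection) ≃ ((SimplicialSection.ev M φ k).obj s ⟶ E) where
  toFun T := SimplicialSection.Hom.app T k ≫ d.counit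
  invFun := d.lift
  left_inv _ := d.toSection_hom_ext (d.liftApp_comp_counit _)
  right_inv := d.liftApp_comp_counit

end CofreeData

variable [∀ i, Limits.HasProducts.{v} (M.fiber i)]

variable (M φ) in
/-- The cofree section on `E`, whose value at `j` is the product of the cotensors of the objects
`α^* E` by the simplicial sets `Map^α(j, k)`. -/
def cofreeData (k : J) (E : M.fiber (φ.obj k)) : CofreeData M φ k E where
  obj j := power (M.isSimplicialModelCategory (φ.obj j)).1
    (fun α : φ.obj j ⟶ φ.obj k ↦ (φ.mapOver α : SSet.{v})) (fun α ↦ M.pull α) E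
  cogen := powerCounit _ _ (fun α ↦ M.adj α) E
  isPower j := isPower_power (M.isSimplicialModelCategory (φ.obj j)).tensor _ _ _ E

variable (M φ) in
/-- The cofree section functor. -/
def cofree (k : J) : M.fiber (φ.obj k) ⥤ SimplicialSection M φ :=
  Adjunction.rightAdjointOfEquiv (F := SimplicialSection.ev M φ k)
    (G_obj := fun E ↦ (cofreeData M φ k E).toSection)
    (fun s E ↦ ((cofreeData M φ k E).homEquiv s).symm) (fun s s' E T f ↦ by
      refine (Equiv.symm_apply_eq _).2 ?_
      refine Eq.trans ?_ (Category.assoc _ _ _).symm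
      exact congrArg _ (Equiv.apply_symm_apply ((cofreeData M φ k E).homEquiv _) _).symm)

variable (M φ) in
/-- Evaluation of sections is left adjoint to the cofree section functor. -/
def evAdjCofree (k : J) : SimplicialSection.ev M φ k ⊣ cofree M φ k :=
  Adjunction.adjunctionOfEquivRight _ _

instance (k : J) : (SimplicialSection.ev M φ k).IsLeftAdjoint := (evAdjCofree M φ k).isLeftAdjoint

lemma evAdjCofree_counit_app (k : J) (E : M.fiber (φ.obj k)) :
    (evAdjCofree M φ k).counit.app E = (cofreeData M φ k E).counit := by
  refine (Adjunction.adjunctionOfEquivRight_counit_app _ _ _).trans ?_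
  exact Category.id_comp _

lemma app_counit_of_cofree_hom (k : J) {E : M.fiber (φ.obj k)} {s : SimplicialSection M φ}
    (T : s ⟶ (cofree M φ k).obj E) :
    SimplicialSection.Hom.app T k ≫ (cofreeData M φ k E).counit =
      ((evAdjCofree M φ k).homEquiv s E).symm T := by
  rw [Adjunction.homEquiv_counit, evAdjCofree_counit_app]
  rfl

end Sections

/-! ### Limits and colimits of sections -/

section LimitsOfSections

open Limits

variable {I : Type u'} [Category.{v} I] {M : SimplicialQuillenPresheaf.{v, u} I}
  {J : Type v} [Category.{v} J] [SimplicialCategory J] {φ : FunctorToOrdinary J I}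
  {𝒦 : Type*} [Category 𝒦] {D : 𝒦 ⥤ SimplicialSection M φ}

namespace SimplicialSection

section Limits

variable {c : ∀ j, Cone (D ⋙ ev M φ j)}

variable (c) in
/-- The projections of a family of cones over the levels of a diagram of sections. -/
def coneπ (j : J) (i : 𝒦) : (c j).pt ⟶ (D.obj i).obj j := (c j).π.app i

variable (c) in
lemma coneπ_comp (j : J) {i i' : 𝒦} (a : i ⟶ i') :
    coneπ c j i ≫ Hom.app (D.map a) j = coneπ c j i' :=
  (c j).w a

variable (hc : ∀ j, IsLimit (c j))

/-- The structure maps of a levelwise limit of sections. -/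
def limitMap {j k : J} (α : φ.obj j ⟶ φ.obj k) :
    (φ.mapOver α : SSet.{v}) ⟶ sHom ((M.push α).obj (c j).pt) (c k).pt :=
  ((M.isSimplicialModelCategory (φ.obj k)).tensor.isLimitSHom (hc k) _).lift
    { pt := (φ.mapOver α : SSet.{v})
      π :=
        { app i := (D.obj i).map α ≫
            eHomWhiskerRight SSet.{v} ((underlying (M.push α)).map (coneπ c j i)) _
          naturality i i' a := by
            ext n x
            change degen n ((underlying (M.push α)).map (coneπ c j i')) ⊚
                ((D.obj i').map α).app n x =
              (degen n ((underlying (M.push α)).map (coneπ c j i)) ⊚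
                ((D.obj i).map α).app n x) ⊚ degen n (Hom.app (D.map a) k)
            rw [scomp_assoc, naturality_app (D.map a) α x, degen_scomp_degen_scomp,
              ← Functor.map_comp, coneπ_comp] } }

lemma limitMap_comp_eHomWhiskerLeft {j k : J} {α : φ.obj j ⟶ φ.obj k} (i : 𝒦) :
    limitMap hc α ≫ eHomWhiskerLeft SSet.{v} _ (coneπ c k i) =
      (D.obj i).map α ≫ eHomWhiskerRight SSet.{v} ((underlying (M.push α)).map (coneπ c j i)) _ :=
  ((M.isSimplicialModelCategory (φ.obj k)).tensor.isLimitSHom (hc k) _).fac _ i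

lemma limitMap_scomp_degen_coneπ {j k : J} {α : φ.obj j ⟶ φ.obj k} (i : 𝒦)
    {n : SimplexCategoryᵒᵖ} (x : (φ.mapOver α : SSet.{v}).obj n) :
    (limitMap hc α).app n x ⊚ degen n (coneπ c k i) =
      degen n ((underlying (M.push α)).map (coneπ c j i)) ⊚ ((D.obj i).map α).app n x :=
  congr_app_apply (limitMap_comp_eHomWhiskerLeft hc i) x

include hc in
lemma sHom_ext_of_isLimit {j : J} {K : SSet.{v}} {X : M.fiber (φ.obj j)}
    {g g' : K ⟶ sHom X (c j).pt}
    (h : ∀ (i : 𝒦) (n : SimplexCategoryᵒᵖ) (x : K.obj n),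
      g.app n x ⊚ degen n (coneπ c j i) = g'.app n x ⊚ degen n (coneπ c j i)) : g = g' :=
  ((M.isSimplicialModelCategory (φ.obj j)).tensor.isLimitSHom (hc j) _).hom_ext fun i ↦ by
    ext n x
    exact h i n x

/-- The levelwise limit of a diagram of sections. -/
@[reducible]
def limitSection : SimplicialSection M φ where
  obj j := (c j).pt
  map := limitMap hc
  map_id j := sHom_ext_of_isLimit hc fun i n _ ↦ by
    change (limitMap hc _).app n (φ.one j n) ⊚ degen n (coneπ c j i) =
      degen n (M.pushId (φ.obj j) (c j).pt).hom ⊚ degen n (coneπ c j i)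
    rw [limitMap_scomp_degen_coneπ, map_one, ← degen_comp, M.pushId_hom_naturality, degen_comp]
  map_comp {j k l} α β := sHom_ext_of_isLimit hc fun i n ⟨x, y⟩ ↦ by
    change (limitMap hc _).app n (φ.mul x y) ⊚ degen n (coneπ c l i) =
      (degen n (M.pushComp α β (c j).pt).hom ⊚
        ((M.push β).map _ _).app n ((limitMap hc α).app n x) ⊚
          (limitMap hc β).app n y) ⊚ degen n (coneπ c l i)
    rw [limitMap_scomp_degen_coneπ, map_mul, scomp_assoc, scomp_assoc, limitMap_scomp_degen_coneπ,
      degen_scomp_degen_scomp, M.pushComp_hom_naturality, ← enrichedFunctor_map_degen,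
      ← scomp_assoc (((M.push β).map _ _).app n ((limitMap hc α).app n x)),
      ← enrichedFunctor_map_scomp, limitMap_scomp_degen_coneπ, degen_comp,
      enrichedFunctor_map_scomp, enrichedFunctor_map_degen, scomp_assoc, scomp_assoc]

/-- The levelwise limit cone of a diagram of sections. -/
def limitCone : Cone D where
  pt := limitSection hc
  π :=
    { app i := Hom.mk (s := limitSection hc) (t := D.obj i) (coneπ c · i) fun _ ↦
        limitMap_comp_eHomWhiskerLeft hc i
      naturality _ _ a := hom_ext fun j ↦ (Category.id_comp _).trans (coneπ_comp c j a).symm }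

/-- The map from a cone over a diagram of sections to the levelwise limit, at `j`. -/
def limitLiftApp (t : Cone D) (j : J) : t.pt.obj j ⟶ (c j).pt := (hc j).lift ((ev M φ j).mapCone t)

lemma limitLiftApp_comp_coneπ (t : Cone D) (j : J) (i : 𝒦) :
    limitLiftApp hc t j ≫ coneπ c j i = Hom.app (t.π.app i) j :=
  (hc j).fac _ _

/-- Limits of sections are computed levelwise. -/
def isLimitLimitCone : IsLimit (limitCone hc) where
  lift t := Hom.mk (s := t.pt) (t := limitSection hc) (limitLiftApp hc t) fun {j k} α ↦
    sHom_ext_of_isLimit hc fun i n x ↦ by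
      change ((t.pt.map α).app n x ⊚ degen n (limitLiftApp hc t k)) ⊚ degen n (coneπ c k i) =
        (degen n ((underlying (M.push α)).map (limitLiftApp hc t j)) ⊚
          (limitMap hc α).app n x) ⊚ degen n (coneπ c k i)
      rw [scomp_assoc, scomp_assoc, limitMap_scomp_degen_coneπ, ← degen_comp,
        limitLiftApp_comp_coneπ, degen_scomp_degen_scomp, ← Functor.map_comp,
        limitLiftApp_comp_coneπ, naturality_app]
  fac t i := hom_ext fun j ↦ limitLiftApp_comp_coneπ hc t j i
  uniq t _ hm := hom_ext fun j ↦ (hc j).hom_ext fun i ↦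
    (congrArg (Hom.app · j) (hm i)).trans (limitLiftApp_comp_coneπ hc t j i).symm

end Limits

section Colimits

variable {c : ∀ j, Cocone (D ⋙ ev M φ j)}

variable (c) in
/-- The inclusions of a family of cocones under the levels of a diagram of sections. -/
def coconeι (j : J) (i : 𝒦) : (D.obj i).obj j ⟶ (c j).pt := (c j).ι.app i

variable (c) in
lemma comp_coconeι (j : J) {i i' : 𝒦} (a : i ⟶ i') :
    Hom.app (D.map a) j ≫ coconeι c j i' = coconeι c j i :=
  (c j).w a

variable (hc : ∀ j, IsColimit (c j))

/-- The image of a levelwise colimit by a change of fiber is a colimit. -/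
def isColimitPushMapCocone {j : J} {i : I} (α : φ.obj j ⟶ i) :
    IsColimit ((underlying (M.push α)).mapCocone (c j)) :=
  have := (M.adj α).toAdjunction.leftAdjoint_preservesColimits
  isColimitOfPreserves _ (hc j)

/-- The structure maps of a levelwise colimit of sections. -/
def colimitMap {j k : J} (α : φ.obj j ⟶ φ.obj k) :
    (φ.mapOver α : SSet.{v}) ⟶ sHom ((M.push α).obj (c j).pt) (c k).pt :=
  ((M.isSimplicialModelCategory (φ.obj k)).1.isLimitSHom (isColimitPushMapCocone hc α) _).lift
    { pt := (φ.mapOver α : SSet.{v})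
      π :=
        { app i := (D.obj i.unop).map α ≫ eHomWhiskerLeft SSet.{v} _ (coconeι c k i.unop)
          naturality := fun ⟨i⟩ ⟨i'⟩ ⟨(a : i' ⟶ i)⟩ ↦ by
            ext n x
            change ((D.obj i').map α).app n x ⊚ degen n (coconeι c k i') =
              degen n ((underlying (M.push α)).map (Hom.app (D.map a) j)) ⊚
                ((D.obj i).map α).app n x ⊚ degen n (coconeι c k i)
            rw [← scomp_assoc, ← naturality_app (D.map a) α x, scomp_assoc, ← degen_comp,
              comp_coconeι] } }

lemma colimitMap_comp_eHomWhiskerRight {j k : J} {α : φ.obj j ⟶ φ.obj k} (i : 𝒦) :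
    colimitMap hc α ≫ eHomWhiskerRight SSet.{v} ((underlying (M.push α)).map (coconeι c j i)) _ =
      (D.obj i).map α ≫ eHomWhiskerLeft SSet.{v} _ (coconeι c k i) :=
  ((M.isSimplicialModelCategory (φ.obj k)).1.isLimitSHom (isColimitPushMapCocone hc α) _).fac _
    (.op i)

lemma degen_coconeι_scomp_colimitMap {j k : J} {α : φ.obj j ⟶ φ.obj k} (i : 𝒦)
    {n : SimplexCategoryᵒᵖ} (x : (φ.mapOver α : SSet.{v}).obj n) :
    degen n ((underlying (M.push α)).map (coconeι c j i)) ⊚ (colimitMap hc α).app n x =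
      ((D.obj i).map α).app n x ⊚ degen n (coconeι c k i) :=
  congr_app_apply (colimitMap_comp_eHomWhiskerRight hc i) x

include hc in
lemma sHom_ext_of_isColimit {j : J} {i : I} {α : φ.obj j ⟶ i} {K : SSet.{v}} {Y : M.fiber i}
    {g g' : K ⟶ sHom ((M.push α).obj (c j).pt) Y}
    (h : ∀ (l : 𝒦) (n : SimplexCategoryᵒᵖ) (x : K.obj n),
      degen n ((underlying (M.push α)).map (coconeι c j l)) ⊚ g.app n x =
        degen n ((underlying (M.push α)).map (coconeι c j l)) ⊚ g'.app n x) : g = g' :=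
  ((M.isSimplicialModelCategory i).1.isLimitSHom (isColimitPushMapCocone hc α) _).hom_ext
    fun l ↦ by
      ext n x
      exact h l.unop n x

/-- The levelwise colimit of a diagram of sections. -/
@[reducible]
def colimitSection : SimplicialSection M φ where
  obj j := (c j).pt
  map := colimitMap hc
  map_id j := sHom_ext_of_isColimit hc fun i n _ ↦ by
    change degen n ((underlying (M.push _)).map (coconeι c j i)) ⊚
        (colimitMap hc _).app n (φ.one j n) =
      degen n ((underlying (M.push _)).map (coconeι c j i)) ⊚
        degen n (M.pushId (φ.obj j) (c j).pt).hom
    rw [degen_coconeι_scomp_colimitMap, map_one, ← degen_comp, ← degen_comp,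
      M.pushId_hom_naturality]
  map_comp {j k l} α β := sHom_ext_of_isColimit hc fun i n ⟨x, y⟩ ↦ by
    change degen n ((underlying (M.push _)).map (coconeι c j i)) ⊚
        (colimitMap hc _).app n (φ.mul x y) =
      degen n ((underlying (M.push _)).map (coconeι c j i)) ⊚
        degen n (M.pushComp α β (c j).pt).hom ⊚
          ((M.push β).map _ _).app n ((colimitMap hc α).app n x) ⊚ (colimitMap hc β).app n y
    rw [degen_coconeι_scomp_colimitMap, map_mul, scomp_assoc, scomp_assoc,
      ← degen_coconeι_scomp_colimitMap, degen_scomp_degen_scomp, M.pushComp_hom_naturality,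
      ← enrichedFunctor_map_degen, ← scomp_assoc (((M.push β).map _ _).app n _),
      ← enrichedFunctor_map_scomp, ← degen_coconeι_scomp_colimitMap, degen_comp,
      enrichedFunctor_map_scomp, enrichedFunctor_map_degen, scomp_assoc, scomp_assoc]

/-- The levelwise colimit cocone of a diagram of sections. -/
def colimitCocone : Cocone D where
  pt := colimitSection hc
  ι :=
    { app i := Hom.mk (s := D.obj i) (t := colimitSection hc) (coconeι c · i) fun _ ↦
        (colimitMap_comp_eHomWhiskerRight hc i).symm
      naturality _ _ a := hom_ext fun j ↦ (comp_coconeι c j a).trans (Category.comp_id _).symm }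

/-- The map from the levelwise colimit to a cocone under a diagram of sections, at `j`. -/
def colimitDescApp (t : Cocone D) (j : J) : (c j).pt ⟶ t.pt.obj j :=
  (hc j).desc ((ev M φ j).mapCocone t)

lemma coconeι_comp_colimitDescApp (t : Cocone D) (j : J) (i : 𝒦) :
    coconeι c j i ≫ colimitDescApp hc t j = Hom.app (t.ι.app i) j :=
  (hc j).fac _ _

/-- Colimits of sections are computed levelwise. -/
def isColimitColimitCocone : IsColimit (colimitCocone hc) where
  desc t := Hom.mk (s := colimitSection hc) (t := t.pt) (colimitDescApp hc t) fun {j k} α ↦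
    sHom_ext_of_isColimit hc fun i n x ↦ by
      change degen n ((underlying (M.push α)).map (coconeι c j i)) ⊚
          (colimitMap hc α).app n x ⊚ degen n (colimitDescApp hc t k) =
        degen n ((underlying (M.push α)).map (coconeι c j i)) ⊚
          degen n ((underlying (M.push α)).map (colimitDescApp hc t j)) ⊚ (t.pt.map α).app n x
      rw [← scomp_assoc, degen_coconeι_scomp_colimitMap, scomp_assoc, ← degen_comp,
        coconeι_comp_colimitDescApp, degen_scomp_degen_scomp, ← Functor.map_comp,
        coconeι_comp_colimitDescApp]
      exact naturality_app (t.ι.app i) α x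
  fac t i := hom_ext fun j ↦ coconeι_comp_colimitDescApp hc t j i
  uniq t _ hm := hom_ext fun j ↦ (hc j).hom_ext fun i ↦
    (congrArg (Hom.app · j) (hm i)).trans (coconeι_comp_colimitDescApp hc t j i).symm

end Colimits

instance [∀ i, HasLimitsOfShape 𝒦 (M.fiber i)] : HasLimitsOfShape 𝒦 (SimplicialSection M φ) :=
  ⟨fun D ↦ ⟨⟨_, isLimitLimitCone fun j ↦ limit.isLimit (D ⋙ ev M φ j)⟩⟩⟩

instance [∀ i, HasColimitsOfShape 𝒦 (M.fiber i)] : HasColimitsOfShape 𝒦 (SimplicialSection M φ) :=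
  ⟨fun D ↦ ⟨⟨_, isColimitColimitCocone fun j ↦ colimit.isColimit (D ⋙ ev M φ j)⟩⟩⟩

instance : HasFiniteLimits (SimplicialSection M φ) := ⟨fun _ _ _ ↦ inferInstance⟩

instance : HasFiniteColimits (SimplicialSection M φ) := ⟨fun _ _ _ ↦ inferInstance⟩

end SimplicialSection

end LimitsOfSections

/-! ### The projective model structure -/

namespace FunctorToOrdinary

variable {I : Type u'} [Category.{v} I] {J : Type u} [Category.{v} J] [SimplicialCategory J]
  {J' : Type u} [Category.{v} J'] [SimplicialCategory J']

lemma isClopen_mapOver (φ : FunctorToOrdinary J I) {j k : J} (α : φ.obj j ⟶ φ.obj k) :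
    IsClopen (φ.mapOver α) := fun θ x hx ↦ (φ.map_simplicial θ x).symm.trans hx

lemma isWeakHomotopyEquivalence_precompOver (φ' : FunctorToOrdinary J' I)
    {ψ : EnrichedFunctor SSet.{v} J J'} {j k : J} (h : IsWeakHomotopyEquivalence (ψ.map j k))
    (α : φ'.obj (ψ.obj j) ⟶ φ'.obj (ψ.obj k)) :
    IsWeakHomotopyEquivalence (φ'.precompOver ψ α) :=
  h.of_isClopen ((φ'.precomp ψ).isClopen_mapOver α) (φ'.isClopen_mapOver α) rfl fun _ hx ↦ hx

end FunctorToOrdinary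

section ProjectiveModelStructure

open Limits MorphismProperty

variable {I : Type u'} [Category.{v} I] {M : SimplicialQuillenPresheaf.{v, u} I}
  {J : Type v} [Category.{v} J] [SimplicialCategory J] {φ : FunctorToOrdinary J I}

variable (M φ) in
/-- The morphisms of sections which belong levelwise to given classes of morphisms. -/
def levelwise (P : ∀ j, MorphismProperty (M.fiber (φ.obj j))) :
    MorphismProperty (SimplicialSection M φ) :=
  fun _ _ T ↦ ∀ j, P j (SimplicialSection.Hom.app T j)

instance (P : ∀ j, MorphismProperty (M.fiber (φ.obj j))) [∀ j, (P j).IsStableUnderRetracts] :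
    (levelwise M φ P).IsStableUnderRetracts where
  of_retract h hg j := of_retract (h.map (SimplicialSection.ev M φ j)) (hg j)

instance (P : ∀ j, MorphismProperty (M.fiber (φ.obj j))) [∀ j, (P j).HasTwoOutOfThreeProperty] :
    (levelwise M φ P).HasTwoOutOfThreeProperty where
  comp_mem _ _ h h' j := (P j).comp_mem _ _ (h j) (h' j)
  of_postcomp f g h h' j :=
    (P j).of_postcomp (SimplicialSection.Hom.app f j) (SimplicialSection.Hom.app g j) (h j) (h' j)
  of_precomp f g h h' j :=
    (P j).of_precomp (SimplicialSection.Hom.app f j) (SimplicialSection.Hom.app g j) (h j) (h' j)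

lemma levelwise_rlp_ofHoms [∀ j, (SimplicialSection.ev M φ j).IsRightAdjoint] {ι : J → Type v}
    {A B : ∀ j, ι j → M.fiber (φ.obj j)} (f : ∀ j a, A j a ⟶ B j a) :
    levelwise M φ (fun j ↦ (ofHoms (f j)).rlp) =
      (ofHoms fun a : Σ j, ι j ↦
        (SimplicialSection.ev M φ a.1).leftAdjoint.map (f a.1 a.2)).rlp := by
  have adj (j : J) := Adjunction.ofIsRightAdjoint (SimplicialSection.ev M φ j)
  ext s t T
  constructor
  · rintro hT _ _ _ ⟨⟨j, a⟩⟩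
    exact ((adj j).hasLiftingProperty_iff _ _).2 (hT j _ ⟨a⟩)
  · rintro hT j _ _ _ ⟨a⟩
    exact ((adj j).hasLiftingProperty_iff _ _).1 (hT _ ⟨(⟨j, a⟩ : Σ j, ι j)⟩)

lemma hasFactorization_llp_levelwise_rlp (hM : ∀ i, IsLocallyPresentable.{v} (M.fiber i))
    (W : ∀ j, MorphismProperty (M.fiber (φ.obj j))) (hW : ∀ j, IsSmall.{v} (W j)) :
    HasFactorization (levelwise M φ (fun j ↦ (W j).rlp)).llp
      (levelwise M φ (fun j ↦ (W j).rlp)) := by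
  have (i : I) : HasLimitsOfSize.{v, v} (M.fiber i) := hasLimits_of_isLocallyPresentable _ (hM i)
  have (i : I) : HasColimitsOfSize.{v, v} (M.fiber i) :=
    hasColimits_of_isLocallyPresentable _ (hM i)
  have : HasColimitsOfSize.{v, v} (SimplicialSection M φ) := ⟨fun _ ↦ inferInstance⟩
  have (j : J) := isRightAdjoint_ev (M := M) (φ := φ) j
  choose ι A B f hf using fun j ↦ (isSmall_iff_eq_ofHoms.{v} _).1 (hW j)
  simp only [hf, levelwise_rlp_ofHoms f]
  have := hasSmallObjectArgument_ofHoms (fun a : Σ j, ι j ↦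
    (SimplicialSection.ev M φ a.1).leftAdjoint.map (f a.1 a.2)) fun a ↦ by
      have : IsPresentable.{v} (A a.1 a.2) := inferInstance
      obtain ⟨κ, _, _⟩ := this.exists_cardinal
      have : (SimplicialSection.ev M φ a.1).IsCardinalAccessible κ :=
        ⟨fun _ _ _ ↦ inferInstance⟩
      have := (Adjunction.ofIsRightAdjoint
        (SimplicialSection.ev M φ a.1)).isCardinalPresentable_leftAdjoint_obj κ (A a.1 a.2)
      exact isPresentable_of_isCardinalPresentable _ κ
  infer_instance

section Cofree

lemma CofreeData.cogen_comp_whiskerRight_of_fac {k : J} {E D : M.fiber (φ.obj k)}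
    {d : CofreeData M φ k E} {d' : CofreeData M φ k D} {p : E ⟶ D}
    {T : d.toSection ⟶ d'.toSection}
    (hT : SimplicialSection.Hom.app T k ≫ d'.counit = d.counit ≫ p) {j : J}
    (α : φ.obj j ⟶ φ.obj k) :
    d'.cogen α ≫ eHomWhiskerRight SSet.{v} ((underlying (M.push α)).map
      (SimplicialSection.Hom.app T j)) D =
    d.cogen α ≫ eHomWhiskerLeft SSet.{v} _ p := by
  refine (d'.cogen_comp_whiskerRight T α).trans ?_
  rw [hT]
  ext n x
  change (d.act α).app n x ⊚ degen n (d.counit ≫ p) = (d.cogen α).app n x ⊚ degen n p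
  rw [cogen_eq_act, degen_comp, scomp_assoc]

variable [∀ i, HasProducts.{v} (M.fiber i)]

lemma cofree_map_app_counit {k : J} {E D : M.fiber (φ.obj k)} (p : E ⟶ D) :
    SimplicialSection.Hom.app ((cofree M φ k).map p) k ≫ (cofreeData M φ k D).counit =
      (cofreeData M φ k E).counit ≫ p := by
  have h := (evAdjCofree M φ k).counit.naturality p
  rw [evAdjCofree_counit_app, evAdjCofree_counit_app] at h
  exact h

lemma cogen_comp_cofree_map {k : J} {E D : M.fiber (φ.obj k)} (p : E ⟶ D) {j : J}
    (α : φ.obj j ⟶ φ.obj k) :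
    (cofreeData M φ k D).cogen α ≫ eHomWhiskerRight SSet.{v} ((underlying (M.push α)).map
      (SimplicialSection.Hom.app ((cofree M φ k).map p) j)) D =
    (cofreeData M φ k E).cogen α ≫ eHomWhiskerLeft SSet.{v} _ p :=
  CofreeData.cogen_comp_whiskerRight_of_fac (cofree_map_app_counit p) α

lemma hasLiftingProperty_cofree_map_app {k j : J} {E D : M.fiber (φ.obj k)} (p : E ⟶ D)
    [Fibration p] {A B : M.fiber (φ.obj j)} (i : A ⟶ B) [Cofibration i]
    (h : WeakEquivalence i ∨ WeakEquivalence p) :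
    HasLiftingProperty i (SimplicialSection.Hom.app ((cofree M φ k).map p) j) :=
  ((cofreeData M φ k E).representsFamilies j).hasLiftingProperty
    ((cofreeData M φ k D).representsFamilies j)
    (fun α ↦ (M.isSimplicialModelCategory _).hasGapLiftingProperty_mappingPresheaf
      (M.push_preservesCofibrations α) _ i p (.inr h)) (fun α ↦ cogen_comp_cofree_map p α)

lemma levelwise_trivialCofibrations_of_llp {s t : SimplicialSection M φ} {T : s ⟶ t}
    (hT : (levelwise M φ (fun j ↦ fibrations (M.fiber (φ.obj j)))).llp T) :
    levelwise M φ (fun j ↦ trivialCofibrations (M.fiber (φ.obj j))) T := fun k ↦ by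
  change trivialCofibrations _ _
  rw [← fibrations_llp]
  intro E D p hp
  refine ((evAdjCofree M φ k).hasLiftingProperty_iff T p).2 (hT _ fun j ↦ ?_)
  change fibrations (M.fiber (φ.obj j)) _
  rw [← trivialCofibrations_rlp]
  intro A B i hi
  have : Fibration p := ⟨hp⟩
  have : Cofibration i := ⟨hi.1⟩
  exact hasLiftingProperty_cofree_map_app p i (Or.inl ⟨hi.2⟩)

end Cofree

lemma levelwise_trivialFibrations :
    levelwise M φ (fun j ↦ trivialFibrations (M.fiber (φ.obj j))) =
      levelwise M φ (fun j ↦ fibrations (M.fiber (φ.obj j))) ⊓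
        levelwise M φ (fun j ↦ weakEquivalences (M.fiber (φ.obj j))) := by
  ext s t T
  exact forall_and

lemma isWeakFactorizationSystem_levelwise_trivialFibrations
    (hM : ∀ i, IsCombinatorial (M.fiber i)) :
    IsWeakFactorizationSystem (levelwise M φ (fun j ↦ trivialFibrations (M.fiber (φ.obj j)))).llp
      (levelwise M φ (fun j ↦ trivialFibrations (M.fiber (φ.obj j)))) := by
  choose W hW hW' using fun i ↦ (hM i).exists_generatingCofibrations
  have := hasFactorization_llp_levelwise_rlp (M := M) (φ := φ)
    (fun i ↦ (hM i).isLocallyPresentable) (fun j ↦ W (φ.obj j)) (fun j ↦ hW _)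
  simp only [← hW'] at this
  exact .mk' _ _ fun i p hi hp ↦ hi _ hp

lemma isWeakFactorizationSystem_levelwise_fibrations (hM : ∀ i, IsCombinatorial (M.fiber i)) :
    IsWeakFactorizationSystem (levelwise M φ (fun j ↦ fibrations (M.fiber (φ.obj j)))).llp
      (levelwise M φ (fun j ↦ fibrations (M.fiber (φ.obj j)))) := by
  choose W hW hW' using fun i ↦ (hM i).exists_generatingTrivialCofibrations
  have := hasFactorization_llp_levelwise_rlp (M := M) (φ := φ)
    (fun i ↦ (hM i).isLocallyPresentable) (fun j ↦ W (φ.obj j)) (fun j ↦ hW _)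
  simp only [← hW'] at this
  exact .mk' _ _ fun i p hi hp ↦ hi _ hp

lemma llp_levelwise_fibrations (hM : ∀ i, IsCombinatorial (M.fiber i)) :
    (levelwise M φ (fun j ↦ fibrations (M.fiber (φ.obj j)))).llp =
      (levelwise M φ (fun j ↦ trivialFibrations (M.fiber (φ.obj j)))).llp ⊓
        levelwise M φ (fun j ↦ weakEquivalences (M.fiber (φ.obj j))) := by
  have (i : I) : HasProducts.{v} (M.fiber i) := fun _ ↦
    have := hasLimits_of_isLocallyPresentable _ (hM i).isLocallyPresentable
    inferInstance
  have := isWeakFactorizationSystem_levelwise_fibrations (φ := φ) hM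
  refine le_antisymm (fun s t T hT ↦ ⟨antitone_llp (fun _ _ _ hp j ↦ (hp j).1) _ hT,
    fun k ↦ (levelwise_trivialCofibrations_of_llp hT k).2⟩) fun s t T hT ↦ ?_
  have h := factorizationData (levelwise M φ (fun j ↦ fibrations (M.fiber (φ.obj j)))).llp
    (levelwise M φ (fun j ↦ fibrations (M.fiber (φ.obj j)))) T
  have hp : levelwise M φ (fun j ↦ weakEquivalences (M.fiber (φ.obj j))) h.p :=
    of_precomp _ (W' := levelwise M φ _) h.i h.p
      (fun k ↦ (levelwise_trivialCofibrations_of_llp h.hi k).2) (h.fac.symm ▸ hT.2)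
  have : HasLiftingProperty T h.p := hT.1 _ fun j ↦ ⟨h.hp j, hp j⟩
  exact of_retract (RetractArrow.ofLeftLiftingProperty h.fac) h.hi

variable (M φ) in
/-- The projective model structure on sections. -/
@[reducible]
def projectiveModelCategory (hM : ∀ i, IsCombinatorial (M.fiber i)) :
    ModelCategory (SimplicialSection M φ) := by
  let _ : CategoryWithFibrations (SimplicialSection M φ) :=
    ⟨levelwise M φ (fun j ↦ fibrations (M.fiber (φ.obj j)))⟩
  let _ : CategoryWithWeakEquivalences (SimplicialSection M φ) :=
    ⟨levelwise M φ (fun j ↦ weakEquivalences (M.fiber (φ.obj j)))⟩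
  let _ : CategoryWithCofibrations (SimplicialSection M φ) :=
    ⟨(levelwise M φ (fun j ↦ trivialFibrations (M.fiber (φ.obj j)))).llp⟩
  have (i : I) : HasLimitsOfSize.{v, v} (M.fiber i) :=
    hasLimits_of_isLocallyPresentable _ (hM i).isLocallyPresentable
  have : (weakEquivalences (SimplicialSection M φ)).HasTwoOutOfThreeProperty :=
    inferInstanceAs (levelwise M φ _).HasTwoOutOfThreeProperty
  have : (fibrations (SimplicialSection M φ)).IsStableUnderRetracts :=
    inferInstanceAs (levelwise M φ _).IsStableUnderRetracts
  have : (cofibrations (SimplicialSection M φ)).IsStableUnderRetracts :=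
    inferInstanceAs (levelwise M φ _).llp.IsStableUnderRetracts
  have : IsWeakFactorizationSystem (cofibrations (SimplicialSection M φ))
      (trivialFibrations (SimplicialSection M φ)) := by
    have := isWeakFactorizationSystem_levelwise_trivialFibrations (φ := φ) hM
    rw [show trivialFibrations (SimplicialSection M φ) = levelwise M φ _ from
      levelwise_trivialFibrations.symm]
    exact this
  have : IsWeakFactorizationSystem (trivialCofibrations (SimplicialSection M φ))
      (fibrations (SimplicialSection M φ)) := by
    have := isWeakFactorizationSystem_levelwise_fibrations (φ := φ) hM
    rwa [llp_levelwise_fibrations hM] at this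
  exact ModelCategory.mk' _

variable (M φ) in
lemma isProjective_projectiveModelCategory (hM : ∀ i, IsCombinatorial (M.fiber i)) :
    SimplicialSection.IsProjective (projectiveModelCategory M φ hM) := by
  let _ := projectiveModelCategory M φ hM
  refine ⟨fun T ↦ ?_, fun T ↦ ?_, fun T ↦ ?_⟩
  · rw [weakEquivalence_iff]
    exact forall_congr' fun j ↦ (weakEquivalence_iff _).symm
  · rw [fibration_iff]
    exact forall_congr' fun j ↦ (fibration_iff _).symm
  · rw [cofibration_iff]
    exact ⟨fun h _ _ T' h₁ h₂ ↦ h T' fun j ↦ ⟨(h₁ j).mem, (h₂ j).mem⟩,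
      fun h _ _ T' hT' ↦ h T' (fun j ↦ ⟨(hT' j).1⟩) (fun j ↦ ⟨(hT' j).2⟩)⟩

end ProjectiveModelStructure

section Restriction

open Limits

variable {I : Type u'} [Category.{v} I] {M : SimplicialQuillenPresheaf.{v, u} I}
  {J : Type v} [Category.{v} J] [SimplicialCategory J]

variable (M) in
/-- The functor which forgets the action of mapping spaces on a section. -/
abbrev forgetSection (φ : FunctorToOrdinary J I) :
    SimplicialSection M φ ⥤ ∀ j, M.fiber (φ.obj j) :=
  Functor.pi' (fun j ↦ SimplicialSection.ev M φ j)

lemma reflectsIsomorphisms_forgetSection (φ : FunctorToOrdinary J I) :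
    (forgetSection M φ).ReflectsIsomorphisms where
  reflects {s t} T hT := by
    have h (j : J) : IsIso (SimplicialSection.Hom.app T j) :=
      inferInstanceAs (IsIso ((Pi.eval _ j).map ((forgetSection M φ).map T)))
    let T' : t ⟶ s := .mk (fun j ↦ inv (SimplicialSection.Hom.app T j)) (fun {j k} α ↦ by
      have h₁ := congrArg (· ≫ eHomWhiskerLeft SSet.{v} _ (inv (SimplicialSection.Hom.app T k)) ≫
        eHomWhiskerRight SSet.{v}
          ((underlying (M.push α)).map (inv (SimplicialSection.Hom.app T j))) _)
        (SimplicialSection.Hom.naturality T α)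
      beta_reduce at h₁
      rw [Category.assoc, ← eHomWhiskerLeft_comp_assoc, IsIso.hom_inv_id, eHomWhiskerLeft_id,
        Category.id_comp, Category.assoc, ← eHom_whisker_exchange_assoc, ← eHomWhiskerRight_comp,
        ← Functor.map_comp, IsIso.inv_hom_id, CategoryTheory.Functor.map_id, eHomWhiskerRight_id,
        Category.comp_id] at h₁
      exact h₁.symm)
    exact ⟨T', by ext j; exact IsIso.hom_inv_id (SimplicialSection.Hom.app T j),
      by ext j; exact IsIso.inv_hom_id (SimplicialSection.Hom.app T j)⟩

variable {J' : Type v} [Category.{v} J'] [SimplicialCategory J']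

-- The adjoint lifting theorem applies because `forgetSection` is monadic.
lemma isRightAdjoint_restriction (hM : ∀ i, IsLocallyPresentable.{v} (M.fiber i))
    (φ' : FunctorToOrdinary J' I) (ψ : EnrichedFunctor SSet.{v} J J') :
    (SimplicialSection.restriction M φ' ψ).IsRightAdjoint := by
  have (i : I) : HasColimitsOfSize.{v, v} (M.fiber i) :=
    hasColimits_of_isLocallyPresentable _ (hM i)
  have (i : I) : HasLimitsOfSize.{v, v} (M.fiber i) := hasLimits_of_isLocallyPresentable _ (hM i)
  have : (forgetSection M (φ'.precomp ψ)).IsRightAdjoint :=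
    isRightAdjoint_pi' _ fun j ↦ isRightAdjoint_ev j
  have : (SimplicialSection.restriction M φ' ψ ⋙
      forgetSection M (φ'.precomp ψ)).IsRightAdjoint :=
    isRightAdjoint_pi' (fun j ↦ SimplicialSection.ev M φ' (ψ.obj j)) fun j ↦ isRightAdjoint_ev _
  have : HasReflexiveCoequalizers (SimplicialSection M φ') := ⟨fun _ _ _ _ _ ↦ inferInstance⟩
  have : HasReflexiveCoequalizers (SimplicialSection M (φ'.precomp ψ)) :=
    ⟨fun _ _ _ _ _ ↦ inferInstance⟩
  have := reflectsIsomorphisms_forgetSection (M := M) (φ'.precomp ψ)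
  have : Monad.PreservesColimitOfIsReflexivePair (forgetSection M (φ'.precomp ψ)) :=
    ⟨fun _ _ _ _ _ ↦ preservesColimit_pi' _ _⟩
  have : MonadicRightAdjoint (forgetSection M (φ'.precomp ψ)) :=
    Monad.monadicOfHasPreservesReflexiveCoequalizersOfReflectsIsomorphisms
      (Adjunction.ofIsRightAdjoint _)
  exact isRightAdjoint_triangle_lift_monadic (forgetSection M (φ'.precomp ψ))

lemma isQuillenAdjunction_restriction (φ' : FunctorToOrdinary J' I)
    (ψ : EnrichedFunctor SSet.{v} J J')
    {P : ModelCategory (SimplicialSection M (φ'.precomp ψ))}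
    {P' : ModelCategory (SimplicialSection M φ')}
    (hP : SimplicialSection.IsProjective P) (hP' : SimplicialSection.IsProjective P')
    {L : SimplicialSection M (φ'.precomp ψ) ⥤ SimplicialSection M φ'}
    (adj : L ⊣ SimplicialSection.restriction M φ' ψ) : IsQuillenAdjunction adj := by
  have h₁ {s t : SimplicialSection M φ'} (T : s ⟶ t) (hT : Fibration T) :
      Fibration ((SimplicialSection.restriction M φ' ψ).map T) :=
    (hP.fibration_iff _).2 fun j ↦ (hP'.fibration_iff _).1 hT (ψ.obj j)
  have h₂ {s t : SimplicialSection M φ'} (T : s ⟶ t) (hT : WeakEquivalence T) :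
      WeakEquivalence ((SimplicialSection.restriction M φ' ψ).map T) :=
    (hP.weakEquivalence_iff _).2 fun j ↦ (hP'.weakEquivalence_iff _).1 hT (ψ.obj j)
  have h₃ {X Y : SimplicialSection M (φ'.precomp ψ)} (f : X ⟶ Y) (hf : Cofibration f) :
      Cofibration (L.map f) := by
    rw [cofibration_iff, ← trivialFibrations_llp]
    intro s t T hT
    have := h₁ T ⟨hT.1⟩
    have := h₂ T ⟨hT.2⟩
    exact (adj.hasLiftingProperty_iff _ _).2 inferInstance
  refine ⟨h₃, fun f hf hf' ↦ ⟨h₃ f hf, ?_⟩⟩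
  suffices trivialCofibrations _ (L.map f) from ⟨this.2⟩
  rw [← fibrations_llp]
  intro s t T hT
  have := h₁ T ⟨hT⟩
  exact (adj.hasLiftingProperty_iff _ _).2 inferInstance

end Restriction

/-! ### Homotopy invertible morphisms -/

section ActionOfMorphisms

open Limits Opposite SSet

variable {I : Type u'} [Category.{v} I] {M : SimplicialQuillenPresheaf.{v, u} I}
  {J : Type v} [Category.{v} J] [SimplicialCategory J] {φ : FunctorToOrdinary J I}

variable (φ) in
lemma FunctorToOrdinary.map_app_stdSimplex_one {j k : J}
    (h : (Δ[1] : SSet.{v}) ⟶ sHom j k) {n m : SimplexCategoryᵒᵖ} (x : (Δ[1] : SSet.{v}).obj n)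
    (y : (Δ[1] : SSet.{v}).obj m) : φ.map (h.app n x) = φ.map (h.app m y) := by
  have hx {n} (x : (Δ[1] : SSet.{v}).obj n) :
      φ.map (h.app n x) = φ.map (h.app (op ⦋1⦌) (SSet.yonedaEquiv (𝟙 Δ[1]))) := by
    have hx : x = (Δ[1] : SSet.{v}).map (stdSimplex.objEquiv x).op (SSet.yonedaEquiv (𝟙 _)) :=
      stdSimplex.objEquiv.injective (Category.comp_id _).symm
    rw [hx, NatTrans.naturality_apply, φ.map_simplicial]
  exact (hx x).trans (hx y).symm

namespace SimplicialSection

variable (s : SimplicialSection M φ)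

/-- The map `α_! s(j) ⟶ s(k)` given by a morphism `f : j ⟶ k` over `α`. -/
def act {j k : J} (f : j ⟶ k) {α : φ.obj j ⟶ φ.obj k} (hf : φ.map (degen (op ⦋0⦌) f) = α) :
    (underlying (M.push α)).obj (s.obj j) ⟶ s.obj k :=
  (homEquiv' _ _).symm ((s.map α).app (op ⦋0⦌) ⟨degen _ f, hf⟩)

lemma degen_act {j k : J} (f : j ⟶ k) {α : φ.obj j ⟶ φ.obj k} (hf : φ.map (degen (op ⦋0⦌) f) = α) :
    degen (op ⦋0⦌) (s.act f hf) = (s.map α).app (op ⦋0⦌) ⟨degen _ f, hf⟩ :=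
  (homEquiv' _ _).apply_symm_apply _

lemma act_comp {j k l : J} (f : j ⟶ k) (g : k ⟶ l) {α : φ.obj j ⟶ φ.obj k} {β : φ.obj k ⟶ φ.obj l}
    (hf : φ.map (degen (op ⦋0⦌) f) = α) (hg : φ.map (degen (op ⦋0⦌) g) = β)
    (hfg : φ.map (degen (op ⦋0⦌) (f ≫ g)) = α ≫ β) :
    s.act (f ≫ g) hfg = (M.pushComp α β (s.obj j)).hom ≫
      (underlying (M.push β)).map (s.act f hf) ≫ s.act g hg := by
  apply degen_zero_injective
  refine Eq.trans (s.degen_act _ hfg) (Eq.trans ?_ (s.map_mul ⟨_, hf⟩ ⟨_, hg⟩) |>.trans ?_)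
  · exact congrArg ((s.map (α ≫ β)).app _) (Subtype.ext (degen_comp _ _ _))
  · rw [degen_comp, degen_comp, ← enrichedFunctor_map_degen, degen_act, degen_act]

lemma isIso_act_id {j : J} {α : φ.obj j ⟶ φ.obj j} (h : φ.map (degen (op ⦋0⦌) (𝟙 j)) = α) :
    IsIso (s.act (𝟙 j) h) := by
  have h₁ : φ.map (degen (op ⦋0⦌) (𝟙 j)) = 𝟙 (φ.obj j) := by
    rw [← φ.map_id j (op ⦋0⦌), eId_app]
  obtain rfl : α = 𝟙 _ := h.symm.trans h₁
  have : s.act (𝟙 j) h = (M.pushId (φ.obj j) (s.obj j)).hom := by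
    apply degen_zero_injective
    rw [degen_act, ← map_one]
    exact congrArg ((s.map (𝟙 _)).app _) (Subtype.ext (eId_app j _ PUnit.unit).symm)
  rw [this]
  infer_instance

lemma weaklyHomotopic_act_endpoint {j k : J} (h : (Δ[1] : SSet.{v}) ⟶ sHom j k)
    {α : φ.obj j ⟶ φ.obj k} (hα : ∀ i, φ.map (degen (op ⦋0⦌) (endpoint h i)) = α) :
    WeaklyHomotopic (s.act (endpoint h 0) (hα 0)) (s.act (endpoint h 1) (hα 1)) := by
  let h' : Δ[1] ⟶ (φ.mapOver α : SSet.{v}) := SSet.Subcomplex.lift h (by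
    rintro n _ ⟨x, rfl⟩
    rw [← hα 0, degen_zero_endpoint]
    exact φ.map_app_stdSimplex_one h _ _)
  have hend (i : Fin 2) : endpoint (h' ≫ s.map α) i = s.act (endpoint h i) (hα i) := by
    apply degen_zero_injective
    rw [degen_zero_endpoint, degen_act]
    exact congrArg ((s.map α).app _) (Subtype.ext (degen_zero_endpoint h i).symm)
  rw [← hend, ← hend]
  exact weaklyHomotopic_endpoint _

lemma weaklyHomotopic_act {j k : J} {f g : j ⟶ k} (h : WeaklyHomotopic f g)
    {α : φ.obj j ⟶ φ.obj k} (hf : φ.map (degen (op ⦋0⦌) f) = α) :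
    ∃ hg : φ.map (degen (op ⦋0⦌) g) = α, WeaklyHomotopic (s.act f hf) (s.act g hg) := by
  refine (h.iff_of_endpoint (fun g ↦ ∃ hg : φ.map (degen (op ⦋0⦌) g) = α,
    WeaklyHomotopic (s.act f hf) (s.act g hg)) fun h ↦ ?_).1 ⟨hf, .refl _⟩
  have hend (i i' : Fin 2) :
      φ.map (degen (op ⦋0⦌) (endpoint h i)) = φ.map (degen (op ⦋0⦌) (endpoint h i')) := by
    rw [degen_zero_endpoint, degen_zero_endpoint, φ.map_app_stdSimplex_one]
  constructor
  · rintro ⟨rfl, h₀⟩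
    exact ⟨hend _ _, h₀.trans (s.weaklyHomotopic_act_endpoint h fun i ↦ hend i 0)⟩
  · rintro ⟨rfl, h₁⟩
    exact ⟨hend _ _, h₁.trans (s.weaklyHomotopic_act_endpoint h fun i ↦ hend i 1).symm⟩

lemma naturality_act {s t : SimplicialSection M φ} (T : s ⟶ t) {j k : J} (f : j ⟶ k)
    {α : φ.obj j ⟶ φ.obj k} (hf : φ.map (degen (op ⦋0⦌) f) = α) :
    s.act f hf ≫ Hom.app T k = (underlying (M.push α)).map (Hom.app T j) ≫ t.act f hf := by
  apply degen_zero_injective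
  rw [degen_comp, degen_comp, degen_act, degen_act]
  exact naturality_app T α _

instance {i j : I} (α : i ⟶ j) : (underlying (M.push α)).IsLeftAdjoint :=
  (M.adj α).toAdjunction.isLeftAdjoint

lemma exists_weaklyHomotopic_isIso {j k : J} {f : j ⟶ k} {g : k ⟶ j}
    (h : WeaklyHomotopic (f ≫ g) (𝟙 j)) {α : φ.obj j ⟶ φ.obj k} {β : φ.obj k ⟶ φ.obj j}
    (hf : φ.map (degen (op ⦋0⦌) f) = α) (hg : φ.map (degen (op ⦋0⦌) g) = β) :
    ∃ (θ : (underlying (M.push β)).obj ((underlying (M.push α)).obj (s.obj j)) ⟶ s.obj j),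
      IsIso θ ∧ WeaklyHomotopic ((underlying (M.push β)).map (s.act f hf) ≫ s.act g hg) θ := by
  have hfg : φ.map (degen (op ⦋0⦌) (f ≫ g)) = α ≫ β := by
    rw [← hf, ← hg, degen_comp]
    exact φ.map_comp _ _
  obtain ⟨h₁, h₂⟩ := s.weaklyHomotopic_act h hfg
  have := s.isIso_act_id h₁
  refine ⟨(M.pushComp α β (s.obj j)).inv ≫ s.act (𝟙 j) h₁, inferInstance, ?_⟩
  have h₃ := h₂.comp_left (M.pushComp α β (s.obj j)).inv
  rwa [s.act_comp f g hf hg hfg, Iso.inv_hom_id_assoc] at h₃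

lemma weakEquivalence_act (hs : ∀ j, IsCofibrant (s.obj j)) {j k : J} {f : j ⟶ k}
    (h : IsHomotopyInvertible f) {α : φ.obj j ⟶ φ.obj k} (hf : φ.map (degen (op ⦋0⦌) f) = α) :
    WeakEquivalence (s.act f hf) := by
  obtain ⟨g, h₁, h₂⟩ := h
  obtain ⟨θ₁, hθ₁, hθ₁'⟩ := s.exists_weaklyHomotopic_isIso h₁ hf rfl
  obtain ⟨θ₂, hθ₂, hθ₂'⟩ := s.exists_weaklyHomotopic_isIso h₂ rfl hf
  have hα := M.push_preservesCofibrations α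
  have hβ := M.push_preservesCofibrations (φ.map (degen (op ⦋0⦌) g))
  have := hβ.isCofibrant_obj (s.obj k)
  have := hα.isCofibrant_obj ((underlying (M.push (φ.map (degen (op ⦋0⦌) g)))).obj (s.obj k))
  refine (M.isSimplicialModelCategory _).weakEquivalence_of_two_out_of_six
    ((underlying (M.push α)).map ((underlying (M.push _)).map (s.act f hf)))
    ((underlying (M.push α)).map (s.act g rfl)) (s.act f hf) ?_ θ₂ hθ₂'
  rw [← Functor.map_comp]
  refine ((M.isSimplicialModelCategory _).weakEquivalence_iff_of_weaklyHomotopic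
    (hθ₁'.map (M.push α))).2 ?_
  have : IsIso ((underlying (M.push α)).map θ₁) := Functor.map_isIso _ _
  infer_instance

lemma weakEquivalence_app_of_isHomotopyInvertible_of_isCofibrant {s t : SimplicialSection M φ}
    (hs : ∀ j, IsCofibrant (s.obj j)) (ht : ∀ j, IsCofibrant (t.obj j)) (T : s ⟶ t) {j k : J}
    {f : j ⟶ k} (hf : IsHomotopyInvertible f) [WeakEquivalence (Hom.app T j)] :
    WeakEquivalence (Hom.app T k) := by
  have := (M.push_preservesCofibrations (φ.map (degen (op ⦋0⦌) f))).weakEquivalence_map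
    (Hom.app T j)
  have h₁ := weakEquivalence_act s hs hf rfl
  have h₂ := weakEquivalence_act t ht hf rfl
  rw [← weakEquivalence_precomp_iff (act s f rfl), naturality_act T f rfl]
  infer_instance

end SimplicialSection

variable [∀ i, HasProducts.{v} (M.fiber i)]

lemma SimplicialSection.IsProjective.cofibration_app {P : ModelCategory (SimplicialSection M φ)}
    (hP : IsProjective P) {s t : SimplicialSection M φ} (T : s ⟶ t) [Cofibration T] (k : J) :
    Cofibration (Hom.app T k) := by
  rw [HomotopicalAlgebra.cofibration_iff, ← trivialFibrations_llp]
  intro E D p hp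
  have : Fibration p := ⟨hp.1⟩
  have h (j : J) : trivialFibrations _ (Hom.app ((cofree M φ k).map p) j) := by
    rw [← cofibrations_rlp]
    intro A B i hi
    have : Cofibration i := ⟨hi⟩
    exact hasLiftingProperty_cofree_map_app p i (Or.inr ⟨hp.2⟩)
  exact ((evAdjCofree M φ k).hasLiftingProperty_iff T p).2 ((hP.cofibration_iff T).1 inferInstance _
    (fun j ↦ ⟨(h j).1⟩) (fun j ↦ ⟨(h j).2⟩))

lemma SimplicialSection.IsProjective.isCofibrant_obj {P : ModelCategory (SimplicialSection M φ)}
    (hP : IsProjective P) (s : SimplicialSection M φ) [IsCofibrant s] (k : J) :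
    IsCofibrant (s.obj k) :=
  (isCofibrant_iff_of_isInitial (Hom.app (initial.to s) k)
    (initialIsInitial.isInitialObj (ev M φ k) _)).2 (hP.cofibration_app _ k)

-- By cofibrant replacement one reduces to a morphism between cofibrant sections.
lemma SimplicialSection.IsProjective.weakEquivalence_app_of_isHomotopyInvertible
    {P : ModelCategory (SimplicialSection M φ)} (hP : IsProjective P)
    {s t : SimplicialSection M φ} (T : s ⟶ t) {j k : J} {f : j ⟶ k} (hf : IsHomotopyInvertible f)
    (hT : WeakEquivalence (Hom.app T j)) : WeakEquivalence (Hom.app T k) := by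
  let d := MorphismProperty.factorizationData (cofibrations _) (trivialFibrations _) (initial.to s)
  let d' := MorphismProperty.factorizationData (cofibrations _) (trivialFibrations _) (d.p ≫ T)
  have : Cofibration d.i := ⟨d.hi⟩
  have : Cofibration d'.i := ⟨d'.hi⟩
  have : IsCofibrant d.Z := (isCofibrant_iff_of_isInitial d.i initialIsInitial).2 inferInstance
  have : IsCofibrant d'.Z := isCofibrant_of_cofibration d'.i
  have h (l : J) : WeakEquivalence (Hom.app d'.i l) ↔ WeakEquivalence (Hom.app T l) := by
    have := (hP.weakEquivalence_iff d.p).1 ⟨d.hp.2⟩ l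
    have := (hP.weakEquivalence_iff d'.p).1 ⟨d'.hp.2⟩ l
    have h : Hom.app d'.i l ≫ Hom.app d'.p l = Hom.app d.p l ≫ Hom.app T l :=
      congrArg (fun S ↦ Hom.app S l) d'.fac
    rw [← weakEquivalence_postcomp_iff (Hom.app d'.i l) (Hom.app d'.p l), h,
      weakEquivalence_precomp_iff]
  rw [← h] at hT ⊢
  exact weakEquivalence_app_of_isHomotopyInvertible_of_isCofibrant
    (hP.isCofibrant_obj d.Z) (hP.isCofibrant_obj d'.Z) d'.i hf

end ActionOfMorphisms

/-! ### Path sections -/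

section CofreePath

open Limits SSet Opposite SimplicialSection

variable {I : Type u'} [Category.{v} I] {M : SimplicialQuillenPresheaf.{v, u} I}
  {J : Type v} [Category.{v} J] [SimplicialCategory J] {φ : FunctorToOrdinary J I}

lemma SimplicialQuillenPresheaf.isCotensored (i : I) : IsCotensored (M.fiber i) :=
  (M.isSimplicialModelCategory i).1

variable [∀ i, HasProducts.{v} (M.fiber i)]

variable (M φ) in
/-- The section of paths in the cofree section on `E`. -/
def cofreePath (k : J) (E : M.fiber (φ.obj k)) : SimplicialSection M φ :=
  (cofree M φ k).obj ((M.isCotensored _).cotensor Δ[1] E)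

namespace cofreePath

variable {k j : J}

section

variable (φ) (E : M.fiber (φ.obj k))

/-- The evaluation of paths at one of the end points of the interval. -/
def eval (i : Fin 2) : cofreePath M φ k E ⟶ (cofree M φ k).obj E :=
  (cofree M φ k).map (endpoint ((M.isCotensored _).counit Δ[1] E) i)

/-- The universal homotopy of which the values of `cofreePath` are representing objects. -/
def cogen (α : φ.obj j ⟶ φ.obj k) :
    (φ.mapOver α : SSet.{v}) ⊗ Δ[1] ⟶
      ((mappingPresheaf (M.push α)).obj E).obj (op ((cofreePath M φ k E).obj j)) :=
  (M.isCotensored _).uncurry ((cofreeData M φ k _).cogen α)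

lemma representsFamilies (j : J) :
    RepresentsFamilies (fun α : φ.obj j ⟶ φ.obj k ↦ (φ.mapOver α : SSet.{v}) ⊗ Δ[1])
      (fun α ↦ (mappingPresheaf (M.push α)).obj E) ((cofreePath M φ k E).obj j)
      fun α ↦ cogen φ E α :=
  (M.isCotensored _).representsFamilies_uncurry ((cofreeData M φ k _).representsFamilies j)

variable {φ} (α : φ.obj j ⟶ φ.obj k)

lemma ι₀_comp_cogen : ι₀ ≫ cogen φ E α = (cofreeData M φ k E).cogen α ≫
    ((mappingPresheaf (M.push α)).obj E).map (Hom.app (eval φ E 0) j).op :=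
  ((M.isCotensored _).ι₀_comp_uncurry _).trans (cogen_comp_cofree_map _ α).symm

lemma ι₁_comp_cogen : ι₁ ≫ cogen φ E α = (cofreeData M φ k E).cogen α ≫
    ((mappingPresheaf (M.push α)).obj E).map (Hom.app (eval φ E 1) j).op :=
  ((M.isCotensored _).ι₁_comp_uncurry _).trans (cogen_comp_cofree_map _ α).symm

end

variable {E D : M.fiber (φ.obj k)} (p : E ⟶ D)

variable (φ) in
/-- The functoriality of `cofreePath`. -/
def map : cofreePath M φ k E ⟶ cofreePath M φ k D :=
  (cofree M φ k).map ((M.isCotensored _).cotensorMap Δ[1] p)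

lemma map_eval (i : Fin 2) : map φ p ≫ eval φ D i = eval φ E i ≫ (cofree M φ k).map p := by
  have h := congrArg (cofree M φ k).map ((M.isCotensored _).cotensorMap_comp_endpoint_counit p i)
  rwa [Functor.map_comp, Functor.map_comp] at h

lemma cogen_comp_map (α : φ.obj j ⟶ φ.obj k) :
    cogen φ D α ≫ ((mappingPresheaf (M.push α)).obj D).map (Hom.app (map φ p) j).op =
      cogen φ E α ≫ ((mappingPresheaf (M.push α)).map p).app _ :=
  ((M.isCotensored _).uncurry_comp_eHomWhiskerRight _ _).trans
    ((congrArg _ (cogen_comp_cofree_map _ α)).trans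
      ((M.isCotensored _).uncurry_comp_eHomWhiskerLeft _ p).symm)

end cofreePath

end CofreePath

section Comparison

open Limits SSet Opposite

variable {I : Type u'} [Category.{v} I] {M : SimplicialQuillenPresheaf.{v, u} I}
  {J : Type v} [Category.{v} J] [SimplicialCategory J]
  {J' : Type v} [Category.{v} J'] [SimplicialCategory J']
  {φ' : FunctorToOrdinary J' I} {ψ : EnrichedFunctor SSet.{v} J J'}

open SimplicialSection

lemma CofreeData.cogen_comp_whiskerRight_of_restriction {k : J} {E : M.fiber (φ'.obj (ψ.obj k))}
    {d : CofreeData M (φ'.precomp ψ) k E} {d' : CofreeData M φ' (ψ.obj k) E}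
    {T : d'.toSection.restrict ψ ⟶ d.toSection} (hT : Hom.app T k ≫ d.counit = d'.counit) {j : J}
    (α : φ'.obj (ψ.obj j) ⟶ φ'.obj (ψ.obj k)) :
    d.cogen (j := j) α ≫ eHomWhiskerRight SSet.{v} ((underlying (M.push α)).map (Hom.app T j)) E =
      φ'.precompOver ψ α ≫ d'.cogen α := by
  refine (d.cogen_comp_whiskerRight T α).trans ?_
  rw [hT]
  ext n x
  exact (d'.cogen_eq_act _).symm

variable [∀ i, HasProducts.{v} (M.fiber i)]

variable (ψ) in
/-- The comparison map from the restriction of a cofree section to a cofree section. -/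
def comparison (k : J) (E : M.fiber (φ'.obj (ψ.obj k))) :
    (restriction M φ' ψ).obj ((cofree M φ' (ψ.obj k)).obj E) ⟶
      (cofree M (φ'.precomp ψ) k).obj E :=
  (evAdjCofree M (φ'.precomp ψ) k).homEquiv
    ((restriction M φ' ψ).obj ((cofree M φ' (ψ.obj k)).obj E)) E
    (cofreeData M φ' (ψ.obj k) E).counit

lemma homEquiv_symm_comparison (k : J) (E : M.fiber (φ'.obj (ψ.obj k))) :
    ((evAdjCofree M (φ'.precomp ψ) k).homEquiv _ _).symm (comparison ψ k E) =
      (cofreeData M φ' (ψ.obj k) E).counit :=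
  Equiv.symm_apply_apply _ _

lemma comparison_naturality {k : J} {E D : M.fiber (φ'.obj (ψ.obj k))} (p : E ⟶ D) :
    comparison ψ k E ≫ (cofree M (φ'.precomp ψ) k).map p =
      (restriction M φ' ψ).map ((cofree M φ' (ψ.obj k)).map p) ≫ comparison ψ k D := by
  apply ((evAdjCofree M (φ'.precomp ψ) k).homEquiv _ _).symm.injective
  rw [Adjunction.homEquiv_naturality_right_symm, Adjunction.homEquiv_naturality_left_symm,
    homEquiv_symm_comparison, homEquiv_symm_comparison]
  exact (cofree_map_app_counit p).symm

lemma cogen_comp_comparison {k : J} (E : M.fiber (φ'.obj (ψ.obj k))) {j : J}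
    (α : φ'.obj (ψ.obj j) ⟶ φ'.obj (ψ.obj k)) :
    (cofreeData M (φ'.precomp ψ) k E).cogen (j := j) α ≫ eHomWhiskerRight SSet.{v}
      ((underlying (M.push α)).map (Hom.app (comparison ψ k E) j)) E =
    φ'.precompOver ψ α ≫ (cofreeData M φ' (ψ.obj k) E).cogen α :=
  CofreeData.cogen_comp_whiskerRight_of_restriction
    ((app_counit_of_cofree_hom k (comparison ψ k E)).trans (homEquiv_symm_comparison k E)) α

lemma homEquiv_symm_comp_comparison
    {L : SimplicialSection M (φ'.precomp ψ) ⥤ SimplicialSection M φ'}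
    (adj : L ⊣ restriction M φ' ψ) {X : SimplicialSection M (φ'.precomp ψ)} {k : J}
    {E : M.fiber (φ'.obj (ψ.obj k))}
    (T : X ⟶ (restriction M φ' ψ).obj ((cofree M φ' (ψ.obj k)).obj E)) :
    ((evAdjCofree M (φ'.precomp ψ) k).homEquiv _ _).symm (T ≫ comparison ψ k E) =
      Hom.app (adj.unit.app X) k ≫
        ((evAdjCofree M φ' (ψ.obj k)).homEquiv _ _).symm ((adj.homEquiv _ _).symm T) := by
  rw [Adjunction.homEquiv_naturality_left_symm, homEquiv_symm_comparison,
    ← app_counit_of_cofree_hom]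
  refine Eq.trans ?_ (Category.assoc _ _ _)
  refine congrArg (· ≫ (cofreeData M φ' (ψ.obj k) E).counit) ?_
  have h := ((adj.homEquiv _ _).apply_symm_apply T).symm.trans (Adjunction.homEquiv_unit _ _ _ _)
  exact congrArg (fun S ↦ Hom.app S k) h

variable (ψ) in
/-- The homotopy fibre product of the restriction of a cofree section over `J'` and the cofree
section over `J`: its points are pairs of a point of the former and a path in the latter which
starts at the image of this point. -/
def pathSection (k : J) (E : M.fiber (φ'.obj (ψ.obj k))) : SimplicialSection M (φ'.precomp ψ) :=
  pullback (comparison ψ k E) (cofreePath.eval (φ'.precomp ψ) E 0)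

namespace pathSection

variable {k : J}

section

variable (ψ) (E : M.fiber (φ'.obj (ψ.obj k)))

/-- The point over `J'` of a point of `pathSection`. -/
def fst : pathSection ψ k E ⟶ (restriction M φ' ψ).obj ((cofree M φ' (ψ.obj k)).obj E) :=
  pullback.fst _ _

/-- The path over `J` of a point of `pathSection`. -/
def snd : pathSection ψ k E ⟶ cofreePath M (φ'.precomp ψ) k E := pullback.snd _ _

lemma isPullback : IsPullback (fst ψ E) (snd ψ E) (comparison ψ k E)
    (cofreePath.eval (φ'.precomp ψ) E 0) := IsPullback.of_hasPullback _ _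

/-- The end of the path of a point of `pathSection`. -/
def finish : pathSection ψ k E ⟶ (cofree M (φ'.precomp ψ) k).obj E :=
  snd ψ E ≫ cofreePath.eval (φ'.precomp ψ) E 1

variable {ψ} {j : J} (α : φ'.obj (ψ.obj j) ⟶ φ'.obj (ψ.obj k))

/-- The universal family of maps out of the mapping cylinders of the maps
`φ'.precompOver ψ α`. -/
def cogen : mappingCylinder (φ'.precompOver ψ α) ⟶
    ((mappingPresheaf (M.push α)).obj E).obj (op ((pathSection ψ k E).obj j)) :=
  (mappingCylinder.isPushout (φ'.precompOver ψ α)).desc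
    (cofreePath.cogen (φ'.precomp ψ) E (j := j) α ≫
      ((mappingPresheaf (M.push α)).obj E).map (Hom.app (snd ψ E) j).op)
    ((cofreeData M φ' (ψ.obj k) E).cogen α ≫
      ((mappingPresheaf (M.push α)).obj E).map (Hom.app (fst ψ E) j).op)
    (comp_map_op_eq_of_comp_eq (H := (mappingPresheaf (M.push α)).obj E)
      (cofreePath.ι₀_comp_cogen (φ := φ'.precomp ψ) E α).symm (cogen_comp_comparison E α)
      (congrArg (fun S ↦ Hom.app S j) (isPullback ψ E).w.symm))

lemma inl_comp_cogen : mappingCylinder.inl _ ≫ cogen E α =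
    cofreePath.cogen (φ'.precomp ψ) E (j := j) α ≫
      ((mappingPresheaf (M.push α)).obj E).map (Hom.app (snd ψ E) j).op :=
  IsPushout.inl_desc _ _ _ _

lemma inr_comp_cogen : mappingCylinder.inr _ ≫ cogen E α =
    (cofreeData M φ' (ψ.obj k) E).cogen α ≫
      ((mappingPresheaf (M.push α)).obj E).map (Hom.app (fst ψ E) j).op :=
  IsPushout.inr_desc _ _ _ _

lemma ι_comp_cogen : mappingCylinder.ι _ ≫ cogen E α =
    (cofreeData M (φ'.precomp ψ) k E).cogen (j := j) α ≫
      ((mappingPresheaf (M.push α)).obj E).map (Hom.app (finish ψ E) j).op := by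
  rw [mappingCylinder.ι, Category.assoc, inl_comp_cogen]
  exact (comp_map_op_comp (cofreePath.ι₁_comp_cogen (φ := φ'.precomp ψ) E α).symm
    (Hom.app (snd ψ E) j)).symm

lemma representsFamilies [∀ i, HasCoproducts.{v} (M.fiber i)] (j : J) :
    RepresentsFamilies (fun α : φ'.obj (ψ.obj j) ⟶ φ'.obj (ψ.obj k) ↦
        mappingCylinder (φ'.precompOver ψ α))
      (fun α ↦ (mappingPresheaf (M.push α)).obj E) ((pathSection ψ k E).obj j)
      fun α ↦ cogen E α := by
  have := isRightAdjoint_ev (M := M) (φ := φ'.precomp ψ) j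
  exact ((cofreeData M (φ'.precomp ψ) k E).representsFamilies j).of_isPullback
    (cofreePath.representsFamilies (φ'.precomp ψ) E j)
    ((cofreeData M φ' (ψ.obj k) E).representsFamilies (ψ.obj j))
    (fun α ↦ mappingCylinder.isPushout (φ'.precompOver ψ α))
    ((isPullback ψ E).map (ev M (φ'.precomp ψ) j)).flip
    (fun α ↦ (cofreePath.ι₀_comp_cogen (φ := φ'.precomp ψ) E α).symm)
    (fun α ↦ cogen_comp_comparison E α)
    (fun α ↦ inl_comp_cogen E α) fun α ↦ inr_comp_cogen E α

end

variable {E D : M.fiber (φ'.obj (ψ.obj k))} (p : E ⟶ D)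

variable (ψ) in
/-- The functoriality of `pathSection`. -/
def map : pathSection ψ k E ⟶ pathSection ψ k D :=
  pullback.map _ _ _ _ ((restriction M φ' ψ).map ((cofree M φ' (ψ.obj k)).map p))
    (cofreePath.map (φ'.precomp ψ) p) ((cofree M (φ'.precomp ψ) k).map p)
    (comparison_naturality p) (cofreePath.map_eval (φ := φ'.precomp ψ) p 0).symm

lemma map_fst : map ψ p ≫ fst ψ D =
    fst ψ E ≫ (restriction M φ' ψ).map ((cofree M φ' (ψ.obj k)).map p) := pullback.lift_fst _ _ _

lemma map_snd : map ψ p ≫ snd ψ D = snd ψ E ≫ cofreePath.map (φ'.precomp ψ) p :=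
  pullback.lift_snd _ _ _

lemma map_finish : map ψ p ≫ finish ψ D = finish ψ E ≫ (cofree M (φ'.precomp ψ) k).map p := by
  rw [finish, ← Category.assoc, map_snd, Category.assoc, cofreePath.map_eval, ← Category.assoc,
    finish]

lemma cogen_comp_map {j : J} (α : φ'.obj (ψ.obj j) ⟶ φ'.obj (ψ.obj k)) :
    cogen D α ≫ ((mappingPresheaf (M.push α)).obj D).map (Hom.app (map ψ p) j).op =
      cogen E α ≫ ((mappingPresheaf (M.push α)).map p).app _ := by
  apply (mappingCylinder.isPushout (φ'.precompOver ψ α)).hom_ext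
  · rw [← Category.assoc, ← Category.assoc, inl_comp_cogen, inl_comp_cogen]
    exact comp_map_op_comp_app (q := (mappingPresheaf (M.push α)).map p)
      (cofreePath.cogen_comp_map (φ := φ'.precomp ψ) p α)
      (congrArg (fun S ↦ Hom.app S j) (map_snd p))
  · rw [← Category.assoc, ← Category.assoc, inr_comp_cogen, inr_comp_cogen]
    exact comp_map_op_comp_app (q := (mappingPresheaf (M.push α)).map p)
      (r := Hom.app ((cofree M φ' (ψ.obj k)).map p) (ψ.obj j))
      (cogen_comp_cofree_map (φ := φ') p α) (congrArg (fun S ↦ Hom.app S j) (map_fst p))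

variable (ψ) in
/-- The gap map of the commutative square formed by `map` and `finish`. -/
def corner : pathSection ψ k E ⟶ pullback (finish ψ D) ((cofree M (φ'.precomp ψ) k).map p) :=
  pullback.lift (map ψ p) (finish ψ E) (map_finish p)

lemma corner_fst : corner ψ p ≫ pullback.fst _ _ = map ψ p := pullback.lift_fst _ _ _

lemma corner_snd : corner ψ p ≫ pullback.snd _ _ = finish ψ E := pullback.lift_snd _ _ _

variable [∀ i, HasCoproducts.{v} (M.fiber i)] [Fibration p]

lemma hasLiftingProperty_corner_app (hψ : ∀ j, IsWeakHomotopyEquivalence (ψ.map j k)) (j : J)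
    {A B : M.fiber (φ'.obj (ψ.obj j))} (g : A ⟶ B) [Cofibration g] :
    HasLiftingProperty g (Hom.app (corner ψ p) j) := by
  have := isRightAdjoint_ev (M := M) (φ := φ'.precomp ψ) j
  refine ((cofreeData M (φ'.precomp ψ) k E).representsFamilies j).hasLiftingProperty_corner
    (representsFamilies E j) (representsFamilies D j)
    (fun α ↦ (M.isSimplicialModelCategory _).hasGapLiftingProperty_mappingPresheaf
      (M.push_preservesCofibrations α) (mappingCylinder.ι (φ'.precompOver ψ α)) g p (.inl
        (mappingCylinder.isWeakHomotopyEquivalence_ι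
          (φ'.isWeakHomotopyEquivalence_precompOver (hψ j) α))))
    ((IsPullback.of_hasPullback (finish ψ D) ((cofree M (φ'.precomp ψ) k).map p)).map
      (ev M (φ'.precomp ψ) j)) _ (fun α ↦ ?_) (fun α ↦ (ι_comp_cogen D α).symm)
    (fun α ↦ cogen_comp_cofree_map (φ := φ'.precomp ψ) p α) fun α ↦ ?_
  · refine Eq.trans ?_ (ι_comp_cogen E α).symm
    rw [← corner_snd p]
    rfl
  · refine Eq.trans ?_ (cogen_comp_map p α)
    rw [← corner_fst p]
    rfl

lemma trivialFibrations_corner_app (hψ : ∀ j, IsWeakHomotopyEquivalence (ψ.map j k)) (j : J) :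
    trivialFibrations (M.fiber (φ'.obj (ψ.obj j))) (Hom.app (corner ψ p) j) := by
  rw [← cofibrations_rlp]
  intro A B g hg
  have : Cofibration g := ⟨hg⟩
  exact hasLiftingProperty_corner_app p hψ j g

lemma exists_lift {P : ModelCategory (SimplicialSection M (φ'.precomp ψ))} (hP : IsProjective P)
    (hψ : ∀ j, IsWeakHomotopyEquivalence (ψ.map j k))
    {X : SimplicialSection M (φ'.precomp ψ)} [IsCofibrant X] (y : X ⟶ pathSection ψ k D)
    (x : X ⟶ (cofree M (φ'.precomp ψ) k).obj E)
    (hxy : y ≫ finish ψ D = x ≫ (cofree M (φ'.precomp ψ) k).map p) :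
    ∃ z : X ⟶ pathSection ψ k E, z ≫ map ψ p = y ∧ z ≫ finish ψ E = x := by
  have := (hP.cofibration_iff (initial.to X)).1 inferInstance (corner ψ p)
    (fun j ↦ ⟨(trivialFibrations_corner_app p hψ j).1⟩)
    (fun j ↦ ⟨(trivialFibrations_corner_app p hψ j).2⟩)
  have sq : CommSq (initial.to _) (initial.to X) (corner ψ p) (pullback.lift y x hxy) :=
    ⟨initial.hom_ext _ _⟩
  refine ⟨sq.lift, ?_, ?_⟩
  · rw [← corner_fst p, ← Category.assoc, sq.fac_right, pullback.lift_fst]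
  · rw [← corner_snd p, ← Category.assoc, sq.fac_right, pullback.lift_snd]

end pathSection

end Comparison

/-! ### The Quillen equivalence -/

section HomotopyLifting

open Limits SSet

variable {C : Type u} [Category.{v} C] [SimplicialCategory C] {A B E D : C}

/-- The lifting property of `p` against the inclusion of `A`, as the free end, in the mapping
cylinder of `η`, phrased without tensors: given a map `y` on `B`, a homotopy `h` from `η ≫ y` and
a lift `x` of its end, both `y` and `h` lift to `E` compatibly. -/
def HasHomotopyLiftingProperty (η : A ⟶ B) (p : E ⟶ D) : Prop :=
  ∀ (x : A ⟶ E) (y : B ⟶ D) (h : (Δ[1] : SSet.{v}) ⟶ sHom A D),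
    endpoint h 0 = η ≫ y → endpoint h 1 = x ≫ p →
    ∃ (f : B ⟶ E) (h' : (Δ[1] : SSet.{v}) ⟶ sHom A E),
      endpoint h' 0 = η ≫ f ∧ endpoint h' 1 = x ∧ f ≫ p = y ∧ h' ≫ eHomWhiskerLeft SSet.{v} _ p = h

lemma HasHomotopyLiftingProperty.hasLiftingProperty {η : A ⟶ B} {p : E ⟶ D}
    (hp : HasHomotopyLiftingProperty η p) (T : SimplicialTensor C) [HasPushout η (T.cylι A 0)] :
    HasLiftingProperty (T.cylι A 1 ≫ pushout.inr η (T.cylι A 0)) p := by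
  have hpo := IsPushout.of_hasPushout η (T.cylι A 0)
  refine ⟨fun {x y} sq ↦ ?_⟩
  obtain ⟨f, h, hf, hx, hy, hh⟩ := hp x (pushout.inl _ _ ≫ y)
    (T.homEquiv _ _ _ (pushout.inr _ _ ≫ y))
    (by rw [← T.cylι_comp, ← Category.assoc, ← hpo.w, Category.assoc])
    (by rw [← T.cylι_comp, ← Category.assoc, ← sq.w])
  refine ⟨⟨⟨hpo.desc f ((T.homEquiv _ _ _).symm h) ?_, ?_, hpo.hom_ext ?_ ?_⟩⟩⟩
  · rw [← T.endpoint_eq, hf]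
  · rw [Category.assoc, IsPushout.inr_desc, ← T.endpoint_eq, hx]
  · rw [← Category.assoc, IsPushout.inl_desc, hy]
  · rw [← Category.assoc, IsPushout.inr_desc]
    apply (T.homEquiv _ _ _).injective
    rw [T.homEquiv_comp, Equiv.apply_symm_apply, hh]

lemma IsSimplicialModelCategory.weakEquivalence_of_hasHomotopyLiftingProperty [ModelCategory C]
    (hC : IsSimplicialModelCategory C) (η : A ⟶ B) [IsCofibrant A]
    (hη : ∀ ⦃E D : C⦄ (p : E ⟶ D) [Fibration p], HasHomotopyLiftingProperty η p) :
    WeakEquivalence η := by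
  let T := hC.tensor
  have hpo := IsPushout.of_hasPushout η (T.cylι A 0)
  have hι (i : Fin 2) := hC.trivialCofibrations_cylι T A i
  have hinl : trivialCofibrations _ (pushout.inl η (T.cylι A 0)) := by
    have h := hι 0
    rw [← fibrations_llp] at h ⊢
    exact MorphismProperty.of_isPushout hpo h
  have hinr : trivialCofibrations _ (T.cylι A 1 ≫ pushout.inr η (T.cylι A 0)) := by
    rw [← fibrations_llp]
    intro E D p hp
    have : Fibration p := ⟨hp⟩
    exact (hη p).hasLiftingProperty T
  have : WeakEquivalence (T.cylι A 0) := ⟨(hι 0).2⟩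
  have : WeakEquivalence (T.cylι A 1) := ⟨(hι 1).2⟩
  have : WeakEquivalence (pushout.inl η (T.cylι A 0)) := ⟨hinl.2⟩
  have : WeakEquivalence (pushout.inr η (T.cylι A 0)) :=
    (weakEquivalence_precomp_iff (T.cylι A 1) _).1 ⟨hinr.2⟩
  refine (weakEquivalence_postcomp_iff η (pushout.inl η (T.cylι A 0))).1 ?_
  rw [hpo.w]
  infer_instance

end HomotopyLifting

section QuillenEquivalence

open Limits SSet Opposite SimplicialSection

section

variable {I : Type u'} [Category.{v} I] {M : SimplicialQuillenPresheaf.{v, u} I}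
  {J : Type v} [Category.{v} J] [SimplicialCategory J] {φ : FunctorToOrdinary J I}
  [∀ i, HasProducts.{v} (M.fiber i)] {k : J} {X : SimplicialSection M φ}

namespace cofreePath

variable (X) in
/-- Maps to `cofreePath` as simplicial homotopies of maps to `E`. -/
def homEquiv (E : M.fiber (φ.obj k)) :
    (X ⟶ cofreePath M φ k E) ≃ ((Δ[1] : SSet.{v}) ⟶ sHom (X.obj k) E) :=
  ((evAdjCofree M φ k).homEquiv _ _).symm.trans ((M.isCotensored _).homEquiv _ _ _)

variable {E D : M.fiber (φ.obj k)}

lemma endpoint_homEquiv (T : X ⟶ cofreePath M φ k E) (i : Fin 2) :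
    endpoint (homEquiv X E T) i =
      ((evAdjCofree M φ k).homEquiv _ _).symm (T ≫ eval φ E i) := by
  refine ((congrArg (endpoint · i) ((M.isCotensored _).homEquiv_apply _)).trans
    (endpoint_comp_eHomWhiskerRight _ _ i)).trans ?_
  exact (Adjunction.homEquiv_naturality_right_symm _ _ _).symm

lemma homEquiv_comp_map (p : E ⟶ D) (T : X ⟶ cofreePath M φ k E) :
    homEquiv X D (T ≫ map φ p) = homEquiv X E T ≫ eHomWhiskerLeft SSet.{v} _ p := by
  have h := Adjunction.homEquiv_naturality_right_symm (evAdjCofree M φ k) T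
    ((M.isCotensored _).cotensorMap Δ[1] p)
  refine (congrArg ((M.isCotensored _).homEquiv _ _ _) h).trans ?_
  rw [IsCotensored.homEquiv_apply, eHomWhiskerRight_comp, ← Category.assoc,
    IsCotensored.counit_comp_eHomWhiskerRight_cotensorMap, Category.assoc,
    eHom_whisker_exchange, ← Category.assoc, ← IsCotensored.homEquiv_apply]
  rfl

end cofreePath

end

variable {I : Type u'} [Category.{v} I] {M : SimplicialQuillenPresheaf.{v, u} I}
  {J : Type v} [Category.{v} J] [SimplicialCategory J]
  {J' : Type v} [Category.{v} J'] [SimplicialCategory J']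
  {φ' : FunctorToOrdinary J' I} {ψ : EnrichedFunctor SSet.{v} J J'}
  {L : SimplicialSection M (φ'.precomp ψ) ⥤ SimplicialSection M φ'} (adj : L ⊣ restriction M φ' ψ)

section

variable [∀ i, HasProducts.{v} (M.fiber i)] {X : SimplicialSection M (φ'.precomp ψ)} {k : J}
  {E D : M.fiber (φ'.obj (ψ.obj k))}

/-- Maps to the restriction of a cofree section, as maps out of the value of `L.obj X`. -/
def restrictionCofreeEquiv :
    (X ⟶ (restriction M φ' ψ).obj ((cofree M φ' (ψ.obj k)).obj E)) ≃
      ((L.obj X).obj (ψ.obj k) ⟶ E) :=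
  (adj.homEquiv _ _).symm.trans ((evAdjCofree M φ' (ψ.obj k)).homEquiv _ _).symm

lemma restrictionCofreeEquiv_comp_map
    (T : X ⟶ (restriction M φ' ψ).obj ((cofree M φ' (ψ.obj k)).obj E)) (p : E ⟶ D) :
    restrictionCofreeEquiv adj (T ≫ (restriction M φ' ψ).map ((cofree M φ' (ψ.obj k)).map p)) =
      restrictionCofreeEquiv adj T ≫ p :=
  (congrArg ((evAdjCofree M φ' (ψ.obj k)).homEquiv _ _).symm
    (Adjunction.homEquiv_naturality_right_symm adj _ _)).trans
    (Adjunction.homEquiv_naturality_right_symm _ _ _)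

namespace pathSection

/-- The map out of `L.obj X` underlying a map to `pathSection`. -/
def homFst (z : X ⟶ pathSection ψ k E) : (L.obj X).obj (ψ.obj k) ⟶ E :=
  restrictionCofreeEquiv adj (z ≫ fst ψ E)

/-- The homotopy underlying a map to `pathSection`; it starts at the restriction of `homFst` along
the unit. -/
def homSnd (z : X ⟶ pathSection ψ k E) : (Δ[1] : SSet.{v}) ⟶ sHom (X.obj k) E :=
  cofreePath.homEquiv X E (z ≫ snd ψ E)

lemma endpoint_zero_homSnd (z : X ⟶ pathSection ψ k E) :
    endpoint (homSnd z) 0 = Hom.app (adj.unit.app X) k ≫ homFst adj z := by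
  have hz : (z ≫ snd ψ E) ≫ cofreePath.eval (φ'.precomp ψ) E 0 =
      (z ≫ fst ψ E) ≫ comparison ψ k E := by
    rw [Category.assoc, Category.assoc, (isPullback ψ E).w]
  exact ((cofreePath.endpoint_homEquiv (z ≫ snd ψ E) 0).trans (congrArg _ hz)).trans
    (homEquiv_symm_comp_comparison adj (z ≫ fst ψ E))

lemma endpoint_one_homSnd (z : X ⟶ pathSection ψ k E) :
    endpoint (homSnd z) 1 =
      ((evAdjCofree M (φ'.precomp ψ) k).homEquiv _ _).symm (z ≫ finish ψ E) :=
  (cofreePath.endpoint_homEquiv (z ≫ snd ψ E) 1).trans (by rw [Category.assoc, finish])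

lemma homFst_comp_map (z : X ⟶ pathSection ψ k E) (p : E ⟶ D) :
    homFst adj (z ≫ map ψ p) = homFst adj z ≫ p := by
  rw [homFst, Category.assoc, map_fst, ← Category.assoc, restrictionCofreeEquiv_comp_map, homFst]

lemma homSnd_comp_map (z : X ⟶ pathSection ψ k E) (p : E ⟶ D) :
    homSnd (z ≫ map ψ p) = homSnd z ≫ eHomWhiskerLeft SSet.{v} _ p := by
  have hz : (z ≫ map ψ p) ≫ snd ψ D = (z ≫ snd ψ E) ≫ cofreePath.map (φ'.precomp ψ) p := by
    rw [Category.assoc, map_snd, Category.assoc]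
  exact (congrArg (cofreePath.homEquiv X D) hz).trans
    (cofreePath.homEquiv_comp_map (φ := φ'.precomp ψ) p (z ≫ snd ψ E))

lemma exists_hom (f : (L.obj X).obj (ψ.obj k) ⟶ E) (h : (Δ[1] : SSet.{v}) ⟶ sHom (X.obj k) E)
    (h₀ : endpoint h 0 = Hom.app (adj.unit.app X) k ≫ f) :
    ∃ z : X ⟶ pathSection ψ k E, homFst adj z = f ∧ homSnd z = h := by
  have hw : (restrictionCofreeEquiv adj).symm f ≫ comparison ψ k E =
      (cofreePath.homEquiv X E).symm h ≫ cofreePath.eval (φ'.precomp ψ) E 0 := by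
    apply ((evAdjCofree M (φ'.precomp ψ) k).homEquiv _ _).symm.injective
    have h₁ := cofreePath.endpoint_homEquiv ((cofreePath.homEquiv X E).symm h) 0
    rw [Equiv.apply_symm_apply] at h₁
    refine (homEquiv_symm_comp_comparison adj _).trans (Eq.trans ?_ (h₀.symm.trans h₁))
    exact congrArg (Hom.app (adj.unit.app X) k ≫ ·)
      ((restrictionCofreeEquiv adj).apply_symm_apply f)
  refine ⟨(isPullback ψ E).lift _ _ hw, ?_, ?_⟩
  · rw [homFst, IsPullback.lift_fst, Equiv.apply_symm_apply]
  · rw [homSnd, IsPullback.lift_snd]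
    exact Equiv.apply_symm_apply _ _

end pathSection

variable [∀ i, HasCoproducts.{v} (M.fiber i)]

lemma hasHomotopyLiftingProperty_unit_app
    {P : ModelCategory (SimplicialSection M (φ'.precomp ψ))}
    (hP : IsProjective P) [IsCofibrant X] (hψ : ∀ j, IsWeakHomotopyEquivalence (ψ.map j k))
    (p : E ⟶ D) [Fibration p] :
    HasHomotopyLiftingProperty (B := (L.obj X).obj (ψ.obj k)) (Hom.app (adj.unit.app X) k) p := by
  intro x y h h₀ h₁
  obtain ⟨w, rfl, rfl⟩ := pathSection.exists_hom adj y h h₀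
  let e {F : M.fiber (φ'.obj (ψ.obj k))} := (evAdjCofree M (φ'.precomp ψ) k).homEquiv X F
  have hw : w ≫ pathSection.finish ψ D = e x ≫ (cofree M (φ'.precomp ψ) k).map p := by
    apply e.symm.injective
    refine ((pathSection.endpoint_one_homSnd w).symm.trans h₁).trans ?_
    refine Eq.trans ?_ (Adjunction.homEquiv_naturality_right_symm
      (evAdjCofree M (φ'.precomp ψ) k) (e x) p).symm
    exact congrArg (· ≫ p) (e.symm_apply_apply x).symm
  obtain ⟨z, rfl, hz⟩ := pathSection.exists_lift p hP hψ w (e x) hw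
  refine ⟨pathSection.homFst adj z, pathSection.homSnd z, pathSection.endpoint_zero_homSnd adj z,
    ?_, (pathSection.homFst_comp_map adj z p).symm, (pathSection.homSnd_comp_map z p).symm⟩
  rw [pathSection.endpoint_one_homSnd, hz]
  exact e.symm_apply_apply x

end

variable [∀ i, HasProducts.{v} (M.fiber i)] [∀ i, HasCoproducts.{v} (M.fiber i)]
  {P : ModelCategory (SimplicialSection M (φ'.precomp ψ))} (hP : IsProjective P)
  (X : SimplicialSection M (φ'.precomp ψ)) [IsCofibrant X] {k : J}
  (hψ : ∀ j, IsWeakHomotopyEquivalence (ψ.map j k))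

include hP hψ in
lemma weakEquivalence_unit_app : WeakEquivalence (Hom.app (adj.unit.app X) k) := by
  have : IsCofibrant (C := M.fiber (φ'.obj (ψ.obj k))) (X.obj k) := hP.isCofibrant_obj X k
  exact (M.isSimplicialModelCategory _).weakEquivalence_of_hasHomotopyLiftingProperty
    (A := X.obj k) (B := (L.obj X).obj (ψ.obj k)) _
    fun _ _ p _ ↦ hasHomotopyLiftingProperty_unit_app adj hP hψ p

lemma isQuillenEquivalence_restriction {P' : ModelCategory (SimplicialSection M φ')}
    (hP : IsProjective P) (hP' : IsProjective P') (hψ : IsDwyerKanEquivalence ψ) :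
    IsQuillenEquivalence adj where
  isQuillenAdjunction := isQuillenAdjunction_restriction φ' ψ hP hP' adj
  weakEquivalence_iff X Y f _ _ := by
    have h (j : J) : WeakEquivalence (Hom.app (adj.homEquiv X Y f) j) ↔
        WeakEquivalence (Hom.app f (ψ.obj j)) := by
      have := weakEquivalence_unit_app adj hP X (k := j) fun j ↦ hψ.map_weakEquivalence j _
      rw [Adjunction.homEquiv_unit]
      exact weakEquivalence_precomp_iff (Hom.app (adj.unit.app X) j) (Hom.app f (ψ.obj j))
    rw [hP'.weakEquivalence_iff, hP.weakEquivalence_iff]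
    refine ⟨fun hf j ↦ (h j).2 (hf _), fun hf j' ↦ ?_⟩
    obtain ⟨j, g, hg⟩ := hψ.exists_obj j'
    exact hP'.weakEquivalence_app_of_isHomotopyInvertible f hg ((h j).1 (hf j))

end QuillenEquivalence

end

end SimplicialSections

theorem propositionp {I : Type u'} [Category.{v} I]
    (M : SimplicialSections.SimplicialQuillenPresheaf.{v, u} I)
    (hM : ∀ i : I, SimplicialSections.IsCombinatorial (M.fiber i))
    {J : Type v} [Category.{v} J] [SimplicialCategory J]
    {J' : Type v} [Category.{v} J'] [SimplicialCategory J']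
    (φ' : SimplicialSections.FunctorToOrdinary J' I) (ψ : EnrichedFunctor SSet.{v} J J') :
    ∃ (P : ModelCategory (SimplicialSections.SimplicialSection M (φ'.precomp ψ)))
      (P' : ModelCategory (SimplicialSections.SimplicialSection M φ')),
      SimplicialSections.SimplicialSection.IsProjective P ∧
      SimplicialSections.SimplicialSection.IsProjective P' ∧
      (SimplicialSections.SimplicialSection.restriction M φ' ψ).IsRightAdjoint ∧
      ∀ (L : SimplicialSections.SimplicialSection M (φ'.precomp ψ) ⥤
          SimplicialSections.SimplicialSection M φ')
        (adj : L ⊣ SimplicialSections.SimplicialSection.restriction M φ' ψ),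
        SimplicialSections.IsQuillenAdjunction adj ∧
        (SimplicialSections.IsDwyerKanEquivalence ψ →
          SimplicialSections.IsQuillenEquivalence adj) := by
  have hP := SimplicialSections.isProjective_projectiveModelCategory M (φ'.precomp ψ) hM
  have hP' := SimplicialSections.isProjective_projectiveModelCategory M φ' hM
  refine ⟨SimplicialSections.projectiveModelCategory M (φ'.precomp ψ) hM,
    SimplicialSections.projectiveModelCategory M φ' hM, hP, hP',
    SimplicialSections.isRightAdjoint_restriction (fun i ↦ (hM i).isLocallyPresentable) φ' ψ,
    fun L adj ↦ ⟨SimplicialSections.isQuillenAdjunction_restriction φ' ψ hP hP' adj, fun hψ ↦ ?_⟩⟩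
  have hp (i : I) := SimplicialSections.hasLimits_of_isLocallyPresentable _
    (hM i).isLocallyPresentable
  have hc (i : I) := SimplicialSections.hasColimits_of_isLocallyPresentable _
    (hM i).isLocallyPresentable
  have (i : I) : Limits.HasProducts.{v} (M.fiber i) := fun _ ↦ inferInstance
  have (i : I) : Limits.HasCoproducts.{v} (M.fiber i) := fun _ ↦ inferInstance
  exact SimplicialSections.isQuillenEquivalence_restriction adj hP hP' hψ
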